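/- **Setting.** For each sample size $n$ let $d,m,s,s_0$ be integers depending on $n$ with $1\le s\le m$, $1\le s_0\le d$, let $X\in\mathbb R^{n\times dm}$ be a fixed design whose columns are indexed by $(i,j)\in[d]\times[m]$ ($i$-th variable of the $j$-th group $G_j$) and have Euclidean norm $\sqrt n$, and let $Y=X\beta^*+\sigma\xi$ with $\sigma>0$ fixed, where $\xi_1,\dots,\xi_n$ are independent, $\mathbf E e^{\lambda\xi_k}\le e^{\lambda^2/2}$ for all $\lambda\in\mathbb R$, and $\mathrm{Var}(\xi_k)=c_\xi$ for all $k$ and $n$. For real $a,b$ let $\Theta(a,b)$ be the set of $\beta\in\mathbb R^{dm}$ with at most $a$ nonzero groups and at most $ab$ nonzero entries, and $\mathcal S(a,b)$ the set of supports of its elements. $X$ satisfies DSRIP$(a,b,\delta)$ if $n(1-\delta)\|u\|_2^2\le\|X_Su\|_2^2\le n(1+\delta)\|u\|_2^2$ for all $S\in\mathcal S(a,b)$ and $u\in\mathbb R^{|S|}\setminus\{0\}$. Let $S^*$ be the support of $\beta^*$, $G^*$ the set of its nonzero groups, and $B_{S^*}$ the maximal Euclidean row norm of $X_{S^*}$.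 Fix $0<\delta<\kappa<1$ and put $$C_\lambda=\sqrt{40}\,\frac{\kappa+(\sqrt3-1)\delta}{\kappa-\delta},\quad A_0=\frac{8\delta^2}{(\kappa-\delta)^2},\quad \bar A=\frac{\lceil A_0s\rceil}{s},\quad \Delta(s,s_0)=\frac1{s_0}\log\frac{em}{s}+\log\frac{ed}{s_0},$$ $$\lambda_{(\infty)}=C_\lambda\sigma\sqrt{\frac{\Delta(s,s_0)}n},\qquad \mu=\max\Big\{\frac{\kappa C_\lambda}\delta,\sqrt{40+\tfrac{120\delta^2}{(1-\delta)^2}}\Big\}\sqrt{\frac{\sigma^2}n\Big\{\frac{\log(em)}{s_0}+\log(esd)\Big\}}$$ (so $\bar A=A_0$ whenever $A_0s$ is an integer). **Estimator.** $\mathcal T_{\lambda,s_0}$ first sets to zero all entries with $|\beta_{ij}|<\lambda$, and then all groups whose remaining squared norm is less than $s_0\lambda^2$. First stage: $\hat\beta^0=0$, $\lambda_{(0)}=\big(\|X^\top Y/n\|_\infty+\sqrt{10\sigma^2\log(dm)/n}\big)/(\sqrt2\kappa)$; while $t\le\lceil\log(\lambda_{(\infty)}/\lambda_{(0)})/\log\kappa\rceil$,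 set $\hat\beta^{t+1}=\mathcal T_{\lambda_{(t)},s_0}\big(\hat\beta^t+\frac1nX^\top(Y-X\hat\beta^t)\big)$, $\lambda_{(t+1)}=\max(\kappa\lambda_{(t)},\lambda_{(\infty)})$, and increase $t$ by one. Second stage: $\tilde\beta^0$ is the output of the first stage and $\tilde\beta^{t+1}=\mathcal T_{\mu,s_0}\big(\tilde\beta^t+\frac1nX^\top(Y-X\tilde\beta^t)\big)$. **Theorem (asymptotic normality).** For every $\delta\in(0,1)$ there is a constant $C_\delta>0$, depending only on $\delta$, such that the following holds for all $\kappa\in(\delta,1)$. Assume that for all large $n$: $\beta^*\in\Theta(s,s_0)$; $X$ satisfies DSRIP$\big((1+2\bar A)s,\frac{1+4\bar A}{1+2\bar A}s_0,\delta\big)$; and $$\min_{(i,j)\in S^*}|\beta^*_{ij}|\ge\Big(2+\frac{\sqrt6\,\delta}{1-\delta}\Big)\mu,\qquad \min_{j\in G^*}\|\beta^*_{G_j}\|_2\ge\Big(2+\frac{\sqrt6\,\delta}{1-\delta}\Big)\sqrt{s_0}\,\mu .$$ Assume also that, as $n\to\infty$, $d\to\infty$, $m\to\infty$, $ss_0\Delta(s,s_0)=O(n)$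 and $B_{S^*}^3=o(\sqrt n)$. Let $t=t_n\ge C_\delta\log n$ for all large $n$. Then for each fixed $K$ and matrices $A=A_n\in\mathbb R^{K\times|S^*|}$, as $n\to\infty$, $$\sqrt n\,A\big(\tilde\beta^{t}_{S^*}-\beta^*_{S^*}\big)\ \to\ N\Big(0,\ c_\xi\sigma^2A\big(\tfrac1nX_{S^*}^\top X_{S^*}\big)^{-1}A^\top\Big)$$ in distribution, in the following sense (the law on the right depends on $n$). (i) If the rows of the matrices $A_n$ are bounded in Euclidean norm uniformly in $n$, then for every bounded continuous $f:\mathbb R^K\to\mathbb R$ the difference of the expectations of $f$ under the law of the left side and under the Gaussian law on the right tends to $0$. (ii) For every sequence $A_n$ such that $A_n(\frac1nX_{S^*}^\top X_{S^*})^{-1}A_n^\top$ converges to some $V$, the left side converges in distribution to $N(0,c_\xi\sigma^2V)$. Moreover (i) and (ii) also hold with $\tilde\beta^t_{S^*}$ replaced by the oracle least squares estimator $(X_{S^*}^\top X_{S^*})^{-1}X_{S^*}^\top Y$; that is, both estimators have the same limit law. -/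

import Mathlib

open MeasureTheory ProbabilityTheory Filter Topology Asymptotics
open scoped Matrix BoundedContinuousFunction

namespace DoubleSparse

noncomputable section

/-- Coordinates: `(i, j)` is the `i`-th variable of the `j`-th group, for `m` groups of size `d`. -/
abbrev Idx (d m : ℕ) : Type := Fin d × Fin m

/-- The set of nonzero coordinates of `β`. -/
def supp {d m : ℕ} (β : Idx d m → ℝ) : Finset (Idx d m) :=
  Finset.univ.filter fun p => β p ≠ 0

/-- The set of groups on which `β` does not vanish identically. -/
def groupSupp {d m : ℕ} (β : Idx d m → ℝ) : Finset (Fin m) :=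
  Finset.univ.filter fun j => ∃ i, β (i, j) ≠ 0

/-- The double sparse space `Θ(a, b)`: at most `a` nonzero groups, at most `a * b` nonzero
entries. -/
def paramSpace (d m : ℕ) (a b : ℝ) : Set (Idx d m → ℝ) :=
  {β | ((groupSupp β).card : ℝ) ≤ a ∧ ((supp β).card : ℝ) ≤ a * b}

/-- `𝒮(a, b)`: the supports of the vectors of `Θ(a, b)`. -/
def supportClass (d m : ℕ) (a b : ℝ) : Set (Finset (Idx d m)) :=
  {S | ∃ β ∈ paramSpace d m a b, supp β = S}

/-- The columns of `X` indexed by `S`. -/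
def subMatrix {n d m : ℕ} (X : Matrix (Fin n) (Idx d m) ℝ) (S : Finset (Idx d m)) :
    Matrix (Fin n) S ℝ :=
  X.submatrix id Subtype.val

/-- The double sparse restricted isometry property `DSRIP(a, b, δ)`. -/
def DSRIP {n d m : ℕ} (X : Matrix (Fin n) (Idx d m) ℝ) (a b δ : ℝ) : Prop :=
  ∀ S ∈ supportClass d m a b, ∀ u : S → ℝ, u ≠ 0 →
    (n : ℝ) * (1 - δ) * ∑ q, u q ^ 2 ≤ ∑ k, ((subMatrix X S *ᵥ u) k) ^ 2 ∧
    ∑ k, ((subMatrix X S *ᵥ u) k) ^ 2 ≤ (n : ℝ) * (1 + δ) * ∑ q, u q ^ 2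

/-- `Δ(s, s₀) = (1 / s₀) log (e m / s) + log (e d / s₀)`. -/
def Delta (d m s s₀ : ℕ) : ℝ :=
  1 / (s₀ : ℝ) * Real.log (Real.exp 1 * m / s) + Real.log (Real.exp 1 * d / s₀)

/-- The constant `C_λ(κ, δ)`. -/
def Clam (κ δ : ℝ) : ℝ :=
  Real.sqrt 40 * ((κ + (Real.sqrt 3 - 1) * δ) / (κ - δ))

/-- The constant `A(κ, δ)`. -/
def Acst (κ δ : ℝ) : ℝ :=
  8 * δ ^ 2 / (κ - δ) ^ 2

/-- `A(κ, δ)` increased as little as possible so that its product with `s` is an integer: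
`⌈A s⌉ / s`. It is `A(κ, δ)` itself whenever `A s` is an integer. -/
def Around (κ δ : ℝ) (s : ℕ) : ℝ :=
  (⌈Acst κ δ * s⌉₊ : ℝ) / s

/-- The floor `λ_(∞)` of the first-stage thresholds. -/
def lamInf (κ δ σ : ℝ) (n d m s s₀ : ℕ) : ℝ :=
  Clam κ δ * σ * Real.sqrt (Delta d m s s₀ / n)

/-- The fixed threshold `μ` of the second stage. -/
def muThr (κ δ σ : ℝ) (n d m s s₀ : ℕ) : ℝ :=
  max (κ * Clam κ δ / δ) (Real.sqrt (40 + 120 * δ ^ 2 / (1 - δ) ^ 2)) *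
    Real.sqrt (σ ^ 2 / n *
      (Real.log (Real.exp 1 * m) / s₀ + Real.log (Real.exp 1 * s * d)))

/-- The element-wise thresholding operator. -/
def thrElem {d m : ℕ} (lam : ℝ) (β : Idx d m → ℝ) : Idx d m → ℝ :=
  fun p => if lam ≤ |β p| then β p else 0

/-- The group-wise thresholding operator. -/
def thrGroup {d m : ℕ} (lam : ℝ) (s₀ : ℕ) (β : Idx d m → ℝ) : Idx d m → ℝ :=
  fun p => if (s₀ : ℝ) * lam ^ 2 ≤ ∑ i, β (i, p.2) ^ 2 then β p else 0

/-- The double sparse hard thresholding operator. -/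
def thr {d m : ℕ} (lam : ℝ) (s₀ : ℕ) (β : Idx d m → ℝ) : Idx d m → ℝ :=
  thrGroup lam s₀ (thrElem lam β)

/-- The gradient step `β + (1 / n) Xᵀ (Y - X β)`. -/
def gradStep {n d m : ℕ} (X : Matrix (Fin n) (Idx d m) ℝ) (Y : Fin n → ℝ) (β : Idx d m → ℝ) :
    Idx d m → ℝ :=
  β + (1 / (n : ℝ)) • (Xᵀ *ᵥ (Y - X *ᵥ β))

/-- The initial threshold `λ_(0)` of the first stage; the norm of a function on the finite type
`Idx d m` is the maximum norm. -/
def lamZero {n d m : ℕ} (X : Matrix (Fin n) (Idx d m) ℝ) (Y : Fin n → ℝ) (κ σ : ℝ) : ℝ :=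
  (‖(1 / (n : ℝ)) • (Xᵀ *ᵥ Y)‖ + Real.sqrt (10 * σ ^ 2 * Real.log ((d : ℝ) * m) / n)) /
    (Real.sqrt 2 * κ)

/-- The first-stage thresholds `λ_(t)`. -/
def lamSeq (κ lam₀ lamInfty : ℝ) : ℕ → ℝ
  | 0 => lam₀
  | t + 1 => max (κ * lamSeq κ lam₀ lamInfty t) lamInfty

/-- The first-stage (DSIHT) iterates, started at `0`. -/
def dsihtIter {n d m : ℕ} (X : Matrix (Fin n) (Idx d m) ℝ) (Y : Fin n → ℝ)
    (κ lam₀ lamInfty : ℝ) (s₀ : ℕ) : ℕ → Idx d m → ℝ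
  | 0 => 0
  | t + 1 => thr (lamSeq κ lam₀ lamInfty t) s₀
      (gradStep X Y (dsihtIter X Y κ lam₀ lamInfty s₀ t))

/-- The output of the first stage. The loop body runs for `t = 0, 1, …` as long as
`t ≤ ⌈log (λ_(∞) / λ_(0)) / log κ⌉`, so the counter ends at that number plus one
(at `0` if the number is negative). -/
def dsiht {n d m : ℕ} (X : Matrix (Fin n) (Idx d m) ℝ) (Y : Fin n → ℝ)
    (κ σ lamInfty : ℝ) (s₀ : ℕ) : Idx d m → ℝ :=
  dsihtIter X Y κ (lamZero X Y κ σ) lamInfty s₀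
    (⌈Real.log (lamInfty / lamZero X Y κ σ) / Real.log κ⌉ + 1).toNat

/-- The second-stage iterates with fixed threshold `μ`, started at `β₀`. -/
def secondStage {n d m : ℕ} (X : Matrix (Fin n) (Idx d m) ℝ) (Y : Fin n → ℝ)
    (μ : ℝ) (s₀ : ℕ) (β₀ : Idx d m → ℝ) : ℕ → Idx d m → ℝ
  | 0 => β₀
  | t + 1 => thr μ s₀ (gradStep X Y (secondStage X Y μ s₀ β₀ t))

/-- The two-stage DSIHT iterates, with the prescribed `λ_(∞)` and `μ`. -/
def twoStage {n d m : ℕ} (X : Matrix (Fin n) (Idx d m) ℝ) (Y : Fin n → ℝ)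
    (κ δ σ : ℝ) (s s₀ t : ℕ) : Idx d m → ℝ :=
  secondStage X Y (muThr κ δ σ n d m s s₀) s₀
    (dsiht X Y κ σ (lamInf κ δ σ n d m s s₀) s₀) t

/-- The linear model `Y = X β* + σ ξ`. -/
def response {n d m : ℕ} (X : Matrix (Fin n) (Idx d m) ℝ) (β : Idx d m → ℝ) (σ : ℝ)
    (ξ : Fin n → ℝ) : Fin n → ℝ :=
  X *ᵥ β + σ • ξ

/-- The restriction to `S` of the least squares estimator that knows the support `S`. -/
def oracleOLS {n d m : ℕ} (X : Matrix (Fin n) (Idx d m) ℝ) (Y : Fin n → ℝ)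
    (S : Finset (Idx d m)) : S → ℝ :=
  ((subMatrix X S)ᵀ * subMatrix X S)⁻¹ *ᵥ ((subMatrix X S)ᵀ *ᵥ Y)

/-- `((1 / n) X_Sᵀ X_S)⁻¹`. -/
def invGram {n d m : ℕ} (X : Matrix (Fin n) (Idx d m) ℝ) (S : Finset (Idx d m)) :
    Matrix S S ℝ :=
  ((1 / (n : ℝ)) • ((subMatrix X S)ᵀ * subMatrix X S))⁻¹

/-- `B_S`: the maximal Euclidean norm of a row of `X_S`. -/
def maxRowNorm {n d m : ℕ} (X : Matrix (Fin n) (Idx d m) ℝ) (S : Finset (Idx d m)) : ℝ :=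
  ⨆ k : Fin n, Real.sqrt (∑ q, subMatrix X S k q ^ 2)

/-- The conditions at a single sample size: ranges of `s` and `s₀`, double sparsity of `β`,
standardized columns, DSRIP, and the two minimum signal conditions. -/
structure Conditions {n d m : ℕ} (X : Matrix (Fin n) (Idx d m) ℝ) (β : Idx d m → ℝ)
    (κ δ σ : ℝ) (s s₀ : ℕ) : Prop where
  one_le_s : 1 ≤ s
  s_le : s ≤ m
  one_le_s₀ : 1 ≤ s₀
  s₀_le : s₀ ≤ d
  sparse : β ∈ paramSpace d m s s₀
  columns : ∀ p, Real.sqrt (∑ k, X k p ^ 2) = Real.sqrt n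
  dsrip : DSRIP X ((1 + 2 * Around κ δ s) * s)
    ((1 + 4 * Around κ δ s) / (1 + 2 * Around κ δ s) * s₀) δ
  elementSignal : ∀ p ∈ supp β,
    (2 + Real.sqrt 6 * δ / (1 - δ)) * muThr κ δ σ n d m s s₀ ≤ |β p|
  groupSignal : ∀ j ∈ groupSupp β,
    (2 + Real.sqrt 6 * δ / (1 - δ)) * Real.sqrt s₀ * muThr κ δ σ n d m s s₀ ≤
      Real.sqrt (∑ i, β (i, j) ^ 2)

/-- Convergence of the law of `W n` to the `n`-dependent law `N(0, Γ n)`, tested on bounded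
continuous functions. -/
def MergesWithGaussian {Ω : ℕ → Type*} [∀ n, MeasurableSpace (Ω n)] (P : ∀ n, Measure (Ω n))
    {K : ℕ} (W : ∀ n, Ω n → EuclideanSpace ℝ (Fin K)) (Γ : ℕ → Matrix (Fin K) (Fin K) ℝ) :
    Prop :=
  (∀ n, AEMeasurable (W n) (P n)) ∧
  ∀ f : EuclideanSpace ℝ (Fin K) →ᵇ ℝ,
    Tendsto (fun n => ∫ ω, f (W n ω) ∂(P n) - ∫ x, f x ∂(multivariateGaussian 0 (Γ n)))
      atTop (𝓝 0)

/-- `A Z` is asymptotically `N(0, v A G Aᵀ)` for matrices `A` with a fixed number `K` of rows,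
where the random vectors `Z n` and the matrices `G n` have an `n`-dependent, possibly growing
dimension. Since the Gaussian law depends on `n`, this means: its distance to the law of `A Z`
tends to `0` (weak topology) along bounded sequences of matrices `A`; and `A Z` converges in
distribution to `N(0, v V)` along arbitrary sequences of matrices `A` such that `A G Aᵀ`
converges to some `V` (for instance when `A` is standardized so that `A G Aᵀ` is the identity). -/
def AsymptoticallyNormal {Ω : ℕ → Type*} [∀ n, MeasurableSpace (Ω n)] (P : ∀ n, Measure (Ω n))
    [∀ n, IsProbabilityMeasure (P n)] {J : ℕ → Type} [∀ n, Fintype (J n)]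
    (Z : ∀ n, Ω n → J n → ℝ) (G : ∀ n, Matrix (J n) (J n) ℝ) (v : ℝ) : Prop :=
  ∀ (K : ℕ) (A : ∀ n, Matrix (Fin K) (J n) ℝ),
    ((∃ R : ℝ, ∀ n a, ∑ q, A n a q ^ 2 ≤ R) →
      MergesWithGaussian P (fun n ω => WithLp.toLp 2 (A n *ᵥ Z n ω))
        (fun n => v • (A n * G n * (A n)ᵀ))) ∧
    ∀ V : Matrix (Fin K) (Fin K) ℝ,
      Tendsto (fun n => A n * G n * (A n)ᵀ) atTop (𝓝 V) →
      TendstoInDistribution (fun n ω => WithLp.toLp 2 (A n *ᵥ Z n ω)) atTop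
        (id : EuclideanSpace ℝ (Fin K) → EuclideanSpace ℝ (Fin K)) P
        (multivariateGaussian 0 (v • V))

end

end DoubleSparse

/-!
The second stage started close to the truth converges to the oracle least squares estimator, which
knows the support and is linear in the noise; hence both have the limit law that the central limit
theorem gives for the oracle.

*Localization.* One step of thresholded gradient descent at `β` applies the thresholding operator to
`β* + (I - XᵀX/n) (β - β*) + Ξ`, where `Ξ = σ Xᵀ ξ / n`. On sparse supports `I - XᵀX/n` has norm at
most `δ`, by the restricted isometry property and polarization (`VecRIP.gap_mul_le`), and `Ξ` is of
the order of the threshold, simultaneously for all sparse supports. A coordinate or group kept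
outside the true support carries mass at least of the order of the squared threshold, so only few of
them can be kept (`smallExtras_thr`), and the error is at most `κ` times the previous radius
(`l2_thr_sub_le`, `StepData.near_thr`). The first stage therefore keeps the error below a multiple
of its decreasing threshold (`StepData.near_dsiht`). The number of extra groups and the way in which
supports are fitted into the restricted isometry class depend on the ratio of `κ` and `δ`
(`VecRIP.gapBound_direct`, `VecRIP.gapBound_two`, `VecRIP.gapBound_blocks`); in each of three
regimes explicit constants close the induction (`exists_tuned`).

*Contraction.* The oracle, extended by zero, exceeds the threshold `μ` on the true support by a
factor larger than `1`, and its residual is orthogonal to the true columns and has correlations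
below `μ` with the others. Expanded around the oracle, a step of the second stage is thus a
contraction (`FixedPoint.l2_thr_sub_le`, `StepData.secondStage_contract`), with a factor `rate δ`
below `1` that depends on `δ` only (`rate_lt_one`). This fixes the constant `1 / log (1 / rate δ)`: after
that many times `log n` steps the initial distance, bounded because `s s₀ Δ = O(n)`, has shrunk to
`O(1 / n)` (`GoodNoise.l2_twoStage_sub_le`, `tendsto_iteration_error`).

*Probability.* All requirements on the noise are bounds for norms of sub-Gaussian vectors, uniform
over families of supports. They follow from an exponential moment bound for quadratic forms
(`measure_sum_sq_ge_le`) and union bounds, and fail with a probability that vanishes as `d` and `m`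
grow (`measure_not_goodNoise_le_badBound`).

*Limit law.* Convergence is tested on characteristic functions of linear functionals with bounded
coefficients; covariance matrices stay in a compact set, so Lévy's theorem applies along
subsequences (`asymptoticallyNormal_of_functionals`). A functional of the oracle error is a linear
form `∑ b k * ξ k` with `max |b k|` of the order of `B / √n → 0`, where `B` is the maximal row norm,
and a third-order Taylor bound yields the Gaussian limit (`norm_integral_cexp_sum_sub_le`). The
two-stage error differs from it by `o(1)` off an event of vanishing probability
(`tendsto_integral_cexp_twoStageErr_sub`).
-/

namespace DoubleSparse

noncomputable section

/-! ### Euclidean norms and coordinate restrictions -/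

/-- The Euclidean norm of a real function on a finite type (the norm instance on functions is the
maximum norm). -/
def l2 {ι : Type*} [Fintype ι] (v : ι → ℝ) : ℝ := Real.sqrt (∑ i, v i ^ 2)

section l2

variable {ι : Type*} [Fintype ι]

lemma l2_eq_norm (v : ι → ℝ) : l2 v = ‖WithLp.toLp 2 v‖ := by
  simp [l2, EuclideanSpace.norm_eq]

lemma l2_nonneg (v : ι → ℝ) : 0 ≤ l2 v := Real.sqrt_nonneg _

lemma l2_sq (v : ι → ℝ) : l2 v ^ 2 = ∑ i, v i ^ 2 :=
  Real.sq_sqrt (Finset.sum_nonneg fun _ _ => sq_nonneg _)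

lemma l2_zero : l2 (0 : ι → ℝ) = 0 := by simp [l2]

lemma l2_add_le (u v : ι → ℝ) : l2 (u + v) ≤ l2 u + l2 v := by
  simp only [l2_eq_norm]; exact norm_add_le (WithLp.toLp 2 u) (WithLp.toLp 2 v)

lemma l2_smul (a : ℝ) (v : ι → ℝ) : l2 (a • v) = |a| * l2 v := by
  simp only [l2_eq_norm, WithLp.toLp_smul, norm_smul, Real.norm_eq_abs]

lemma l2_neg (v : ι → ℝ) : l2 (-v) = l2 v := by simp [l2]

lemma l2_sub_le (u v : ι → ℝ) : l2 (u - v) ≤ l2 u + l2 v := by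
  rw [sub_eq_add_neg, ← l2_neg v]; exact l2_add_le u (-v)

lemma abs_apply_le_l2 (v : ι → ℝ) (i : ι) : |v i| ≤ l2 v := by
  rw [← Real.sqrt_sq_eq_abs]
  exact Real.sqrt_le_sqrt (Finset.single_le_sum (f := fun i => v i ^ 2)
    (fun _ _ => sq_nonneg _) (Finset.mem_univ i))

lemma eq_zero_of_l2_eq_zero {v : ι → ℝ} (h : l2 v = 0) : v = 0 := by
  funext i
  have := abs_apply_le_l2 v i
  rw [h] at this
  simpa using le_antisymm this (abs_nonneg _)

lemma sum_mul_le_l2 (u v : ι → ℝ) : ∑ i, u i * v i ≤ l2 u * l2 v := by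
  refine (abs_le_of_sq_le_sq' ?_ (mul_nonneg (l2_nonneg u) (l2_nonneg v))).2
  rw [mul_pow, l2_sq, l2_sq]
  exact Finset.sum_mul_sq_le_sq_mul_sq _ _ _

end l2

/-- The restriction of `v` to the coordinates in `T`, extended by zero. -/
def res {ι : Type*} [DecidableEq ι] (T : Finset ι) (v : ι → ℝ) : ι → ℝ :=
  fun p => if p ∈ T then v p else 0

section res

variable {ι : Type*} [Fintype ι] [DecidableEq ι]

lemma l2_res_sq (T : Finset ι) (v : ι → ℝ) : l2 (res T v) ^ 2 = ∑ p ∈ T, v p ^ 2 := by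
  rw [l2_sq]
  simp [res, ite_pow, Finset.sum_ite_mem]

lemma l2_res_mono {T T' : Finset ι} (h : T ⊆ T') (v : ι → ℝ) : l2 (res T v) ≤ l2 (res T' v) := by
  refine Real.sqrt_le_sqrt (Finset.sum_le_sum fun i _ => ?_)
  unfold res; split_ifs with h1 h2
  · exact le_rfl
  · exact absurd (h h1) h2
  · simpa using sq_nonneg (v i)
  · exact le_rfl

lemma res_add {ι : Type*} [DecidableEq ι] (T : Finset ι) (u v : ι → ℝ) :
    res T (u + v) = res T u + res T v := by
  funext p; simp only [res, Pi.add_apply]; split_ifs <;> simp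

lemma res_eq_self {ι : Type*} [DecidableEq ι] {T : Finset ι} {v : ι → ℝ}
    (h : ∀ p, p ∉ T → v p = 0) : res T v = v := by
  funext p; unfold res; split_ifs with h1
  · rfl
  · exact (h p h1).symm

lemma sum_res_mul_self (T : Finset ι) (v : ι → ℝ) :
    ∑ p, v p * res T v p = l2 (res T v) ^ 2 := by
  rw [l2_sq]; refine Finset.sum_congr rfl fun p _ => ?_
  unfold res; split_ifs <;> ring

end res

/-! ### The restricted isometry property for vectors -/

section rip

variable {n d m : ℕ}

/-- The groups met by a set of coordinates. -/
def groups (T : Finset (Idx d m)) : Finset (Fin m) := T.image Prod.snd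

lemma groups_mono {T T' : Finset (Idx d m)} (h : T ⊆ T') : groups T ⊆ groups T' :=
  Finset.image_subset_image h

lemma groups_union (T T' : Finset (Idx d m)) : groups (T ∪ T') = groups T ∪ groups T' :=
  Finset.image_union _ _

lemma mem_supp {v : Idx d m → ℝ} {p : Idx d m} : p ∈ supp v ↔ v p ≠ 0 := by simp [supp]

lemma groupSupp_eq (v : Idx d m → ℝ) : groupSupp v = groups (supp v) := by
  ext j; simp [groupSupp, groups, supp]

/-- The restricted isometry property for vectors with at most `g` nonzero groups and at most `k`
nonzero entries. -/
def VecRIP (X : Matrix (Fin n) (Idx d m) ℝ) (g k : ℕ) (δ : ℝ) : Prop :=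
  ∀ u : Idx d m → ℝ, (groups (supp u)).card ≤ g → (supp u).card ≤ k →
    (n : ℝ) * (1 - δ) * ∑ p, u p ^ 2 ≤ ∑ i, ((X *ᵥ u) i) ^ 2 ∧
    ∑ i, ((X *ᵥ u) i) ^ 2 ≤ (n : ℝ) * (1 + δ) * ∑ p, u p ^ 2

lemma subMatrix_mulVec (X : Matrix (Fin n) (Idx d m) ℝ) (S : Finset (Idx d m))
    {u : Idx d m → ℝ} (hu : ∀ p, p ∉ S → u p = 0) :
    subMatrix X S *ᵥ (fun q : S => u q) = X *ᵥ u := by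
  funext i
  simp only [Matrix.mulVec, dotProduct, subMatrix, Matrix.submatrix_apply, id]
  rw [Finset.sum_coe_sort S (fun p => X i p * u p)]
  refine Finset.sum_subset (Finset.subset_univ _) fun p _ hp => ?_
  rw [hu p hp, mul_zero]

lemma sum_subtype_sq (S : Finset (Idx d m)) {u : Idx d m → ℝ} (hu : ∀ p, p ∉ S → u p = 0) :
    ∑ q : S, u q ^ 2 = ∑ p, u p ^ 2 := by
  rw [Finset.sum_coe_sort S (fun p => u p ^ 2)]
  refine Finset.sum_subset (Finset.subset_univ _) fun p _ hp => ?_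
  rw [hu p hp]; ring

lemma DSRIP.vecRIP {X : Matrix (Fin n) (Idx d m) ℝ} {a b δ : ℝ} (h : DSRIP X a b δ) {g k : ℕ}
    (hg : (g : ℝ) ≤ a) (hk : (k : ℝ) ≤ a * b) : VecRIP X g k δ := by
  intro u hug huk
  by_cases hu : u = 0
  · subst hu; simp
  have hz : ∀ p, p ∉ supp u → u p = 0 := fun p hp => by simpa [supp] using hp
  have hmem : supp u ∈ supportClass d m a b := by
    refine ⟨u, ⟨?_, ?_⟩, rfl⟩
    · rw [groupSupp_eq]; exact le_trans (by exact_mod_cast hug) hg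
    · exact le_trans (by exact_mod_cast huk) hk
  have hne : (fun q : supp u => u q) ≠ 0 := by
    obtain ⟨p, hp⟩ := Function.ne_iff.1 hu
    intro h0
    exact hp (congrFun h0 ⟨p, mem_supp.2 hp⟩)
  have := h _ hmem _ hne
  rwa [subMatrix_mulVec X _ hz, sum_subtype_sq _ hz] at this

/-- `(I - XᵀX/n) u`. -/
def gap (X : Matrix (Fin n) (Idx d m) ℝ) (u : Idx d m → ℝ) : Idx d m → ℝ :=
  u - (1 / (n : ℝ)) • (Xᵀ *ᵥ (X *ᵥ u))

lemma sum_gap_mul (X : Matrix (Fin n) (Idx d m) ℝ) (u v : Idx d m → ℝ) :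
    ∑ p, gap X u p * v p = ∑ p, u p * v p - 1 / (n : ℝ) * ∑ i, (X *ᵥ u) i * (X *ᵥ v) i := by
  have h : ∑ p, (Xᵀ *ᵥ (X *ᵥ u)) p * v p = ∑ i, (X *ᵥ u) i * (X *ᵥ v) i := by
    change (Xᵀ *ᵥ (X *ᵥ u)) ⬝ᵥ v = (X *ᵥ u) ⬝ᵥ (X *ᵥ v)
    rw [Matrix.mulVec_transpose, ← Matrix.dotProduct_mulVec]
  simp only [gap, Pi.sub_apply, Pi.smul_apply, smul_eq_mul, sub_mul, Finset.sum_sub_distrib,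
    mul_assoc, ← Finset.mul_sum, h]

lemma sum_gap_mul_comm (X : Matrix (Fin n) (Idx d m) ℝ) (u v : Idx d m → ℝ) :
    ∑ p, gap X u p * v p = ∑ p, gap X v p * u p := by
  rw [sum_gap_mul, sum_gap_mul]
  simp only [mul_comm]

lemma gap_add (X : Matrix (Fin n) (Idx d m) ℝ) (u v : Idx d m → ℝ) :
    gap X (u + v) = gap X u + gap X v := by
  simp only [gap, Matrix.mulVec_add, smul_add]; abel

lemma gap_sub (X : Matrix (Fin n) (Idx d m) ℝ) (u v : Idx d m → ℝ) :
    gap X (u - v) = gap X u - gap X v := by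
  simp only [gap, Matrix.mulVec_sub, smul_sub]; abel

lemma gap_smul (X : Matrix (Fin n) (Idx d m) ℝ) (a : ℝ) (u : Idx d m → ℝ) :
    gap X (a • u) = a • gap X u := by
  simp only [gap, Matrix.mulVec_smul, smul_sub, smul_comm a]

lemma VecRIP.abs_quad_le {X : Matrix (Fin n) (Idx d m) ℝ} {g k : ℕ} {δ : ℝ}
    (h : VecRIP X g k δ) (hn : 0 < n) {T : Finset (Idx d m)} (hg : (groups T).card ≤ g)
    (hk : T.card ≤ k) {u : Idx d m → ℝ} (hu : ∀ p, p ∉ T → u p = 0) :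
    |∑ p, gap X u p * u p| ≤ δ * ∑ p, u p ^ 2 := by
  have hsub : supp u ⊆ T := fun p hp => by
    by_contra hpT; exact mem_supp.1 hp (hu p hpT)
  obtain ⟨h1, h2⟩ := h u ((Finset.card_le_card (groups_mono hsub)).trans hg)
    ((Finset.card_le_card hsub).trans hk)
  have hn' : (0 : ℝ) < n := by exact_mod_cast hn
  rw [sum_gap_mul]
  simp only [← pow_two]
  have e1 : 1 / (n : ℝ) * ∑ i, ((X *ᵥ u) i) ^ 2 ≤ (1 + δ) * ∑ p, u p ^ 2 := by
    rw [one_div, inv_mul_le_iff₀ hn']; linarith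
  have e2 : (1 - δ) * ∑ p, u p ^ 2 ≤ 1 / (n : ℝ) * ∑ i, ((X *ᵥ u) i) ^ 2 := by
    rw [one_div, le_inv_mul_iff₀ hn']; linarith
  rw [abs_le]; constructor <;> linarith

/-- Restricted orthogonality, from the restricted isometry property by polarization. -/
lemma VecRIP.gap_mul_le {X : Matrix (Fin n) (Idx d m) ℝ} {g k : ℕ} {δ : ℝ}
    (h : VecRIP X g k δ) (hn : 0 < n) {T : Finset (Idx d m)} (hg : (groups T).card ≤ g)
    (hk : T.card ≤ k) {u v : Idx d m → ℝ} (hu : ∀ p, p ∉ T → u p = 0)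
    (hv : ∀ p, p ∉ T → v p = 0) :
    ∑ p, gap X u p * v p ≤ δ * (l2 u * l2 v) := by
  -- polarization gives the arithmetic mean of the squared norms; rescaling `u` and `v` to equal
  -- norms turns it into the product of the norms
  have key : ∀ u v : Idx d m → ℝ, (∀ p, p ∉ T → u p = 0) → (∀ p, p ∉ T → v p = 0) →
      ∑ p, gap X u p * v p ≤ δ * ((l2 u ^ 2 + l2 v ^ 2) / 2) := by
    intro u v hu hv
    have a1 := (abs_le.1 (h.abs_quad_le hn hg hk (u := u + v)
      fun p hp => by simp [hu p hp, hv p hp])).2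
    have a2 := (abs_le.1 (h.abs_quad_le hn hg hk (u := u - v)
      fun p hp => by simp [hu p hp, hv p hp])).1
    have c := sum_gap_mul_comm X u v
    simp only [gap_add, gap_sub, Pi.add_apply, Pi.sub_apply, add_mul, mul_add, sub_mul, mul_sub,
      Finset.sum_add_distrib, Finset.sum_sub_distrib, add_sq, sub_sq] at a1 a2
    rw [l2_sq, l2_sq]
    linarith
  rcases (l2_nonneg u).eq_or_lt with h0 | h0
  · rw [eq_zero_of_l2_eq_zero h0.symm]
    simp [gap, l2_zero]
  rcases (l2_nonneg v).eq_or_lt with h0' | h0'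
  · rw [eq_zero_of_l2_eq_zero h0'.symm]
    simp [l2_zero]
  have := key ((l2 v) • u) ((l2 u) • v) (fun p hp => by simp [hu p hp])
    (fun p hp => by simp [hv p hp])
  rw [gap_smul, l2_smul, l2_smul, abs_of_pos h0, abs_of_pos h0'] at this
  simp only [Pi.smul_apply, smul_eq_mul] at this
  have e : ∑ p, l2 v * gap X u p * (l2 u * v p) = (l2 u * l2 v) * ∑ p, gap X u p * v p := by
    rw [Finset.mul_sum]; exact Finset.sum_congr rfl fun _ _ => by ring
  rw [e] at this
  have hp := mul_pos h0 h0'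
  refine le_of_mul_le_mul_left ?_ hp
  linarith [this]

/-! ### Splitting supports into small blocks -/

/-- `U` is the disjoint union of `p` blocks with at most `h` groups and `k` entries each. -/
def Splits (h k : ℕ) (U : Finset (Idx d m)) (p : ℕ) : Prop :=
  ∃ b : Idx d m → Fin p, ∀ i, (groups (U.filter fun x => b x = i)).card ≤ h ∧
    (U.filter fun x => b x = i).card ≤ k

lemma Splits.mono {h k p : ℕ} {U V : Finset (Idx d m)} (hV : Splits h k V p) (hUV : U ⊆ V) :
    Splits h k U p := by
  obtain ⟨b, hb⟩ := hV
  refine ⟨b, fun i => ⟨le_trans (Finset.card_le_card (groups_mono ?_)) (hb i).1,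
    le_trans (Finset.card_le_card ?_) (hb i).2⟩⟩ <;>
  exact Finset.filter_subset_filter _ hUV

lemma Splits.union {h k p q : ℕ} {U V : Finset (Idx d m)} (hU : Splits h k U p)
    (hV : Splits h k V q) : Splits h k (U ∪ V) (p + q) := by
  obtain ⟨b, hb⟩ := hU
  obtain ⟨c, hc⟩ := hV
  refine ⟨fun x => if x ∈ U then Fin.castAdd q (b x) else Fin.natAdd p (c x), fun i => ?_⟩
  refine Fin.addCases (fun i => ?_) (fun i => ?_) i
  · have hsub : (U ∪ V).filter (fun x => (if x ∈ U then Fin.castAdd q (b x)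
        else Fin.natAdd p (c x)) = Fin.castAdd q i) ⊆ U.filter fun x => b x = i := by
      intro x hx
      simp only [Finset.mem_filter, Finset.mem_union] at hx ⊢
      by_cases hxU : x ∈ U
      · simpa [hxU] using hx.2
      · simp only [hxU, if_false] at hx
        exfalso
        have := congrArg Fin.val hx.2
        simp at this; omega
    exact ⟨(Finset.card_le_card (groups_mono hsub)).trans (hb i).1,
      (Finset.card_le_card hsub).trans (hb i).2⟩
  · have hsub : (U ∪ V).filter (fun x => (if x ∈ U then Fin.castAdd q (b x)
        else Fin.natAdd p (c x)) = Fin.natAdd p i) ⊆ V.filter fun x => c x = i := by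
      intro x hx
      simp only [Finset.mem_filter, Finset.mem_union] at hx ⊢
      by_cases hxU : x ∈ U
      · simp only [hxU, if_true] at hx
        exfalso
        have := congrArg Fin.val hx.2
        simp at this; omega
      · simp only [hxU, if_false, false_or] at hx
        exact ⟨hx.1, by simpa using hx.2⟩
    exact ⟨(Finset.card_le_card (groups_mono hsub)).trans (hc i).1,
      (Finset.card_le_card hsub).trans (hc i).2⟩

lemma Splits.single {h k : ℕ} {U : Finset (Idx d m)} (h1 : (groups U).card ≤ h)
    (h2 : U.card ≤ k) : Splits h k U 1 :=
  ⟨fun _ => 0, fun _ => ⟨le_trans (Finset.card_le_card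
    (groups_mono (Finset.filter_subset _ _))) h1,
    le_trans (Finset.card_le_card (Finset.filter_subset _ _)) h2⟩⟩

lemma Splits.empty {h k : ℕ} (p : ℕ) : Splits h k (∅ : Finset (Idx d m)) (p + 1) :=
  ⟨fun _ => 0, fun _ => by simp [groups]⟩

/-- Greedy splitting: every block but the last exhausts either `h` groups or `k` entries. -/
lemma splits_of_card_le {h k : ℕ} : ∀ (g e : ℕ) (U : Finset (Idx d m)),
    (groups U).card ≤ (g + 1) * h → U.card ≤ (e + 1) * k → Splits h k U (g + e + 1) := by
  suffices H : ∀ (N g e : ℕ), g + e = N → ∀ U : Finset (Idx d m),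
      (groups U).card ≤ (g + 1) * h → U.card ≤ (e + 1) * k → Splits h k U (g + e + 1) from
    fun g e => H _ g e rfl
  intro N
  induction N with
  | zero =>
    intro g e hge U hg he
    obtain ⟨rfl, rfl⟩ : g = 0 ∧ e = 0 := by omega
    exact Splits.single (by simpa using hg) (by simpa using he)
  | succ N ih =>
    intro g e hge U hg he
    -- `B` is one block, taken from at most `h` groups
    have hblock : ∀ W ⊆ U, (groups W).card ≤ h → k ≤ W.card →
        Splits h k U (g + e + 1) := by
      intro W hW hWg hWk
      obtain ⟨B, hBW, hBk⟩ := Finset.exists_subset_card_eq hWk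
      have hB := Splits.single (h := h) (k := k)
        ((Finset.card_le_card (groups_mono hBW)).trans hWg) hBk.le
      have hcard : (U \ B).card = U.card - k := by
        rw [Finset.card_sdiff_of_subset (hBW.trans hW), hBk]
      have hU : U = (U \ B) ∪ B := (Finset.sdiff_union_of_subset (hBW.trans hW)).symm
      rcases Nat.eq_zero_or_pos e with rfl | he0
      · have : U \ B = ∅ := by
          rw [← Finset.card_eq_zero, hcard]; omega
        rw [hU, this]
        exact (Splits.empty (g + 0 - 1)).union hB |> fun h => by
          have e : g + 0 - 1 + 1 + 1 = g + 0 + 1 := by omega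
          rwa [e] at h
      · have := ih g (e - 1) (by omega) (U \ B)
          ((Finset.card_le_card (groups_mono Finset.sdiff_subset)).trans hg)
          (by
            rw [hcard]
            have : (e + 1) * k = (e - 1 + 1) * k + k := by
              obtain ⟨e', rfl⟩ : ∃ e', e = e' + 1 := ⟨e - 1, by omega⟩
              simp; ring
            omega)
        have h2 := this.union hB
        rw [← hU] at h2
        have e3 : g + (e - 1) + 1 + 1 = g + e + 1 := by omega
        rwa [e3] at h2
    by_cases hsmall : (groups U).card ≤ h
    · by_cases hk : k ≤ U.card
      · exact hblock U subset_rfl hsmall hk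
      · have := (Splits.single (h := h) (k := k) hsmall (by omega)).union
          (Splits.empty (d := d) (m := m) (h := h) (k := k) (g + e - 1))
        rw [Finset.union_empty] at this
        have e3 : 1 + (g + e - 1 + 1) = g + e + 1 := by omega
        rwa [e3] at this
    · obtain ⟨J, hJ, hJc⟩ := Finset.exists_subset_card_eq (not_le.1 hsmall).le
      set W := U.filter fun x => x.2 ∈ J with hWdef
      have hWg : groups W ⊆ J := by
        intro j hj
        simp only [groups, Finset.mem_image] at hj
        obtain ⟨x, hx, rfl⟩ := hj
        exact (Finset.mem_filter.1 hx).2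
      by_cases hk : k ≤ W.card
      · exact hblock W (Finset.filter_subset _ _) (hJc ▸ Finset.card_le_card hWg) hk
      · have hrest : groups (U \ W) ⊆ groups U \ J := by
          intro j hj
          simp only [groups, Finset.mem_image, Finset.mem_sdiff] at hj ⊢
          obtain ⟨x, ⟨hxU, hxW⟩, rfl⟩ := hj
          exact ⟨⟨x, hxU, rfl⟩, fun hxJ => hxW (Finset.mem_filter.2 ⟨hxU, hxJ⟩)⟩
        have hcard : (groups (U \ W)).card ≤ (groups U).card - h := by
          refine (Finset.card_le_card hrest).trans ?_
          rw [Finset.card_sdiff_of_subset hJ, hJc]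
        have hg0 : 0 < g := by
          rcases Nat.eq_zero_or_pos g with rfl | h0
          · exfalso; simp at hg; omega
          · exact h0
        have h1 := ih (g - 1) e (by omega) (U \ W)
          (by
            have : (g + 1) * h = (g - 1 + 1) * h + h := by
              obtain ⟨e', rfl⟩ : ∃ e', g = e' + 1 := ⟨g - 1, by omega⟩
              simp; ring
            omega)
          ((Finset.card_le_card Finset.sdiff_subset).trans he)
        have h2 := h1.union (Splits.single (h := h) (k := k) (hJc ▸ Finset.card_le_card hWg)
          (not_le.1 hk).le)
        rw [Finset.sdiff_union_of_subset (Finset.filter_subset _ _)] at h2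
        have e3 : g - 1 + e + 1 + 1 = g + e + 1 := by omega
        rwa [e3] at h2

lemma sum_l2_block_le {p : ℕ} (b : Idx d m → Fin p) (U : Finset (Idx d m))
    {u : Idx d m → ℝ} (hu : ∀ x, x ∉ U → u x = 0) :
    (∑ i, l2 (res (U.filter fun x => b x = i) u)) ≤ Real.sqrt p * l2 u := by
  have h1 : ∑ i, l2 (res (U.filter fun x => b x = i) u) ^ 2 = l2 u ^ 2 := by
    simp only [l2_res_sq]
    rw [Finset.sum_fiberwise, l2_sq]
    exact Finset.sum_subset (Finset.subset_univ _) fun x _ hx => by rw [hu x hx]; ring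
  refine abs_le_of_sq_le_sq' ?_ (by have := l2_nonneg u; positivity) |>.2
  rw [mul_pow, Real.sq_sqrt (Nat.cast_nonneg p), ← h1]
  have := sq_sum_le_card_mul_sum_sq (s := (Finset.univ : Finset (Fin p)))
    (f := fun i => l2 (res (U.filter fun x => b x = i) u))
  simpa using this

lemma sum_res_blocks {p : ℕ} (b : Idx d m → Fin p) (U : Finset (Idx d m))
    {u : Idx d m → ℝ} (hu : ∀ x, x ∉ U → u x = 0) :
    ∑ i, res (U.filter fun x => b x = i) u = u := by
  funext x
  rw [Finset.sum_apply]
  by_cases hx : x ∈ U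
  · simp [res, hx]
  · simp [res, hx, hu x hx]

/-- The bilinear form of `I - XᵀX/n` on supports that split into blocks, two of which always fit
into the class of the restricted isometry property. -/
lemma VecRIP.gap_mul_le_of_splits {X : Matrix (Fin n) (Idx d m) ℝ} {g k h l p q : ℕ} {δ : ℝ}
    (hX : VecRIP X g k δ) (hδ : 0 ≤ δ) (hn : 0 < n) (hg : 2 * h ≤ g) (hk : 2 * l ≤ k)
    {U V : Finset (Idx d m)} (hU : Splits h l U p) (hV : Splits h l V q) {u v : Idx d m → ℝ}
    (hu : ∀ x, x ∉ U → u x = 0) (hv : ∀ x, x ∉ V → v x = 0) :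
    ∑ x, gap X u x * v x ≤ δ * (Real.sqrt p * Real.sqrt q) * (l2 u * l2 v) := by
  obtain ⟨b, hb⟩ := hU
  obtain ⟨c, hc⟩ := hV
  have e1 : gap X u = ∑ i, gap X (res (U.filter fun x => b x = i) u) := by
    conv_lhs => rw [← sum_res_blocks b U hu]
    let f : (Idx d m → ℝ) →+ (Idx d m → ℝ) :=
      { toFun := gap X, map_zero' := by simp [gap], map_add' := gap_add X }
    exact map_sum f _ _
  have e2 : ∑ x, gap X u x * v x = ∑ i, ∑ j, ∑ x,
      gap X (res (U.filter fun x => b x = i) u) x * res (V.filter fun x => c x = j) v x := by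
    conv_lhs => rw [e1, ← sum_res_blocks c V hv]
    simp only [Finset.sum_apply, Finset.sum_mul_sum]
    rw [Finset.sum_comm]
    refine Finset.sum_congr rfl fun i _ => ?_
    rw [Finset.sum_comm]
  rw [e2]
  calc _ ≤ ∑ i, ∑ j, δ * (l2 (res (U.filter fun x => b x = i) u) *
        l2 (res (V.filter fun x => c x = j) v)) := by
        refine Finset.sum_le_sum fun i _ => Finset.sum_le_sum fun j _ => ?_
        refine hX.gap_mul_le hn (T := (U.filter fun x => b x = i) ∪ (V.filter fun x => c x = j))
          ?_ ?_ ?_ ?_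
        · rw [groups_union]
          refine (Finset.card_union_le _ _).trans ?_
          have := (hb i).1; have := (hc j).1; omega
        · refine (Finset.card_union_le _ _).trans ?_
          have := (hb i).2; have := (hc j).2; omega
        · intro x hx; rw [Finset.mem_union, not_or] at hx; simp [res, hx.1]
        · intro x hx; rw [Finset.mem_union, not_or] at hx; simp [res, hx.2]
    _ = δ * ((∑ i, l2 (res (U.filter fun x => b x = i) u)) *
        ∑ j, l2 (res (V.filter fun x => c x = j) v)) := by
        rw [Finset.sum_mul_sum, Finset.mul_sum]
        simp only [Finset.mul_sum]
    _ ≤ δ * ((Real.sqrt p * l2 u) * (Real.sqrt q * l2 v)) := by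
        refine mul_le_mul_of_nonneg_left (mul_le_mul (sum_l2_block_le b U hu)
          (sum_l2_block_le c V hv) (Finset.sum_nonneg fun _ _ => l2_nonneg _)
          (mul_nonneg (Real.sqrt_nonneg _) (l2_nonneg _))) hδ
    _ = _ := by ring

/-- A bound on the bilinear form of `I - XᵀX/n` bounds its coordinate restrictions. -/
lemma l2_res_gap_le {X : Matrix (Fin n) (Idx d m) ℝ} {T : Finset (Idx d m)} {u : Idx d m → ℝ}
    {a : ℝ} (h : ∀ v : Idx d m → ℝ, (∀ x, x ∉ T → v x = 0) →
      ∑ x, gap X u x * v x ≤ a * l2 v) (ha : 0 ≤ a) : l2 (res T (gap X u)) ≤ a := by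
  have := h (res T (gap X u)) (fun x hx => by simp [res, hx])
  rw [sum_res_mul_self] at this
  rcases (l2_nonneg (res T (gap X u))).eq_or_lt with h0 | h0
  · rw [← h0]; exact ha
  · rw [pow_two] at this; exact le_of_mul_le_mul_right this h0

end rip

/-! ### One step of thresholded gradient descent -/

section step

variable {n d m : ℕ}

lemma thr_eq_or (lam : ℝ) (s₀ : ℕ) (H : Idx d m → ℝ) (p : Idx d m) :
    thr lam s₀ H p = H p ∨ thr lam s₀ H p = 0 := by
  unfold thr thrGroup thrElem
  split_ifs <;> simp

lemma thr_of_ne_zero {lam : ℝ} {s₀ : ℕ} {H : Idx d m → ℝ} {p : Idx d m}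
    (h : thr lam s₀ H p ≠ 0) : thr lam s₀ H p = H p ∧ lam ≤ |H p| ∧
      (s₀ : ℝ) * lam ^ 2 ≤ ∑ i, thr lam s₀ H (i, p.2) ^ 2 := by
  have hg : (s₀ : ℝ) * lam ^ 2 ≤ ∑ i, thrElem lam H (i, p.2) ^ 2 := by
    by_contra hc; exact h (by simp [thr, thrGroup, hc])
  have he : lam ≤ |H p| := by
    by_contra hc; exact h (by simp [thr, thrGroup, thrElem, hc])
  refine ⟨(thr_eq_or lam s₀ H p).resolve_right h, he, ?_⟩
  have e : ∀ i, thr lam s₀ H (i, p.2) = thrElem lam H (i, p.2) := fun i => by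
    simp only [thr, thrGroup, if_pos hg]
  simpa only [e] using hg

/-- The size restrictions on the support `E` of an iterate outside the true support `S`: at most `N`
entries in the true groups `G`, and at most `a` further groups with at most `q` entries. -/
structure SmallExtras (S : Finset (Idx d m)) (G : Finset (Fin m)) (N a q : ℕ)
    (E : Finset (Idx d m)) : Prop where
  notMem : ∀ p ∈ E, p ∉ S
  inner : (E.filter fun p => p.2 ∈ G).card ≤ N
  outer_groups : (groups (E.filter fun p => p.2 ∉ G)).card ≤ a
  outer : (E.filter fun p => p.2 ∉ G).card ≤ q

/-- Test sets for extra entries in the true groups. -/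
def IsInner (S : Finset (Idx d m)) (G : Finset (Fin m)) (N : ℕ) (T : Finset (Idx d m)) : Prop :=
  T.card ≤ N + 1 ∧ ∀ p ∈ T, p ∉ S ∧ p.2 ∈ G

/-- Test sets for extra groups. -/
def IsOuter (G : Finset (Fin m)) (a q : ℕ) (T : Finset (Idx d m)) : Prop :=
  (groups T).card ≤ a ∧ T.card ≤ q ∧ ∀ p ∈ T, p.2 ∉ G

/-- Operator norm bounds for the blocks of `I - XᵀX/n` that occur in the analysis of the iterates:
`δT` when the output is restricted to a test set, `δW` when it is restricted to the support of the
next iterate. -/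
structure GapBound (X : Matrix (Fin n) (Idx d m) ℝ) (S : Finset (Idx d m)) (G : Finset (Fin m))
    (N a q : ℕ) (δT δW : ℝ) : Prop where
  inner : ∀ E, SmallExtras S G N a q E → ∀ T, IsInner S G N T → ∀ u : Idx d m → ℝ,
    (∀ p, p ∉ S ∪ E → u p = 0) → l2 (res T (gap X u)) ≤ δT * l2 u
  outer : ∀ E, SmallExtras S G N a q E → ∀ T, IsOuter G a q T → ∀ u : Idx d m → ℝ,
    (∀ p, p ∉ S ∪ E → u p = 0) → l2 (res T (gap X u)) ≤ δT * l2 u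
  whole : ∀ E, SmallExtras S G N a q E → ∀ E', SmallExtras S G N a q E' → ∀ u : Idx d m → ℝ,
    (∀ p, p ∉ S ∪ E → u p = 0) → l2 (res (S ∪ E') (gap X u)) ≤ δW * l2 u

/-- Bounds for the noise `Ξ` on the true support and on the test sets. -/
structure NoiseBound (Ξ : Idx d m → ℝ) (S : Finset (Idx d m)) (G : Finset (Fin m))
    (N a q : ℕ) (nS n₁ n₂ : ℝ) : Prop where
  support : l2 (res S Ξ) ≤ nS
  inner : ∀ T, IsInner S G N T → l2 (res T Ξ) ≤ n₁
  outer : ∀ T, IsOuter G a q T → l2 (res T Ξ) ≤ n₂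

lemma card_mul_sq_le_sum_sq {T : Finset (Idx d m)} {H : Idx d m → ℝ} {lam : ℝ} (hlam : 0 ≤ lam)
    (h : ∀ p ∈ T, lam ≤ |H p|) : (T.card : ℝ) * lam ^ 2 ≤ ∑ p ∈ T, H p ^ 2 := by
  rw [← nsmul_eq_mul]
  refine Finset.card_nsmul_le_sum _ _ _ fun p hp => ?_
  rw [← sq_abs (H p)]
  exact pow_le_pow_left₀ hlam (h p hp) 2

/-- If thresholding keeps too many groups or entries outside `G`, then some test set carries much
of the mass of `H`. -/
lemma exists_outer_of_not_small {lam : ℝ} (hlam : 0 ≤ lam) {s₀ a : ℕ} {H : Idx d m → ℝ}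
    {G : Finset (Fin m)} {F : Finset (Idx d m)}
    (hF : F = (supp (thr lam s₀ H)).filter fun p => p.2 ∉ G)
    (hbig : ¬ ((groups F).card ≤ a ∧ F.card ≤ a * s₀)) :
    ∃ T ⊆ F, IsOuter G a (a * s₀) T ∧ ((a * s₀ : ℕ) : ℝ) * lam ^ 2 ≤ ∑ p ∈ T, H p ^ 2 := by
  have hFm : ∀ p ∈ F, thr lam s₀ H p ≠ 0 ∧ p.2 ∉ G := fun p hp => by
    rw [hF, Finset.mem_filter, mem_supp] at hp; exact hp
  by_cases hg : (groups F).card ≤ a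
  -- few groups, so too many entries, each of size at least `lam`
  · have hc : a * s₀ ≤ F.card := by
      by_contra hc; exact hbig ⟨hg, (not_le.1 hc).le⟩
    obtain ⟨T, hT, hTc⟩ := Finset.exists_subset_card_eq hc
    refine ⟨T, hT, ⟨(Finset.card_le_card (groups_mono hT)).trans hg, hTc.le,
      fun p hp => (hFm p (hT hp)).2⟩, ?_⟩
    rw [← hTc]
    exact card_mul_sq_le_sum_sq hlam fun p hp => (thr_of_ne_zero (hFm p (hT hp)).1).2.1
  -- too many groups: `a` of them contribute `s₀ lam ^ 2` each, through `s₀` entries of size at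
  -- least `lam`, or through all kept entries of the group if these are fewer than `s₀`
  · obtain ⟨J, hJ, hJc⟩ := Finset.exists_subset_card_eq (not_le.1 hg).le
    have hsel : ∀ j ∈ J, ∃ T ⊆ F.filter fun p => p.2 = j, T.card ≤ s₀ ∧
        (s₀ : ℝ) * lam ^ 2 ≤ ∑ p ∈ T, H p ^ 2 := by
      intro j hj
      by_cases hk : s₀ ≤ (F.filter fun p => p.2 = j).card
      · obtain ⟨T, hT, hTc⟩ := Finset.exists_subset_card_eq hk
        refine ⟨T, hT, hTc.le, ?_⟩
        rw [← hTc]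
        exact card_mul_sq_le_sum_sq hlam fun p hp =>
          (thr_of_ne_zero (hFm p (Finset.mem_filter.1 (hT hp)).1).1).2.1
      · refine ⟨_, subset_rfl, (not_le.1 hk).le, ?_⟩
        obtain ⟨p, hp, rfl⟩ := Finset.mem_image.1 (hJ hj)
        obtain ⟨hp1, hp2⟩ := hFm p hp
        refine (thr_of_ne_zero hp1).2.2.trans ?_
        have hinj : Set.InjOn (fun i : Fin d => ((i, p.2) : Idx d m))
            ((Finset.univ.filter fun i => thr lam s₀ H (i, p.2) ≠ 0 : Finset (Fin d)) :
              Set (Fin d)) := fun x _ y _ h => (Prod.mk.inj h).1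
        have e : F.filter (fun q => q.2 = p.2) =
            (Finset.univ.filter fun i => thr lam s₀ H (i, p.2) ≠ 0).image
              fun i => ((i, p.2) : Idx d m) := by
          ext ⟨i, j⟩
          simp only [hF, Finset.mem_filter, mem_supp, Finset.mem_image, Finset.mem_univ, true_and,
            Prod.mk.injEq]
          constructor
          · rintro ⟨⟨h1, -⟩, rfl⟩; exact ⟨i, h1, rfl, rfl⟩
          · rintro ⟨i', h1, rfl, rfl⟩; exact ⟨⟨h1, hp2⟩, rfl⟩
        rw [e, Finset.sum_image hinj, Finset.sum_filter]
        refine Finset.sum_le_sum fun i _ => ?_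
        split_ifs with h0
        · rw [(thr_of_ne_zero h0).1]
        · rw [not_not] at h0; rw [h0]; simp
    choose! T hT using hsel
    have hdisj : (J : Set (Fin m)).PairwiseDisjoint T := by
      intro i hi j hj hij
      rw [Function.onFun, Finset.disjoint_left]
      intro p hp hp'
      exact hij (((Finset.mem_filter.1 ((hT i hi).1 hp)).2).symm.trans
        (Finset.mem_filter.1 ((hT j hj).1 hp')).2)
    refine ⟨J.biUnion T, Finset.biUnion_subset.2 fun j hj =>
      (hT j hj).1.trans (Finset.filter_subset _ _), ⟨?_, ?_, ?_⟩, ?_⟩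
    · rw [← hJc]
      refine Finset.card_le_card fun j hj => ?_
      obtain ⟨p, hp, rfl⟩ := Finset.mem_image.1 hj
      obtain ⟨j, hjJ, hpj⟩ := Finset.mem_biUnion.1 hp
      rw [(Finset.mem_filter.1 ((hT j hjJ).1 hpj)).2]; exact hjJ
    · refine Finset.card_biUnion_le.trans ?_
      rw [← hJc]
      exact Finset.sum_le_card_nsmul _ _ _ fun j hj => (hT j hj).2.1
    · intro p hp
      obtain ⟨j, hjJ, hpj⟩ := Finset.mem_biUnion.1 hp
      exact (hFm p (Finset.mem_filter.1 ((hT j hjJ).1 hpj)).1).2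
    · rw [Finset.sum_biUnion hdisj]
      calc ((a * s₀ : ℕ) : ℝ) * lam ^ 2 = J.card • ((s₀ : ℝ) * lam ^ 2) := by
            rw [hJc, nsmul_eq_mul]; push_cast; ring
        _ ≤ _ := Finset.card_nsmul_le_sum _ _ _ fun j hj => (hT j hj).2.2

/-- The mass of `H` removed from the true support by thresholding. -/
lemma sum_killed_le {lam : ℝ} {s₀ s : ℕ} (H : Idx d m → ℝ)
    {S : Finset (Idx d m)} (hS : S.card ≤ s * s₀) (hG : (groups S).card ≤ s) :
    ∑ p ∈ S, (thr lam s₀ H p - H p) ^ 2 ≤ 2 * ((s : ℝ) * s₀) * lam ^ 2 := by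
  -- the element-wise step removes at most `lam ^ 2` per entry, the group-wise step at most
  -- `s₀ lam ^ 2` per group
  have hpt : ∀ p : Idx d m, (thr lam s₀ H p - H p) ^ 2 ≤ lam ^ 2 +
      (if (s₀ : ℝ) * lam ^ 2 ≤ ∑ i, thrElem lam H (i, p.2) ^ 2 then 0
        else thrElem lam H p ^ 2) := by
    intro p
    unfold thr thrGroup
    by_cases he : lam ≤ |H p|
    · have : thrElem lam H p = H p := by simp [thrElem, he]
      split_ifs with hg
      · rw [this]; nlinarith
      · rw [this]; nlinarith
    · have h0 : thrElem lam H p = 0 := by simp [thrElem, he]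
      have h1 : H p ^ 2 ≤ lam ^ 2 := by
        rw [← sq_abs]; exact pow_le_pow_left₀ (abs_nonneg _) (not_le.1 he).le 2
      split_ifs with hg <;> simp [h0, h1]
  have hgrp : ∑ p ∈ S, (if (s₀ : ℝ) * lam ^ 2 ≤ ∑ i, thrElem lam H (i, p.2) ^ 2 then 0
        else thrElem lam H p ^ 2) ≤ (groups S).card * ((s₀ : ℝ) * lam ^ 2) := by
    rw [← Finset.sum_fiberwise_of_maps_to (t := groups S) (g := Prod.snd)
      (fun p hp => Finset.mem_image_of_mem _ hp)]
    refine (Finset.sum_le_card_nsmul _ _ ((s₀ : ℝ) * lam ^ 2) fun j _ => ?_).trans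
      (nsmul_eq_mul _ _).le
    by_cases hj : (s₀ : ℝ) * lam ^ 2 ≤ ∑ i, thrElem lam H (i, j) ^ 2
    · rw [Finset.sum_eq_zero]
      · positivity
      · intro p hp
        rw [(Finset.mem_filter.1 hp).2, if_pos hj]
    · refine le_trans ?_ (not_le.1 hj).le
      have e : ∑ i, thrElem lam H (i, j) ^ 2 =
          ∑ p ∈ Finset.univ.image fun i : Fin d => ((i, j) : Idx d m), thrElem lam H p ^ 2 := by
        rw [Finset.sum_image fun x _ y _ h => (Prod.mk.inj h).1]
      rw [e]
      calc _ = ∑ p ∈ S.filter (fun p => p.2 = j), thrElem lam H p ^ 2 :=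
            Finset.sum_congr rfl fun p hp => by
              rw [(Finset.mem_filter.1 hp).2, if_neg hj]
        _ ≤ _ := Finset.sum_le_sum_of_subset_of_nonneg (fun p hp => by
              rw [Finset.mem_image]
              exact ⟨p.1, Finset.mem_univ _, by rw [← (Finset.mem_filter.1 hp).2]⟩)
              fun _ _ _ => sq_nonneg _
  calc _ ≤ ∑ p ∈ S, (lam ^ 2 + (if (s₀ : ℝ) * lam ^ 2 ≤ ∑ i, thrElem lam H (i, p.2) ^ 2 then 0
        else thrElem lam H p ^ 2)) := Finset.sum_le_sum fun p _ => hpt p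
    _ ≤ (S.card : ℝ) * lam ^ 2 + (groups S).card * ((s₀ : ℝ) * lam ^ 2) := by
        rw [Finset.sum_add_distrib, Finset.sum_const, nsmul_eq_mul]
        gcongr
    _ ≤ ((s * s₀ : ℕ) : ℝ) * lam ^ 2 + s * ((s₀ : ℝ) * lam ^ 2) := by
        gcongr
    _ = _ := by push_cast; ring

/-- Size control of the support after one step. -/
lemma smallExtras_thr {lam e n₁ n₂ nS δT δW : ℝ} (hlam : 0 < lam) {s₀ N a : ℕ}
    {X : Matrix (Fin n) (Idx d m) ℝ} {βs β Ξ : Idx d m → ℝ} {E : Finset (Idx d m)}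
    (hgap : GapBound X (supp βs) (groupSupp βs) N a (a * s₀) δT δW)
    (hnoise : NoiseBound Ξ (supp βs) (groupSupp βs) N a (a * s₀) nS n₁ n₂) (hδT : 0 ≤ δT)
    (h₁ : δT * e + n₁ < Real.sqrt (N + 1) * lam)
    (h₂ : δT * e + n₂ < Real.sqrt ((a * s₀ : ℕ) : ℝ) * lam)
    (hE : SmallExtras (supp βs) (groupSupp βs) N a (a * s₀) E)
    (hβ : ∀ p, p ∉ supp βs ∪ E → (β - βs) p = 0) (he : l2 (β - βs) ≤ e) :
    SmallExtras (supp βs) (groupSupp βs) N a (a * s₀)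
      (supp (thr lam s₀ (βs + gap X (β - βs) + Ξ)) \ supp βs) := by
  set H := βs + gap X (β - βs) + Ξ with hH
  set S := supp βs
  set G := groupSupp βs
  -- outside the true support `H` consists of the gap term and the noise only, so a test set on
  -- which both are small cannot carry the mass that a violation of the size constraints would
  -- produce
  have hHT : ∀ T : Finset (Idx d m), (∀ p ∈ T, p ∉ S) →
      l2 (res T H) ≤ l2 (res T (gap X (β - βs))) + l2 (res T Ξ) := by
    intro T hT
    have : res T H = res T (gap X (β - βs)) + res T Ξ := by
      rw [← res_add]; funext p
      simp only [res]
      split_ifs with hp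
      · have : βs p = 0 := by simpa [S, supp] using hT p hp
        simp [hH, this]
      · rfl
    rw [this]; exact l2_add_le _ _
  have hle : δT * l2 (β - βs) ≤ δT * e := mul_le_mul_of_nonneg_left he hδT
  have hsq : ∀ (T : Finset (Idx d m)) (k : ℝ), 0 ≤ k → k * lam ^ 2 ≤ ∑ p ∈ T, H p ^ 2 →
      Real.sqrt k * lam ≤ l2 (res T H) := by
    intro T k hk hT
    refine abs_le_of_sq_le_sq' ?_ (l2_nonneg _) |>.2
    rw [mul_pow, Real.sq_sqrt hk, l2_res_sq]; exact hT
  have hGS : ∀ p : Idx d m, p.2 ∉ G → p ∉ S := fun p hp hpS => hp (by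
    simp only [G, groupSupp_eq]; exact Finset.mem_image_of_mem _ hpS)
  have houter : (groups ((supp (thr lam s₀ H)).filter fun p => p.2 ∉ G)).card ≤ a ∧
      ((supp (thr lam s₀ H)).filter fun p => p.2 ∉ G).card ≤ a * s₀ := by
    by_contra hbig
    obtain ⟨T, -, hT, hmass⟩ := exists_outer_of_not_small hlam.le rfl hbig
    have := hHT T fun p hp => hGS p (hT.2.2 p hp)
    have h3 := hgap.outer E hE T hT _ hβ
    have h4 := hnoise.outer T hT
    have h5 := hsq T _ (Nat.cast_nonneg _) hmass
    linarith
  have hsub : ((supp (thr lam s₀ H) \ S).filter fun p => p.2 ∉ G) ⊆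
      (supp (thr lam s₀ H)).filter fun p => p.2 ∉ G :=
    Finset.filter_subset_filter _ Finset.sdiff_subset
  refine ⟨fun p hp => (Finset.mem_sdiff.1 hp).2, ?_,
    (Finset.card_le_card (groups_mono hsub)).trans houter.1,
    (Finset.card_le_card hsub).trans houter.2⟩
  by_contra hbig
  obtain ⟨T, hTs, hTc⟩ := Finset.exists_subset_card_eq (Nat.succ_le_of_lt (not_le.1 hbig))
  have hTm : ∀ p ∈ T, thr lam s₀ H p ≠ 0 ∧ p ∉ S ∧ p.2 ∈ G := fun p hp => by
    have := hTs hp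
    rw [Finset.mem_filter, Finset.mem_sdiff, mem_supp] at this
    exact ⟨this.1.1, this.1.2, this.2⟩
  have hT : IsInner S G N T := ⟨hTc.le, fun p hp => (hTm p hp).2⟩
  have hmass := card_mul_sq_le_sum_sq hlam.le fun p hp => (thr_of_ne_zero (hTm p hp).1).2.1
  have h5 := hsq T _ (Nat.cast_nonneg _) hmass
  have := hHT T fun p hp => (hTm p hp).2.1
  have h3 := hgap.inner E hE T hT _ hβ
  have h4 := hnoise.inner T hT
  rw [hTc] at h5; push_cast at h5
  linarith

/-- Error bound after one step, given the size control of the new support. -/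
lemma l2_thr_sub_le {lam e n₁ n₂ nS δT δW : ℝ} (hlam : 0 ≤ lam) {s s₀ N a q : ℕ}
    {X : Matrix (Fin n) (Idx d m) ℝ} {βs β Ξ : Idx d m → ℝ} {E : Finset (Idx d m)}
    (hS : (supp βs).card ≤ s * s₀) (hG : (groupSupp βs).card ≤ s)
    (hgap : GapBound X (supp βs) (groupSupp βs) N a q δT δW)
    (hnoise : NoiseBound Ξ (supp βs) (groupSupp βs) N a q nS n₁ n₂) (hδW : 0 ≤ δW)
    (hE : SmallExtras (supp βs) (groupSupp βs) N a q E)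
    (hβ : ∀ p, p ∉ supp βs ∪ E → (β - βs) p = 0) (he : l2 (β - βs) ≤ e)
    (hE' : SmallExtras (supp βs) (groupSupp βs) N a q
      (supp (thr lam s₀ (βs + gap X (β - βs) + Ξ)) \ supp βs)) :
    l2 (thr lam s₀ (βs + gap X (β - βs) + Ξ) - βs) ≤ δW * e +
      Real.sqrt ((Real.sqrt 2 * Real.sqrt ((s : ℝ) * s₀) * lam + nS) ^ 2 + n₁ ^ 2 + n₂ ^ 2) := by
  set H := βs + gap X (β - βs) + Ξ with hH
  set E' := supp (thr lam s₀ H) \ supp βs with hE'def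
  set S := supp βs
  set G := groupSupp βs
  set kill : Idx d m → ℝ := res S (thr lam s₀ H - H) with hkill
  -- gap term on the old and new support, noise and thresholding loss on the true support, and noise
  -- on the extra entries; the last two parts are orthogonal
  have hdec : thr lam s₀ H - βs =
      res (S ∪ E') (gap X (β - βs)) + ((res S Ξ + kill) + res E' Ξ) := by
    funext p
    by_cases hp : p ∈ S
    · have hpE : p ∉ E' := fun h => hE'.notMem p h hp
      have : H p = βs p + gap X (β - βs) p + Ξ p := rfl
      simp only [Pi.sub_apply, Pi.add_apply, res, hkill, hp, hpE, Finset.mem_union, true_or,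
        if_true, if_false]
      rw [this]; ring
    · have hb : βs p = 0 := by simpa [S, supp] using hp
      have : H p = βs p + gap X (β - βs) p + Ξ p := rfl
      by_cases hpE : p ∈ E'
      · have h1 : thr lam s₀ H p ≠ 0 := mem_supp.1 (Finset.mem_sdiff.1 hpE).1
        simp only [Pi.sub_apply, Pi.add_apply, res, hkill, hp, hpE, Finset.mem_union, or_true,
          if_true, if_false]
        rw [(thr_of_ne_zero h1).1, this, hb]; ring
      · have h1 : thr lam s₀ H p = 0 := by
          by_contra h1
          exact hpE (Finset.mem_sdiff.2 ⟨mem_supp.2 h1, hp⟩)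
        simp [res, hkill, hp, hpE, h1, hb]
  have hkn : l2 kill ≤ Real.sqrt 2 * Real.sqrt ((s : ℝ) * s₀) * lam := by
    refine abs_le_of_sq_le_sq' ?_ (by positivity) |>.2
    rw [hkill, l2_res_sq, mul_pow, mul_pow, Real.sq_sqrt (by norm_num),
      Real.sq_sqrt (by positivity)]
    exact sum_killed_le H hS (by rw [← groupSupp_eq]; exact hG)
  have hEn : l2 (res E' Ξ) ^ 2 ≤ n₁ ^ 2 + n₂ ^ 2 := by
    have h1 : IsInner S G N (E'.filter fun p => p.2 ∈ G) :=
      ⟨hE'.inner.trans (Nat.le_succ _), fun p hp =>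
        ⟨hE'.notMem p (Finset.mem_filter.1 hp).1, (Finset.mem_filter.1 hp).2⟩⟩
    have h2 : IsOuter G a q (E'.filter fun p => p.2 ∉ G) :=
      ⟨hE'.outer_groups, hE'.outer, fun p hp => (Finset.mem_filter.1 hp).2⟩
    have h3 := pow_le_pow_left₀ (l2_nonneg _) (hnoise.inner _ h1) 2
    have h4 := pow_le_pow_left₀ (l2_nonneg _) (hnoise.outer _ h2) 2
    rw [l2_res_sq] at h3 h4 ⊢
    rw [← Finset.sum_filter_add_sum_filter_not E' (fun p => p.2 ∈ G)]
    linarith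
  have hsum : l2 ((res S Ξ + kill) + res E' Ξ) ^ 2 =
      l2 (res S Ξ + kill) ^ 2 + l2 (res E' Ξ) ^ 2 := by
    rw [l2_sq, l2_sq, l2_sq, ← Finset.sum_add_distrib]
    refine Finset.sum_congr rfl fun p _ => ?_
    by_cases hp : p ∈ S
    · have hpE : p ∉ E' := fun h => hE'.notMem p h hp
      simp [res, hpE]
    · simp [res, hkill, hp]
  have hSk : l2 (res S Ξ + kill) ≤ Real.sqrt 2 * Real.sqrt ((s : ℝ) * s₀) * lam + nS :=
    (l2_add_le _ _).trans (by linarith [hnoise.support])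
  rw [hdec]
  refine (l2_add_le _ _).trans (add_le_add ((hgap.whole E hE E' hE' _ hβ).trans
    (mul_le_mul_of_nonneg_left he hδW)) ?_)
  refine Real.le_sqrt_of_sq_le ?_
  rw [hsum]
  have := pow_le_pow_left₀ (l2_nonneg _) hSk 2
  linarith

lemma gradStep_eq (X : Matrix (Fin n) (Idx d m) ℝ) (Y : Fin n → ℝ) (b β : Idx d m → ℝ) :
    gradStep X Y β = b + gap X (β - b) + (1 / (n : ℝ)) • (Xᵀ *ᵥ (Y - X *ᵥ b)) := by
  simp only [gradStep, gap, Matrix.mulVec_sub, smul_sub]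
  abel

end step

/-! ### Contraction of the second stage towards a fixed point -/

section contraction

variable {n d m : ℕ}

/-- If every `k`-element subset of `K` has `f`-mass at most `A`, then `K` has at most the
proportional mass, by averaging over the subsets. -/
lemma sum_le_of_forall_card_eq {ι : Type*} [DecidableEq ι] {f : ι → ℝ} {A : ℝ} {k : ℕ}
    (hk : 0 < k) : ∀ (l : ℕ) (K : Finset ι), K.card = k + l →
      (∀ T ⊆ K, T.card = k → ∑ p ∈ T, f p ≤ A) → (k : ℝ) * ∑ p ∈ K, f p ≤ K.card * A := by
  intro l
  induction l with
  | zero =>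
    intro K hK h
    have := h K subset_rfl (by simpa using hK)
    rw [hK]; simpa using mul_le_mul_of_nonneg_left this (Nat.cast_nonneg k)
  | succ l ih =>
    intro K hK h
    have h1 : ∀ p ∈ K, (k : ℝ) * ∑ x ∈ K.erase p, f x ≤ (k + l : ℕ) * A := by
      intro p hp
      have hc : (K.erase p).card = k + l := by rw [Finset.card_erase_of_mem hp, hK]; omega
      have := ih (K.erase p) hc fun T hT hTc => h T (hT.trans (Finset.erase_subset _ _)) hTc
      rwa [hc] at this
    have h2 := Finset.sum_le_sum h1
    have h3 : ∀ p ∈ K, (k : ℝ) * ∑ x ∈ K.erase p, f x = k * ∑ x ∈ K, f x - k * f p := by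
      intro p hp
      rw [← Finset.add_sum_erase K f hp]; ring
    rw [Finset.sum_congr rfl h3, Finset.sum_sub_distrib, Finset.sum_const, ← Finset.mul_sum,
      Finset.sum_const, nsmul_eq_mul, nsmul_eq_mul, hK] at h2
    rw [hK]
    push_cast at h2 ⊢
    have hpos : (0 : ℝ) < k + l := by positivity
    refine le_of_mul_le_mul_left ?_ hpos
    linarith

/-- The elementary inequality behind the contraction factor for a group that thresholding wrongly
removes: `Br`, `Be` are the norms of the target on the entries kept and removed by the element-wise
thresholding, `gr`, `ge` the norms of the perturbation there. -/
lemma killed_group_bound {Q M Br Be gr ge : ℝ} (hQ : 1 < Q) (hBr0 : 0 ≤ Br)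
    (hBe0 : 0 ≤ Be) (hBr : Br ≤ M + gr) (hBe : (Q - 1) * Be ≤ Q * ge)
    (hP : Q ^ 2 * M ^ 2 ≤ Br ^ 2 + Be ^ 2) :
    2 * (Q - 1) ^ 3 * (Br ^ 2 + Be ^ 2) ≤ Q ^ 2 * (2 * Q - 1) * (gr ^ 2 + ge ^ 2) := by
  have h1 : Br ^ 2 ≤ (M + gr) ^ 2 := pow_le_pow_left₀ hBr0 hBr 2
  have h2 : ((Q - 1) * Be) ^ 2 ≤ (Q * ge) ^ 2 :=
    pow_le_pow_left₀ (mul_nonneg (by linarith) hBe0) hBe 2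
  -- Young's inequality with the weight that makes the two quadratic terms match
  have h3 : (2 * Q - 1) * (Q - 1) ^ 2 * (M + gr) ^ 2 ≤
      (2 * Q - 1) * Q ^ 2 * gr ^ 2 + (Q - 1) ^ 2 * Q ^ 2 * M ^ 2 := by
    nlinarith [sq_nonneg ((Q - 1) ^ 2 * M - (2 * Q - 1) * gr)]
  have h4 : 0 < 2 * Q - 1 := by linarith
  have h5 := mul_le_mul_of_nonneg_left h1 (mul_nonneg h4.le (sq_nonneg (Q - 1)))
  have h6 := mul_le_mul_of_nonneg_left h2 h4.le
  have h7 := mul_le_mul_of_nonneg_left hP (sq_nonneg (Q - 1))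
  nlinarith

lemma sqrt_sum_add_le {ι : Type*} (K : Finset ι) (u v : ι → ℝ) :
    Real.sqrt (∑ p ∈ K, (u p + v p) ^ 2) ≤
      Real.sqrt (∑ p ∈ K, u p ^ 2) + Real.sqrt (∑ p ∈ K, v p ^ 2) := by
  have := l2_add_le (fun p : K => u p) (fun p : K => v p)
  simp only [l2, Pi.add_apply] at this
  rwa [Finset.sum_coe_sort K (fun p => (u p + v p) ^ 2),
    Finset.sum_coe_sort K (fun p => u p ^ 2), Finset.sum_coe_sort K (fun p => v p ^ 2)] at this

/-- Hypotheses on a vector `b` and a residual correlation `Ξ` under which thresholded gradient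
descent contracts to `b`: the entries and groups of `b` exceed the threshold `μ` by the factor `Q`,
and `Ξ` vanishes on the support and is smaller than `ε μ` elsewhere, entry by entry in the groups of
`b`, and for sets of `s₀` entries in the other groups. -/
structure FixedPoint (b Ξ : Idx d m → ℝ) (S : Finset (Idx d m)) (G : Finset (Fin m)) (s₀ : ℕ)
    (μ Q ε : ℝ) : Prop where
  off : ∀ p, p ∉ S → b p = 0
  resid : ∀ p ∈ S, Ξ p = 0
  groups : ∀ p ∈ S, p.2 ∈ G
  entry : ∀ p ∈ S, Q * μ ≤ |b p|
  group : ∀ j ∈ G, Q ^ 2 * ((s₀ : ℝ) * μ ^ 2) ≤ ∑ i, b (i, j) ^ 2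
  noise_inner : ∀ p, p ∉ S → p.2 ∈ G → |Ξ p| ≤ ε * μ
  noise_outer : ∀ j ∉ G, ∀ T : Finset (Fin d), T.card ≤ s₀ →
    ∑ i ∈ T, Ξ (i, j) ^ 2 ≤ ε ^ 2 * (s₀ * μ ^ 2)

/-- The error towards the fixed point is at most a multiple of the part of the perturbation `g` that
lives on the union of the true and of the new support. -/
lemma FixedPoint.l2_thr_sub_le {b Ξ g : Idx d m → ℝ} {S : Finset (Idx d m)}
    {G : Finset (Fin m)} {s₀ : ℕ} {μ Q ε Γ : ℝ} (h : FixedPoint b Ξ S G s₀ μ Q ε) (hs₀ : 0 < s₀)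
    (hμ : 0 < μ) (hQ : 1 < Q) (hε0 : 0 ≤ ε) (hε : ε < 1) (hΓ : 1 ≤ Γ * (1 - ε))
    (hΓQ : Q ^ 2 * (2 * Q - 1) ≤ Γ ^ 2 * (2 * (Q - 1) ^ 3)) :
    l2 (thr μ s₀ (b + g + Ξ) - b) ≤
      Γ * l2 (res (S ∪ (supp (thr μ s₀ (b + g + Ξ)) \ S)) g) := by
  set H := b + g + Ξ with hH
  set E' := supp (thr μ s₀ H) \ S with hE'
  have hHp : ∀ p, H p = b p + g p + Ξ p := fun p => rfl
  have hΓ0 : 0 < Γ := by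
    by_contra hc
    nlinarith [mul_nonpos_of_nonpos_of_nonneg (not_lt.1 hc) (by linarith : 0 ≤ 1 - ε)]
  have hQ1 : 0 < Q - 1 := by linarith
  have hγ : Q ^ 2 ≤ Γ ^ 2 * (Q - 1) ^ 2 := by
    have h1 : Q ^ 2 * (2 * (Q - 1)) ≤ Γ ^ 2 * (Q - 1) ^ 2 * (2 * (Q - 1)) := by nlinarith
    exact le_of_mul_le_mul_right h1 (by linarith)
  -- the entries that thresholding removes from the support although the group survives
  have hrem : ∀ p ∈ S, |H p| < μ → (Q - 1) * |b p| ≤ Q * |g p| := by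
    intro p hp hlt
    have h1 := h.entry p hp
    have h2 : |b p| ≤ |H p| + |g p| := by
      rw [hHp, h.resid p hp, add_zero]
      calc |b p| = |(b p + g p) - g p| := by ring_nf
        _ ≤ _ := abs_sub _ _
    have h3 : |b p| ≤ μ + |g p| := by linarith
    have h4 : Q * |b p| ≤ Q * μ + Q * |g p| := by nlinarith
    linarith
  refine abs_le_of_sq_le_sq' ?_ (mul_nonneg hΓ0.le (l2_nonneg _)) |>.2
  rw [mul_pow, l2_sq, l2_sq, Fintype.sum_prod_type_right, Fintype.sum_prod_type_right,
    Finset.mul_sum]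
  refine Finset.sum_le_sum fun j _ => ?_
  have hnew : ∀ p, p ∉ S → thr μ s₀ H p ≠ 0 → p ∈ S ∪ E' := fun p hp h0 =>
    Finset.mem_union_right _ (Finset.mem_sdiff.2 ⟨mem_supp.2 h0, hp⟩)
  by_cases hj : j ∈ G
  · by_cases hkill : (s₀ : ℝ) * μ ^ 2 ≤ ∑ i, thrElem μ H (i, j) ^ 2
    -- a group of `b` that survives: entry by entry
    · rw [Finset.mul_sum]
      refine Finset.sum_le_sum fun i _ => ?_
      have hthr : thr μ s₀ H (i, j) = thrElem μ H (i, j) := by simp [thr, thrGroup, hkill]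
      by_cases hp : (i, j) ∈ S
      · have hr : res (S ∪ E') g (i, j) = g (i, j) := by simp [res, hp]
        rw [hr]
        have hΓ1 : 1 ≤ Γ := by nlinarith
        by_cases hbig : μ ≤ |H (i, j)|
        · have : (thr μ s₀ H - b) (i, j) = g (i, j) := by
            rw [Pi.sub_apply, hthr, thrElem, if_pos hbig, hHp, h.resid _ hp]; ring
          rw [this]
          nlinarith [sq_nonneg (g (i, j))]
        · have h1 := hrem _ hp (not_le.1 hbig)
          have : (thr μ s₀ H - b) (i, j) = - b (i, j) := by
            rw [Pi.sub_apply, hthr, thrElem, if_neg hbig]; ring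
          rw [this, neg_sq, ← sq_abs (b _), ← sq_abs (g _)]
          have h2 := pow_le_pow_left₀ (mul_nonneg hQ1.le (abs_nonneg _)) h1 2
          rw [mul_pow, mul_pow] at h2
          have h3 := mul_le_mul_of_nonneg_right hγ (sq_nonneg |g (i, j)|)
          have h4 : (Q - 1) ^ 2 * |b (i, j)| ^ 2 ≤ (Q - 1) ^ 2 * (Γ ^ 2 * |g (i, j)| ^ 2) := by
            linarith
          exact le_of_mul_le_mul_left h4 (by positivity)
      · by_cases h0 : thr μ s₀ H (i, j) = 0
        · have : (thr μ s₀ H - b) (i, j) = 0 := by simp [h0, h.off _ hp]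
          rw [this, zero_pow two_ne_zero]; positivity
        · have hr : res (S ∪ E') g (i, j) = g (i, j) := by
            simp [res, -Finset.mem_union, hnew _ hp h0]
          have ht := thr_of_ne_zero h0
          have hb0 := h.off _ hp
          have : (thr μ s₀ H - b) (i, j) = H (i, j) := by simp [ht.1, hb0]
          rw [hr, this, ← sq_abs, ← sq_abs (g _), ← mul_pow]
          refine pow_le_pow_left₀ (abs_nonneg _) ?_ 2
          have h1 := h.noise_inner _ hp hj
          have h2 : |H (i, j)| ≤ |g (i, j)| + |Ξ (i, j)| := by
            rw [hHp, hb0, zero_add]; exact abs_add_le _ _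
          have h3 : (1 - ε) * |H (i, j)| ≤ |g (i, j)| := by nlinarith [ht.2.1]
          nlinarith [abs_nonneg (H (i, j))]
    -- a group of `b` that is removed: the whole mass of `b` there is the error
    · have hthr : ∀ i, thr μ s₀ H (i, j) = 0 := fun i => by simp [thr, thrGroup, hkill]
      set K := Finset.univ.filter fun i : Fin d => (i, j) ∈ S with hK
      set Kr := K.filter fun i => μ ≤ |H (i, j)| with hKr
      set Ke := K.filter fun i => ¬ μ ≤ |H (i, j)| with hKe
      have hKm : ∀ i ∈ K, (i, j) ∈ S := fun i hi => (Finset.mem_filter.1 hi).2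
      have hb : ∑ i, (thr μ s₀ H - b) (i, j) ^ 2 = ∑ i ∈ K, b (i, j) ^ 2 := by
        rw [hK, Finset.sum_filter]
        refine Finset.sum_congr rfl fun i _ => ?_
        split_ifs with hi
        · simp [hthr]
        · simp [hthr, h.off _ hi]
      have hbb : ∑ i, b (i, j) ^ 2 = ∑ i ∈ K, b (i, j) ^ 2 := by
        rw [hK, Finset.sum_filter]
        refine Finset.sum_congr rfl fun i _ => ?_
        split_ifs with hi
        · rfl
        · simp [h.off _ hi]
      have hgK : ∑ i ∈ K, g (i, j) ^ 2 ≤ ∑ i, res (S ∪ E') g (i, j) ^ 2 := by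
        rw [hK, Finset.sum_filter]
        refine Finset.sum_le_sum fun i _ => ?_
        split_ifs with hi
        · simp [res, hi]
        · positivity
      have hP := h.group j hj
      rw [hbb] at hP
      rw [hb]
      have hsplit : ∀ f : Fin d → ℝ, ∑ i ∈ K, f i = ∑ i ∈ Kr, f i + ∑ i ∈ Ke, f i := fun f =>
        (Finset.sum_filter_add_sum_filter_not K _ f).symm
      have hHr : ∑ i ∈ Kr, H (i, j) ^ 2 ≤ s₀ * μ ^ 2 := by
        refine le_trans ?_ (not_le.1 hkill).le
        calc _ = ∑ i ∈ Kr, thrElem μ H (i, j) ^ 2 := Finset.sum_congr rfl fun i hi => by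
              rw [thrElem, if_pos (Finset.mem_filter.1 hi).2]
          _ ≤ _ := Finset.sum_le_sum_of_subset_of_nonneg (Finset.subset_univ _)
              fun _ _ _ => sq_nonneg _
      have hBr : Real.sqrt (∑ i ∈ Kr, b (i, j) ^ 2) ≤ Real.sqrt (s₀ * μ ^ 2) +
          Real.sqrt (∑ i ∈ Kr, g (i, j) ^ 2) := by
        have h1 := sqrt_sum_add_le Kr (fun i => H (i, j)) (fun i => - g (i, j))
        have h2 : ∀ i ∈ Kr, (H (i, j) + - g (i, j)) ^ 2 = b (i, j) ^ 2 := fun i hi => by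
          rw [hHp, h.resid _ (hKm i (Finset.mem_filter.1 hi).1)]; ring
        rw [Finset.sum_congr rfl h2] at h1
        simp only [neg_sq] at h1
        exact h1.trans (add_le_add (Real.sqrt_le_sqrt hHr) le_rfl)
      have hBe : (Q - 1) * Real.sqrt (∑ i ∈ Ke, b (i, j) ^ 2) ≤
          Q * Real.sqrt (∑ i ∈ Ke, g (i, j) ^ 2) := by
        refine abs_le_of_sq_le_sq' ?_ (mul_nonneg (by linarith) (Real.sqrt_nonneg _)) |>.2
        rw [mul_pow, mul_pow, Real.sq_sqrt (Finset.sum_nonneg fun _ _ => sq_nonneg _),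
          Real.sq_sqrt (Finset.sum_nonneg fun _ _ => sq_nonneg _), Finset.mul_sum,
          Finset.mul_sum]
        refine Finset.sum_le_sum fun i hi => ?_
        have hi' := Finset.mem_filter.1 hi
        have h1 := hrem _ (hKm i hi'.1) (not_le.1 hi'.2)
        have h2 := pow_le_pow_left₀ (mul_nonneg hQ1.le (abs_nonneg _)) h1 2
        rwa [mul_pow, mul_pow, sq_abs, sq_abs] at h2
      have hkey := killed_group_bound hQ (Real.sqrt_nonneg _) (Real.sqrt_nonneg _) hBr hBe
        (by
          rw [Real.sq_sqrt (by positivity), Real.sq_sqrt (Finset.sum_nonneg fun _ _ => sq_nonneg _),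
            Real.sq_sqrt (Finset.sum_nonneg fun _ _ => sq_nonneg _), ← hsplit]
          exact hP)
      rw [Real.sq_sqrt (Finset.sum_nonneg fun _ _ => sq_nonneg _),
        Real.sq_sqrt (Finset.sum_nonneg fun _ _ => sq_nonneg _),
        Real.sq_sqrt (Finset.sum_nonneg fun _ _ => sq_nonneg _),
        Real.sq_sqrt (Finset.sum_nonneg fun _ _ => sq_nonneg _), ← hsplit, ← hsplit] at hkey
      have hg0 : 0 ≤ ∑ i ∈ K, g (i, j) ^ 2 := Finset.sum_nonneg fun _ _ => sq_nonneg _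
      have h2 := mul_le_mul_of_nonneg_right hΓQ hg0
      have h3 : 2 * (Q - 1) ^ 3 * ∑ i ∈ K, b (i, j) ^ 2 ≤
          2 * (Q - 1) ^ 3 * (Γ ^ 2 * ∑ i ∈ K, g (i, j) ^ 2) := by linarith
      refine (le_of_mul_le_mul_left h3 (by positivity)).trans ?_
      exact mul_le_mul_of_nonneg_left hgK (sq_nonneg _)
  -- a group outside `G`: if it survives, its norm exceeds that of `Ξ` by the factor `1 / ε`
  · have hpS : ∀ i, (i, j) ∉ S := fun i hi => hj (h.groups _ hi)
    set K := Finset.univ.filter fun i : Fin d => thr μ s₀ H (i, j) ≠ 0 with hK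
    have hKm : ∀ i ∈ K, thr μ s₀ H (i, j) ≠ 0 := fun i hi => (Finset.mem_filter.1 hi).2
    have hD : ∑ i, (thr μ s₀ H - b) (i, j) ^ 2 = ∑ i ∈ K, H (i, j) ^ 2 := by
      rw [hK, Finset.sum_filter]
      refine Finset.sum_congr rfl fun i _ => ?_
      split_ifs with hi
      · simp [h.off _ (hpS i), (thr_of_ne_zero hi).1]
      · rw [not_not] at hi; simp [h.off _ (hpS i), hi]
    have hgK : ∑ i ∈ K, g (i, j) ^ 2 ≤ ∑ i, res (S ∪ E') g (i, j) ^ 2 := by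
      rw [hK, Finset.sum_filter]
      refine Finset.sum_le_sum fun i _ => ?_
      split_ifs with hi
      · simp [res, -Finset.mem_union, hnew _ (hpS i) hi]
      · positivity
    rw [hD]
    rcases K.eq_empty_or_nonempty with hK0 | ⟨i₀, hi₀⟩
    · rw [hK0, Finset.sum_empty]; positivity
    have hH1 : (s₀ : ℝ) * μ ^ 2 ≤ ∑ i ∈ K, H (i, j) ^ 2 := by
      rw [← hD]
      refine (thr_of_ne_zero (hKm i₀ hi₀)).2.2.trans (le_of_eq ?_)
      exact Finset.sum_congr rfl fun i _ => by simp [h.off _ (hpS i)]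
    have hH2 : (K.card : ℝ) * μ ^ 2 ≤ ∑ i ∈ K, H (i, j) ^ 2 := by
      rw [← nsmul_eq_mul]
      refine Finset.card_nsmul_le_sum _ _ _ fun i hi => ?_
      rw [← sq_abs (H _)]
      exact pow_le_pow_left₀ hμ.le (thr_of_ne_zero (hKm i hi)).2.1 2
    have hΞ : ∑ i ∈ K, Ξ (i, j) ^ 2 ≤ ε ^ 2 * ∑ i ∈ K, H (i, j) ^ 2 := by
      rcases le_total K.card s₀ with hc | hc
      · exact (h.noise_outer j hj K hc).trans (mul_le_mul_of_nonneg_left hH1 (sq_nonneg _))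
      -- more than `s₀` kept entries: average over their `s₀`-element subsets
      · have h1 := sum_le_of_forall_card_eq (f := fun i => Ξ (i, j) ^ 2) hs₀ (K.card - s₀) K
          (by omega) fun T _ hT => h.noise_outer j hj T hT.le
        have h2 : (s₀ : ℝ) * ∑ i ∈ K, Ξ (i, j) ^ 2 ≤
            s₀ * (ε ^ 2 * ∑ i ∈ K, H (i, j) ^ 2) := by
          refine h1.trans ?_
          have := mul_le_mul_of_nonneg_left hH2
            (by positivity : (0 : ℝ) ≤ s₀ * ε ^ 2)
          linarith
        exact le_of_mul_le_mul_left h2 (by exact_mod_cast hs₀)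
    have h4 := sqrt_sum_add_le K (fun i => g (i, j)) (fun i => Ξ (i, j))
    have h5 : ∀ i ∈ K, (g (i, j) + Ξ (i, j)) ^ 2 = H (i, j) ^ 2 := fun i _ => by
      rw [hHp, h.off _ (hpS i), zero_add]
    rw [Finset.sum_congr rfl h5] at h4
    have h6 : Real.sqrt (∑ i ∈ K, Ξ (i, j) ^ 2) ≤ ε * Real.sqrt (∑ i ∈ K, H (i, j) ^ 2) := by
      rw [← Real.sqrt_sq hε0, ← Real.sqrt_mul (sq_nonneg _)]
      exact Real.sqrt_le_sqrt hΞ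
    have h7 : Real.sqrt (∑ i ∈ K, H (i, j) ^ 2) ≤ Γ * Real.sqrt (∑ i ∈ K, g (i, j) ^ 2) := by
      nlinarith [Real.sqrt_nonneg (∑ i ∈ K, H (i, j) ^ 2)]
    have h8 := pow_le_pow_left₀ (Real.sqrt_nonneg _) h7 2
    rw [mul_pow, Real.sq_sqrt (Finset.sum_nonneg fun _ _ => sq_nonneg _),
      Real.sq_sqrt (Finset.sum_nonneg fun _ _ => sq_nonneg _)] at h8
    exact h8.trans (mul_le_mul_of_nonneg_left hgK (sq_nonneg _))

end contraction

/-! ### The two stages on a fixed noise realization -/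

section stages

variable {n d m : ℕ}

/-- `β` is within `r` of `βs`, and its support outside that of `βs` is small. -/
def Near (βs : Idx d m → ℝ) (N a q : ℕ) (r : ℝ) (β : Idx d m → ℝ) : Prop :=
  SmallExtras (supp βs) (groupSupp βs) N a q (supp β \ supp βs) ∧ l2 (β - βs) ≤ r

lemma Near.mono {βs β : Idx d m → ℝ} {N a q : ℕ} {r r' : ℝ} (h : Near βs N a q r β)
    (hr : r ≤ r') : Near βs N a q r' β := ⟨h.1, h.2.trans hr⟩

lemma sub_eq_zero_off {βs β : Idx d m → ℝ} {p : Idx d m}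
    (hp : p ∉ supp βs ∪ (supp β \ supp βs)) : (β - βs) p = 0 := by
  rw [Finset.union_sdiff_self_eq_union, Finset.mem_union, not_or, mem_supp, mem_supp, not_not,
    not_not] at hp
  simp [hp.1, hp.2]

/-- The relations between the constants that keep the iterates close to the truth: `lam₀` is the
smallest threshold in use, `z₁`, `z₂`, `zS` are the noise levels in units of it, and the errors
stay below `W` times the current threshold. -/
structure StepData (X : Matrix (Fin n) (Idx d m) ℝ) (βs Ξ : Idx d m → ℝ) (s s₀ N a : ℕ)
    (lam₀ z₁ z₂ zS δT δW κ W : ℝ) : Prop where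
  lam_pos : 0 < lam₀
  card_supp : (supp βs).card ≤ s * s₀
  card_groups : (groupSupp βs).card ≤ s
  gapBound : GapBound X (supp βs) (groupSupp βs) N a (a * s₀) δT δW
  noise : NoiseBound Ξ (supp βs) (groupSupp βs) N a (a * s₀) (zS * lam₀) (z₁ * lam₀) (z₂ * lam₀)
  δT_nonneg : 0 ≤ δT
  δW_nonneg : 0 ≤ δW
  z₁_nonneg : 0 ≤ z₁
  z₂_nonneg : 0 ≤ z₂
  zS_nonneg : 0 ≤ zS
  W_nonneg : 0 ≤ W
  inner : δT * W + z₁ < Real.sqrt (N + 1)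
  outer : δT * W + z₂ < Real.sqrt ((a * s₀ : ℕ) : ℝ)
  whole : δW * W + Real.sqrt ((Real.sqrt 2 * Real.sqrt ((s : ℝ) * s₀) + zS) ^ 2 + z₁ ^ 2 + z₂ ^ 2)
    ≤ κ * W

/-- One step of thresholded gradient descent, at any threshold above the final one, reduces the
radius of the error ball by the factor `κ`. -/
lemma StepData.near_thr {X : Matrix (Fin n) (Idx d m) ℝ} {βs Ξ : Idx d m → ℝ} {s s₀ N a : ℕ}
    {lam₀ z₁ z₂ zS δT δW κ W : ℝ} (D : StepData X βs Ξ s s₀ N a lam₀ z₁ z₂ zS δT δW κ W)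
    {lam : ℝ} (hlam : lam₀ ≤ lam) {β : Idx d m → ℝ} (hβ : Near βs N a (a * s₀) (W * lam) β) :
    Near βs N a (a * s₀) (κ * W * lam) (thr lam s₀ (βs + gap X (β - βs) + Ξ)) := by
  have h0 : 0 < lam := D.lam_pos.trans_le hlam
  have hz1 := mul_le_mul_of_nonneg_left hlam D.z₁_nonneg
  have hz2 := mul_le_mul_of_nonneg_left hlam D.z₂_nonneg
  have hzS := mul_le_mul_of_nonneg_left hlam D.zS_nonneg
  have hnoise : NoiseBound Ξ (supp βs) (groupSupp βs) N a (a * s₀) (zS * lam) (z₁ * lam)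
      (z₂ * lam) :=
    ⟨D.noise.support.trans hzS, fun T hT => (D.noise.inner T hT).trans hz1,
      fun T hT => (D.noise.outer T hT).trans hz2⟩
  have hsmall := smallExtras_thr h0 D.gapBound hnoise D.δT_nonneg
    (e := W * lam)
    (by have := mul_lt_mul_of_pos_right D.inner h0; linarith)
    (by have := mul_lt_mul_of_pos_right D.outer h0; linarith)
    hβ.1 (fun p hp => sub_eq_zero_off hp) hβ.2
  refine ⟨hsmall, (l2_thr_sub_le h0.le D.card_supp D.card_groups D.gapBound hnoise D.δW_nonneg hβ.1
    (fun p hp => sub_eq_zero_off hp) hβ.2 hsmall).trans ?_⟩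
  have e : (Real.sqrt 2 * Real.sqrt ((s : ℝ) * s₀) * lam + zS * lam) ^ 2 + (z₁ * lam) ^ 2 +
      (z₂ * lam) ^ 2 = ((Real.sqrt 2 * Real.sqrt ((s : ℝ) * s₀) + zS) ^ 2 + z₁ ^ 2 + z₂ ^ 2) *
        lam ^ 2 := by ring
  rw [e, Real.sqrt_mul (by positivity), Real.sqrt_sq h0.le]
  have := mul_le_mul_of_nonneg_right D.whole h0.le
  linarith

lemma lamSeq_eq_max {κ l₀ l : ℝ} (hκ0 : 0 ≤ κ) (hκ1 : κ ≤ 1) (hl : 0 ≤ l) (h : l ≤ l₀) (t : ℕ) :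
    lamSeq κ l₀ l t = max (κ ^ t * l₀) l := by
  induction t with
  | zero => simp [lamSeq, h]
  | succ t ih =>
    rw [lamSeq, ih, pow_succ', mul_assoc, mul_max_of_nonneg _ _ hκ0, max_assoc,
      max_eq_right (mul_le_of_le_one_left hl hκ1)]

/-- The output of the first stage is close to the truth at the scale of the final threshold. -/
lemma StepData.near_dsiht {X : Matrix (Fin n) (Idx d m) ℝ} {βs Ξ : Idx d m → ℝ}
    {s s₀ N a : ℕ} {lam₀ z₁ z₂ zS δT δW κ W σ : ℝ}
    (D : StepData X βs Ξ s s₀ N a lam₀ z₁ z₂ zS δT δW κ W) (hκ0 : 0 < κ) (hκ1 : κ < 1)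
    {Y : Fin n → ℝ} (hΞ : (1 / (n : ℝ)) • (Xᵀ *ᵥ (Y - X *ᵥ βs)) = Ξ)
    (hstart : lam₀ ≤ lamZero X Y κ σ) (hinit : l2 βs ≤ W * lamZero X Y κ σ) :
    Near βs N a (a * s₀) (κ * W * lam₀) (dsiht X Y κ σ lam₀ s₀) := by
  set l₀ := lamZero X Y κ σ with hl₀
  have hl₀pos : 0 < l₀ := D.lam_pos.trans_le hstart
  have hseq := lamSeq_eq_max hκ0.le hκ1.le D.lam_pos.le hstart
  have hge : ∀ t, lam₀ ≤ lamSeq κ l₀ lam₀ t := fun t => by rw [hseq]; exact le_max_right _ _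
  have hstep : ∀ t, Near βs N a (a * s₀) (W * lamSeq κ l₀ lam₀ t)
      (dsihtIter X Y κ l₀ lam₀ s₀ t) → Near βs N a (a * s₀) (κ * W * lamSeq κ l₀ lam₀ t)
      (dsihtIter X Y κ l₀ lam₀ s₀ (t + 1)) := by
    intro t ht
    rw [dsihtIter, gradStep_eq X Y βs, hΞ]
    exact D.near_thr (hge t) ht
  have hall : ∀ t, Near βs N a (a * s₀) (W * lamSeq κ l₀ lam₀ t)
      (dsihtIter X Y κ l₀ lam₀ s₀ t) := by
    intro t
    induction t with
    | zero =>
      refine ⟨?_, ?_⟩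
      · have : supp (dsihtIter X Y κ l₀ lam₀ s₀ 0) \ supp βs = ∅ := by
          simp [dsihtIter, supp]
        rw [this]
        exact ⟨by simp, by simp, by simp [groups], by simp⟩
      · simpa [dsihtIter, lamSeq, l2_neg] using hinit
    | succ t ih =>
      refine (hstep t ih).mono ?_
      have h1 : κ * lamSeq κ l₀ lam₀ t ≤ lamSeq κ l₀ lam₀ (t + 1) := by
        rw [lamSeq]; exact le_max_left _ _
      have := mul_le_mul_of_nonneg_left h1 D.W_nonneg
      linarith
  have hlogκ : Real.log κ < 0 := Real.log_neg hκ0 hκ1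
  set x := Real.log (lam₀ / l₀) / Real.log κ with hx
  have hx0 : 0 ≤ x := by
    refine div_nonneg_of_nonpos (Real.log_nonpos (by have := D.lam_pos; positivity) ?_) hlogκ.le
    exact (div_le_one hl₀pos).2 hstart
  have hT : (⌈x⌉ + 1).toNat = ⌈x⌉.toNat + 1 := by
    have := Int.ceil_nonneg hx0; omega
  -- the iteration stops one step after the counter `⌈x⌉`, at which the threshold has reached its
  -- floor, so that the last step is made with the final threshold
  have hlast : lamSeq κ l₀ lam₀ ⌈x⌉.toNat = lam₀ := by
    rw [hseq]
    refine max_eq_right ?_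
    have h1 : x ≤ (⌈x⌉.toNat : ℝ) := by
      have h2 : ((⌈x⌉.toNat : ℤ) : ℝ) = (⌈x⌉ : ℝ) := by
        rw [Int.toNat_of_nonneg (Int.ceil_nonneg hx0)]
      calc x ≤ (⌈x⌉ : ℝ) := Int.le_ceil x
        _ = _ := by rw [← h2]; exact Int.cast_natCast _
    rw [← le_div_iff₀ hl₀pos, ← Real.log_le_log_iff (by positivity)
      (div_pos D.lam_pos hl₀pos), Real.log_pow]
    rwa [hx, div_le_iff_of_neg hlogκ] at h1
  have := hstep ⌈x⌉.toNat (hall _)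
  rw [hlast] at this
  rw [dsiht, ← hl₀, ← hx, hT]
  exact this

/-- Second-stage iterates stay near the truth and contract to a fixed point `b`. -/
lemma StepData.secondStage_contract {X : Matrix (Fin n) (Idx d m) ℝ} {βs Ξ : Idx d m → ℝ}
    {s s₀ N a : ℕ} {lam₀ z₁ z₂ zS δT δW κ W : ℝ}
    (D : StepData X βs Ξ s s₀ N a lam₀ z₁ z₂ zS δT δW κ W) (hκ1 : κ < 1)
    {Y : Fin n → ℝ} (hΞ : (1 / (n : ℝ)) • (Xᵀ *ᵥ (Y - X *ᵥ βs)) = Ξ)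
    {b Ξb : Idx d m → ℝ} (hΞb : (1 / (n : ℝ)) • (Xᵀ *ᵥ (Y - X *ᵥ b)) = Ξb)
    {μ Q ε Γ : ℝ} (hfix : FixedPoint b Ξb (supp βs) (groupSupp βs) s₀ μ Q ε) (hs₀ : 0 < s₀)
    (hQ : 1 < Q) (hε0 : 0 ≤ ε) (hε : ε < 1) (hΓ : 1 ≤ Γ * (1 - ε))
    (hΓQ : Q ^ 2 * (2 * Q - 1) ≤ Γ ^ 2 * (2 * (Q - 1) ^ 3)) (hμ : lam₀ ≤ μ)
    {β₀ : Idx d m → ℝ} (hβ₀ : Near βs N a (a * s₀) (W * μ) β₀) (t : ℕ) :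
    Near βs N a (a * s₀) (W * μ) (secondStage X Y μ s₀ β₀ t) ∧
      l2 (secondStage X Y μ s₀ β₀ t - b) ≤ (Γ * δW) ^ t * l2 (β₀ - b) := by
  have hμ0 : 0 < μ := D.lam_pos.trans_le hμ
  have hΓ0 : 0 < Γ := by
    by_contra hc
    nlinarith [mul_nonpos_of_nonpos_of_nonneg (not_lt.1 hc) (by linarith : 0 ≤ 1 - ε)]
  induction t with
  | zero => exact ⟨hβ₀, by simp [secondStage]⟩
  | succ t ih =>
    obtain ⟨ih1, ih2⟩ := ih
    set β := secondStage X Y μ s₀ β₀ t with hβ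
    have hnear := D.near_thr hμ ih1
    -- the same step, expanded around the truth and around the fixed point: the former keeps the
    -- supports small, the latter contracts
    have e1 : secondStage X Y μ s₀ β₀ (t + 1) = thr μ s₀ (βs + gap X (β - βs) + Ξ) := by
      rw [secondStage, ← hβ, gradStep_eq X Y βs, hΞ]
    have e2 : secondStage X Y μ s₀ β₀ (t + 1) = thr μ s₀ (b + gap X (β - b) + Ξb) := by
      rw [secondStage, ← hβ, gradStep_eq X Y b, hΞb]
    refine ⟨?_, ?_⟩
    · rw [e1]
      refine hnear.mono ?_
      have := mul_le_of_le_one_left (mul_nonneg D.W_nonneg hμ0.le) hκ1.le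
      linarith
    · have h1 := hfix.l2_thr_sub_le (g := gap X (β - b)) hs₀ hμ0 hQ hε0 hε hΓ hΓQ
      have hE' := hnear.1
      rw [← e1, e2] at hE'
      rw [e2]
      have h2 := D.gapBound.whole _ ih1.1 _ hE' (β - b) (fun p hp => by
        rw [Finset.union_sdiff_self_eq_union, Finset.mem_union, not_or, mem_supp, mem_supp,
          not_not, not_not] at hp
        have := hfix.off p (by rw [mem_supp, not_not]; exact hp.1)
        simp [this, hp.2])
      calc _ ≤ Γ * (δW * l2 (β - b)) := h1.trans (mul_le_mul_of_nonneg_left h2 hΓ0.le)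
        _ ≤ Γ * (δW * ((Γ * δW) ^ t * l2 (β₀ - b))) :=
          mul_le_mul_of_nonneg_left (mul_le_mul_of_nonneg_left ih2 D.δW_nonneg) hΓ0.le
        _ = _ := by ring

/-- The initial threshold dominates the truth: the norm of `βs` is controlled by the largest entry
of `Xᵀ Y / n` and the largest entry of the noise. -/
lemma l2_le_lamZero {X : Matrix (Fin n) (Idx d m) ℝ} {Y : Fin n → ℝ} {βs Ξ : Idx d m → ℝ}
    {κ σ δ : ℝ} {g k : ℕ} (hX : VecRIP X g k δ) (hn : 0 < n) (hδ0 : 0 ≤ δ) (hκ : 0 < κ)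
    (hg : (groupSupp βs).card ≤ g) (hk : (supp βs).card ≤ k)
    (hΞ : (1 / (n : ℝ)) • (Xᵀ *ᵥ (Y - X *ᵥ βs)) = Ξ)
    (hmax : ∀ p, |Ξ p| ≤ Real.sqrt (10 * σ ^ 2 * Real.log ((d : ℝ) * m) / n)) :
    (1 - δ) * l2 βs ≤ Real.sqrt (supp βs).card * (Real.sqrt 2 * κ * lamZero X Y κ σ) := by
  set Z := (1 / (n : ℝ)) • (Xᵀ *ᵥ Y) with hZ
  have e : βs = gap X βs + (Z - Ξ) := by
    rw [← hΞ, hZ, gap, Matrix.mulVec_sub, smul_sub]; abel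
  have hoff : ∀ p, p ∉ supp βs → βs p = 0 := fun p hp => by simpa [supp] using hp
  have h1 : l2 (res (supp βs) (gap X βs)) ≤ δ * l2 βs := by
    refine l2_res_gap_le (fun v hv => ?_) (mul_nonneg hδ0 (l2_nonneg _))
    have := hX.gap_mul_le hn (T := supp βs) (by rwa [← groupSupp_eq]) hk hoff hv
    linarith
  have hent : ∀ p, |(Z - Ξ) p| ≤ Real.sqrt 2 * κ * lamZero X Y κ σ := by
    intro p
    have e1 : Real.sqrt 2 * κ * lamZero X Y κ σ =
        ‖Z‖ + Real.sqrt (10 * σ ^ 2 * Real.log ((d : ℝ) * m) / n) := by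
      rw [lamZero, mul_div_cancel₀]; positivity
    rw [e1, Pi.sub_apply]
    exact (abs_sub _ _).trans (add_le_add (norm_le_pi_norm Z p) (hmax p))
  have h2 : l2 (res (supp βs) (Z - Ξ)) ≤
      Real.sqrt (supp βs).card * (Real.sqrt 2 * κ * lamZero X Y κ σ) := by
    rcases (supp βs).eq_empty_or_nonempty with h0 | ⟨p₀, hp₀⟩
    · simp [h0, l2, res]
    · have h3 : 0 ≤ Real.sqrt 2 * κ * lamZero X Y κ σ := (abs_nonneg _).trans (hent p₀)
      refine abs_le_of_sq_le_sq' ?_ (mul_nonneg (Real.sqrt_nonneg _) h3) |>.2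
      rw [l2_res_sq, mul_pow, Real.sq_sqrt (Nat.cast_nonneg _), ← nsmul_eq_mul]
      refine Finset.sum_le_card_nsmul _ _ _ fun p _ => ?_
      rw [← sq_abs]
      exact pow_le_pow_left₀ (abs_nonneg _) (hent p) 2
  have h3 : l2 βs ≤ l2 (res (supp βs) (gap X βs)) + l2 (res (supp βs) (Z - Ξ)) := by
    have := l2_add_le (res (supp βs) (gap X βs)) (res (supp βs) (Z - Ξ))
    rwa [← res_add, ← e, res_eq_self hoff] at this
  linarith

end stages

/-! ### Operator norm bounds from the restricted isometry property -/

section gapbound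

variable {n d m : ℕ}

lemma SmallExtras.card_le {S : Finset (Idx d m)} {G : Finset (Fin m)} {N a q : ℕ}
    {E : Finset (Idx d m)} (hE : SmallExtras S G N a q E) : E.card ≤ N + q := by
  rw [← Finset.card_filter_add_card_filter_not (s := E) (fun p => p.2 ∈ G)]
  exact add_le_add hE.inner hE.outer

lemma groups_subset_union_filter (E : Finset (Idx d m)) (G : Finset (Fin m)) :
    groups E ⊆ G ∪ groups (E.filter fun p => p.2 ∉ G) := by
  intro j hj
  obtain ⟨p, hp, rfl⟩ := Finset.mem_image.1 hj
  by_cases h : p.2 ∈ G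
  · exact Finset.mem_union_left _ h
  · exact Finset.mem_union_right _ (Finset.mem_image_of_mem _ (Finset.mem_filter.2 ⟨hp, h⟩))

lemma IsInner.groups_subset {S : Finset (Idx d m)} {G : Finset (Fin m)} {N : ℕ}
    {T : Finset (Idx d m)} (hT : IsInner S G N T) : groups T ⊆ G := by
  intro j hj
  obtain ⟨p, hp, rfl⟩ := Finset.mem_image.1 hj
  exact (hT.2 p hp).2

/-- Restricting the output of `I - XᵀX/n` to a set that fits, together with the support of the
input, into the class of the restricted isometry property. -/
lemma VecRIP.l2_res_gap_le {X : Matrix (Fin n) (Idx d m) ℝ} {g k : ℕ} {δ : ℝ}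
    (hX : VecRIP X g k δ) (hn : 0 < n) (hδ : 0 ≤ δ) {U T : Finset (Idx d m)}
    (hg : (groups (U ∪ T)).card ≤ g) (hk : (U ∪ T).card ≤ k) {u : Idx d m → ℝ}
    (hu : ∀ p, p ∉ U → u p = 0) : l2 (res T (gap X u)) ≤ δ * l2 u := by
  refine DoubleSparse.l2_res_gap_le (fun v hv => ?_) (mul_nonneg hδ (l2_nonneg _))
  rw [mul_assoc]
  exact hX.gap_mul_le hn hg hk (fun p hp => hu p fun h => hp (Finset.mem_union_left _ h))
    (fun p hp => hv p fun h => hp (Finset.mem_union_right _ h))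

section direct

variable {X : Matrix (Fin n) (Idx d m) ℝ} {S : Finset (Idx d m)} {s s₀ N a q : ℕ} {δ : ℝ}

lemma VecRIP.gap_inner (hX : VecRIP X (s + 2 * a) (s * s₀ + 4 * q) δ) (hn : 0 < n) (hδ : 0 ≤ δ)
    (hS : S.card ≤ s * s₀) (hG : (groups S).card ≤ s) (hN : 2 * N + 1 ≤ 3 * q)
    {E T : Finset (Idx d m)} (hE : SmallExtras S (groups S) N a q E)
    (hT : IsInner S (groups S) N T) {u : Idx d m → ℝ} (hu : ∀ p, p ∉ S ∪ E → u p = 0) :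
    l2 (res T (gap X u)) ≤ δ * l2 u := by
  refine hX.l2_res_gap_le hn hδ ?_ ?_ hu
  · have h : groups (S ∪ E ∪ T) ⊆ groups S ∪ groups (E.filter fun p => p.2 ∉ groups S) := by
      rw [groups_union, groups_union]
      exact Finset.union_subset (Finset.union_subset Finset.subset_union_left
        (groups_subset_union_filter E _))
        (hT.groups_subset.trans Finset.subset_union_left)
    have h1 := (Finset.card_le_card h).trans (Finset.card_union_le _ _)
    have := hE.outer_groups; omega
  · have h1 := Finset.card_union_le (S ∪ E) T
    have h2 := Finset.card_union_le S E
    have h3 := hE.card_le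
    have h4 := hT.1
    omega

lemma VecRIP.gap_outer (hX : VecRIP X (s + 2 * a) (s * s₀ + 4 * q) δ) (hn : 0 < n) (hδ : 0 ≤ δ)
    (hS : S.card ≤ s * s₀) (hG : (groups S).card ≤ s) (hN : 2 * N + 1 ≤ 3 * q)
    {E T : Finset (Idx d m)} (hE : SmallExtras S (groups S) N a q E)
    (hTg : (groups T).card ≤ a) (hTq : T.card ≤ q)
    {u : Idx d m → ℝ} (hu : ∀ p, p ∉ S ∪ E → u p = 0) :
    l2 (res (S ∪ T) (gap X u)) ≤ δ * l2 u := by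
  refine hX.l2_res_gap_le hn hδ ?_ ?_ hu
  · have h : groups (S ∪ E ∪ (S ∪ T)) ⊆
        groups S ∪ groups (E.filter fun p => p.2 ∉ groups S) ∪ groups T := by
      rw [groups_union, groups_union, groups_union]
      refine Finset.union_subset (Finset.union_subset ?_
        ((groups_subset_union_filter E _).trans Finset.subset_union_left)) (Finset.union_subset ?_
          Finset.subset_union_right)
      · exact Finset.subset_union_left.trans Finset.subset_union_left
      · exact Finset.subset_union_left.trans Finset.subset_union_left
    have h1 := (Finset.card_le_card h).trans (Finset.card_union_le _ _)
    have h2 := Finset.card_union_le (groups S) (groups (E.filter fun p => p.2 ∉ groups S))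
    have := hE.outer_groups; omega
  · have e : S ∪ E ∪ (S ∪ T) = S ∪ E ∪ T := by
      ext p; simp only [Finset.mem_union]; tauto
    rw [e]
    have h1 := Finset.card_union_le (S ∪ E) T
    have h2 := Finset.card_union_le S E
    have h3 := hE.card_le
    omega

/-- With at most `q - 1` extra entries in the true groups, all supports fit into the class of the
restricted isometry property. -/
lemma VecRIP.gapBound_direct (hX : VecRIP X (s + 2 * a) (s * s₀ + 4 * q) δ) (hn : 0 < n)
    (hδ : 0 ≤ δ) (hS : S.card ≤ s * s₀) (hG : (groups S).card ≤ s) (hN : N + 1 = q) :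
    GapBound X S (groups S) N a q δ δ where
  inner E hE T hT u hu := hX.gap_inner hn hδ hS hG (by omega) hE hT hu
  outer E hE T hT u hu := (l2_res_mono Finset.subset_union_right _).trans
    (hX.gap_outer hn hδ hS hG (by omega) hE hT.1 hT.2.1 hu)
  whole E hE E' hE' u hu := by
    refine hX.l2_res_gap_le hn hδ ?_ ?_ hu
    · have h : groups (S ∪ E ∪ (S ∪ E')) ⊆
          groups S ∪ groups (E.filter fun p => p.2 ∉ groups S) ∪
            groups (E'.filter fun p => p.2 ∉ groups S) := by
        rw [groups_union, groups_union, groups_union]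
        have hs : groups S ⊆ groups S ∪ groups (E.filter fun p => p.2 ∉ groups S) ∪
            groups (E'.filter fun p => p.2 ∉ groups S) :=
          Finset.subset_union_left.trans Finset.subset_union_left
        refine Finset.union_subset (Finset.union_subset hs
          ((groups_subset_union_filter E _).trans Finset.subset_union_left)) (Finset.union_subset hs
            ((groups_subset_union_filter E' _).trans
              (Finset.union_subset hs Finset.subset_union_right)))
      have h1 := (Finset.card_le_card h).trans (Finset.card_union_le _ _)
      have h2 := Finset.card_union_le (groups S) (groups (E.filter fun p => p.2 ∉ groups S))
      have := hE.outer_groups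
      have := hE'.outer_groups
      omega
    · have e : S ∪ E ∪ (S ∪ E') = S ∪ E ∪ E' := by
        ext p; simp only [Finset.mem_union]; tauto
      rw [e]
      have h1 := Finset.card_union_le (S ∪ E) E'
      have h2 := Finset.card_union_le S E
      have h3 := hE.card_le
      have h4 := hE'.card_le
      omega

/-- With up to `3 q / 2` extra entries in the true groups, the next support is treated in two
parts. -/
lemma VecRIP.gapBound_two (hX : VecRIP X (s + 2 * a) (s * s₀ + 4 * q) δ) (hn : 0 < n)
    (hδ : 0 ≤ δ) (hS : S.card ≤ s * s₀) (hG : (groups S).card ≤ s) (hN : 2 * N + 1 ≤ 3 * q) :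
    GapBound X S (groups S) N a q δ (Real.sqrt 2 * δ) where
  inner E hE T hT u hu := hX.gap_inner hn hδ hS hG hN hE hT hu
  outer E hE T hT u hu := (l2_res_mono Finset.subset_union_right _).trans
    (hX.gap_outer hn hδ hS hG hN hE hT.1 hT.2.1 hu)
  whole E hE E' hE' u hu := by
    have h1 := hX.gap_inner hn hδ hS hG hN hE (T := E'.filter fun p => p.2 ∈ groups S)
      ⟨hE'.inner.trans (Nat.le_succ _), fun p hp =>
        ⟨hE'.notMem p (Finset.mem_filter.1 hp).1, (Finset.mem_filter.1 hp).2⟩⟩ hu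
    have h2 := hX.gap_outer hn hδ hS hG hN hE hE'.outer_groups hE'.outer hu
    have h3 := pow_le_pow_left₀ (l2_nonneg _) h1 2
    have h4 := pow_le_pow_left₀ (l2_nonneg _) h2 2
    refine abs_le_of_sq_le_sq' ?_ (mul_nonneg (by positivity) (l2_nonneg _)) |>.2
    rw [l2_res_sq] at h3 h4 ⊢
    have e : S ∪ E' = (S ∪ E'.filter fun p => p.2 ∉ groups S) ∪
        E'.filter fun p => p.2 ∈ groups S := by
      ext p; simp only [Finset.mem_union, Finset.mem_filter]; tauto
    have h5 : ∑ p ∈ S ∪ E', gap X u p ^ 2 ≤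
        ∑ p ∈ S ∪ E'.filter (fun p => p.2 ∉ groups S), gap X u p ^ 2 +
          ∑ p ∈ E'.filter (fun p => p.2 ∈ groups S), gap X u p ^ 2 := by
      rw [e]
      have := Finset.sum_union_inter (s₁ := S ∪ E'.filter fun p => p.2 ∉ groups S)
        (s₂ := E'.filter fun p => p.2 ∈ groups S) (f := fun p => gap X u p ^ 2)
      have h0 : 0 ≤ ∑ p ∈ (S ∪ E'.filter fun p => p.2 ∉ groups S) ∩
        (E'.filter fun p => p.2 ∈ groups S), gap X u p ^ 2 :=
          Finset.sum_nonneg fun _ _ => sq_nonneg _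
      linarith
    have e2 : (Real.sqrt 2 * δ * l2 u) ^ 2 = 2 * (δ * l2 u) ^ 2 := by
      rw [mul_assoc, mul_pow, Real.sq_sqrt (by norm_num)]
    rw [e2]; linarith

/-- For a small isometry constant the admissible number of extra entries and groups is raised to
half the sparsity, at the price of splitting all supports into blocks: `2`, `1` and `5` for the
test sets and for the supports of the iterates. -/
lemma VecRIP.gapBound_blocks {g k : ℕ} (hX : VecRIP X g k δ) (hn : 0 < n)
    (hδ : 0 ≤ δ) (hS : S.card ≤ s * s₀) (hG : (groups S).card ≤ s) (hg : 2 * a ≤ g)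
    (hk : 2 * (a * s₀) ≤ k) (hsa : s ≤ 2 * a) (hN : N + 1 = a * s₀) :
    GapBound X S (groups S) N a (a * s₀) (Real.sqrt 10 * δ) (5 * δ) := by
  have hss : s * s₀ ≤ 2 * (a * s₀) := by
    rw [← mul_assoc]; exact Nat.mul_le_mul_right _ hsa
  have hU : ∀ E, SmallExtras S (groups S) N a (a * s₀) E → Splits a (a * s₀) (S ∪ E) 5 := by
    intro E hE
    -- the true support and the extras in its groups: at most `2 a` groups and `3 a s₀` entries,
    -- hence `4` blocks; the other extras form one more
    have h1 : Splits a (a * s₀) (S ∪ E.filter fun p => p.2 ∈ groups S) 4 := by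
      refine splits_of_card_le 1 2 _ ?_ ?_
      · have : groups (S ∪ E.filter fun p => p.2 ∈ groups S) ⊆ groups S := by
          rw [groups_union]
          refine Finset.union_subset subset_rfl fun j hj => ?_
          obtain ⟨p, hp, rfl⟩ := Finset.mem_image.1 hj
          exact (Finset.mem_filter.1 hp).2
        have := Finset.card_le_card this
        omega
      · have := Finset.card_union_le S (E.filter fun p => p.2 ∈ groups S)
        have := hE.inner
        omega
    have h2 : Splits a (a * s₀) (E.filter fun p => p.2 ∉ groups S) 1 :=
      Splits.single hE.outer_groups hE.outer
    refine (h1.union h2).mono ?_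
    intro p hp
    simp only [Finset.mem_union, Finset.mem_filter] at hp ⊢
    tauto
  have h5 : (0 : ℝ) ≤ 5 := by norm_num
  have e10 : Real.sqrt ((5 : ℕ) : ℝ) * Real.sqrt ((2 : ℕ) : ℝ) = Real.sqrt 10 := by
    rw [← Real.sqrt_mul (by norm_num)]; norm_num
  have e5 : Real.sqrt ((5 : ℕ) : ℝ) * Real.sqrt ((1 : ℕ) : ℝ) ≤ Real.sqrt 10 := by
    rw [← Real.sqrt_mul (by norm_num)]; exact Real.sqrt_le_sqrt (by norm_num)
  refine ⟨fun E hE T hT u hu => ?_, fun E hE T hT u hu => ?_, fun E hE E' hE' u hu => ?_⟩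
  · have hT' : Splits a (a * s₀) T 2 := by
      refine splits_of_card_le 1 0 _ ?_ ?_
      · have := Finset.card_le_card hT.groups_subset; omega
      · have := hT.1; omega
    refine DoubleSparse.l2_res_gap_le (fun v hv => ?_) (by have := l2_nonneg u; positivity)
    have := hX.gap_mul_le_of_splits hδ hn hg hk (hU E hE) hT' hu hv
    rw [e10] at this; linarith
  · have hT' : Splits a (a * s₀) T 1 := Splits.single hT.1 hT.2.1
    refine DoubleSparse.l2_res_gap_le (fun v hv => ?_) (by have := l2_nonneg u; positivity)
    have := hX.gap_mul_le_of_splits hδ hn hg hk (hU E hE) hT' hu hv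
    have h6 := mul_le_mul_of_nonneg_left e5
      (mul_nonneg hδ (mul_nonneg (l2_nonneg u) (l2_nonneg v)))
    linarith
  · refine DoubleSparse.l2_res_gap_le (fun v hv => ?_) (by have := l2_nonneg u; positivity)
    have := hX.gap_mul_le_of_splits hδ hn hg hk (hU E hE) (hU E' hE') hu hv
    rw [Real.mul_self_sqrt (by norm_num)] at this
    push_cast at this; linarith

end direct

end gapbound

/-! ### Tail bound for quadratic forms of sub-Gaussian noise -/

section tail

variable {Ω : Type*} [MeasurableSpace Ω] {P : Measure Ω} {n : ℕ} {ξ : Fin n → Ω → ℝ}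

lemma hasSubgaussianMGF_sum_mul (hind : iIndepFun ξ P) (hsub : ∀ k, HasSubgaussianMGF (ξ k) 1 P)
    (c : Fin n → ℝ) :
    HasSubgaussianMGF (fun ω => ∑ k, c k * ξ k ω) (∑ k, Real.toNNReal (c k ^ 2)) P := by
  have h1 : iIndepFun (fun k ω => c k * ξ k ω) P :=
    hind.comp (fun k x => c k * x) (fun k => measurable_const_mul (c k))
  refine HasSubgaussianMGF.sum_of_iIndepFun h1 (s := Finset.univ) fun k _ => ?_
  have := (hsub k).const_mul (c k)
  convert this using 1
  refine NNReal.eq ?_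
  change max (c k ^ 2) 0 = c k ^ 2 * 1
  rw [mul_one, max_eq_left (sq_nonneg _)]

lemma lintegral_pi_ofReal_prod {ι : Type*} [Fintype ι] {f : ι → ℝ → ℝ}
    {γ : Measure ℝ} [SigmaFinite γ] (h0 : ∀ i x, 0 ≤ f i x) (hf : ∀ i, Integrable (f i) γ) :
    ∫⁻ g : ι → ℝ, ENNReal.ofReal (∏ i, f i (g i)) ∂(Measure.pi fun _ => γ) =
      ENNReal.ofReal (∏ i, ∫ x, f i x ∂γ) := by
  rw [← ofReal_integral_eq_lintegral_ofReal (Integrable.fintype_prod hf)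
    (ae_of_all _ fun g => Finset.prod_nonneg fun i _ => h0 i _), integral_fintype_prod_eq_prod]

lemma integrable_and_integral_exp_sq {θ : ℝ} (hθ : θ < 1 / 2) :
    Integrable (fun x => Real.exp (θ * x ^ 2)) (gaussianReal 0 1) ∧
      ∫ x, Real.exp (θ * x ^ 2) ∂(gaussianReal 0 1) = Real.sqrt (1 / (1 - 2 * θ)) := by
  have hb : 0 < 1 / 2 - θ := by linarith
  have e : ∀ x : ℝ, gaussianPDFReal 0 1 x * Real.exp (θ * x ^ 2) =
      (Real.sqrt (2 * Real.pi))⁻¹ * Real.exp (-(1 / 2 - θ) * x ^ 2) := by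
    intro x
    rw [gaussianPDFReal, mul_assoc, ← Real.exp_add]
    simp only [NNReal.coe_one, mul_one, sub_zero]
    congr 2; ring
  constructor
  · rw [gaussianReal_of_var_ne_zero 0 one_ne_zero, integrable_withDensity_iff_integrable_smul'
      (measurable_gaussianPDF 0 1) (ae_of_all _ fun x => ENNReal.ofReal_lt_top)]
    have : (fun x => (gaussianPDF 0 1 x).toReal • Real.exp (θ * x ^ 2)) =
        fun x => (Real.sqrt (2 * Real.pi))⁻¹ * Real.exp (-(1 / 2 - θ) * x ^ 2) := by
      funext x
      rw [gaussianPDF, ENNReal.toReal_ofReal (gaussianPDFReal_nonneg _ _ _), smul_eq_mul, e]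
    rw [this]
    exact (integrable_exp_neg_mul_sq hb).const_mul _
  · rw [integral_gaussianReal_eq_integral_smul one_ne_zero]
    simp only [smul_eq_mul, e]
    rw [integral_const_mul, integral_gaussian, ← Real.sqrt_inv, ← Real.sqrt_mul (by positivity)]
    congr 1
    have := Real.pi_pos
    have h2 : 1 - 2 * θ ≠ 0 := by linarith
    field_simp

/-- Tail bound for `‖B ξ‖²` when `‖Bᵀ v‖² ≤ ρ ‖v‖²`. The exponential moment of the quadratic form
is linearized by an independent Gaussian vector. -/
lemma measure_sum_sq_ge_le [IsProbabilityMeasure P] (hind : iIndepFun ξ P)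
    (hsub : ∀ k, HasSubgaussianMGF (ξ k) 1 P) {ι : Type*} [Fintype ι] (B : ι → Fin n → ℝ)
    {ρ θ : ℝ} (hρ : 0 < ρ) (hB : ∀ v : ι → ℝ, ∑ k, (∑ i, v i * B i k) ^ 2 ≤ ρ * ∑ i, v i ^ 2)
    (hθ0 : 0 ≤ θ) (hθ : θ < 1 / 2) (y : ℝ) :
    P {ω | y ≤ ∑ i, (∑ k, B i k * ξ k ω) ^ 2} ≤
      ENNReal.ofReal (Real.exp (-(θ * y / ρ)) *
        Real.sqrt (1 / (1 - 2 * θ)) ^ Fintype.card ι) := by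
  set γ : Measure (ι → ℝ) := Measure.pi fun _ => gaussianReal 0 1 with hγ
  set z : ι → Ω → ℝ := fun i ω => ∑ k, B i k * ξ k ω with hz
  set w : ℝ := Real.sqrt (2 * θ / ρ) with hw
  have hw2 : w ^ 2 = 2 * θ / ρ := Real.sq_sqrt (by positivity)
  have hzm : ∀ i, AEMeasurable (z i) P := fun i =>
    (hasSubgaussianMGF_sum_mul hind hsub (B i)).aemeasurable
  -- `exp (θ ‖z‖² / ρ)` is the Gaussian average of `exp (w ⟨g, z⟩)`
  have h1 : ∀ ω, ∫⁻ g, ENNReal.ofReal (Real.exp (w * ∑ i, g i * z i ω)) ∂γ =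
      ENNReal.ofReal (Real.exp (θ / ρ * ∑ i, z i ω ^ 2)) := by
    intro ω
    have e : ∀ g : ι → ℝ, Real.exp (w * ∑ i, g i * z i ω) =
        ∏ i, Real.exp ((w * z i ω) * g i) := fun g => by
      rw [← Real.exp_sum, Finset.mul_sum]
      congr 1; exact Finset.sum_congr rfl fun i _ => by ring
    simp only [e]
    rw [hγ, lintegral_pi_ofReal_prod (f := fun i x => Real.exp ((w * z i ω) * x))
      (fun i x => (Real.exp_pos _).le)
      (fun i => integrable_exp_mul_gaussianReal _)]
    congr 1
    have e2 : ∀ i, ∫ x, Real.exp ((w * z i ω) * x) ∂(gaussianReal 0 1) =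
        Real.exp (θ / ρ * z i ω ^ 2) := fun i => by
      have := congrFun (mgf_fun_id_gaussianReal (μ := 0) (v := 1)) (w * z i ω)
      rw [mgf] at this
      rw [this]
      congr 1
      rw [mul_pow, hw2]; push_cast; ring
    simp only [e2]
    rw [← Real.exp_sum, Finset.mul_sum]
  -- for fixed `g` the functional `⟨g, z⟩` is sub-Gaussian with proxy `ρ ‖g‖²`
  have h2 : ∀ g : ι → ℝ, ∫⁻ ω, ENNReal.ofReal (Real.exp (w * ∑ i, g i * z i ω)) ∂P ≤
      ENNReal.ofReal (∏ i, Real.exp (θ * g i ^ 2)) := by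
    intro g
    have e : ∀ ω, ∑ i, g i * z i ω = ∑ k, (∑ i, g i * B i k) * ξ k ω := fun ω => by
      simp only [hz, Finset.mul_sum, Finset.sum_mul]
      rw [Finset.sum_comm]
      exact Finset.sum_congr rfl fun k _ => Finset.sum_congr rfl fun i _ => by ring
    have hs := hasSubgaussianMGF_sum_mul hind hsub fun k => ∑ i, g i * B i k
    simp only [e]
    rw [← ofReal_integral_eq_lintegral_ofReal (hs.integrable_exp_mul w)
      (ae_of_all _ fun ω => (Real.exp_pos _).le)]
    refine ENNReal.ofReal_le_ofReal ((hs.mgf_le w).trans ?_)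
    rw [← Real.exp_sum, ← Finset.mul_sum]
    refine Real.exp_le_exp.2 ?_
    push_cast
    have e3 : ∑ k, ((Real.toNNReal ((∑ i, g i * B i k) ^ 2) : NNReal) : ℝ) =
        ∑ k, (∑ i, g i * B i k) ^ 2 :=
      Finset.sum_congr rfl fun k _ => Real.coe_toNNReal _ (sq_nonneg _)
    rw [e3, hw2]
    have := mul_le_mul_of_nonneg_right (hB g) (by positivity : 0 ≤ θ / ρ)
    calc _ = (∑ k, (∑ i, g i * B i k) ^ 2) * (θ / ρ) := by ring
      _ ≤ _ := this
      _ = _ := by field_simp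
  -- the remaining Gaussian integral of `exp (θ ‖g‖²)` factorizes
  have h3 : ∫⁻ ω, ENNReal.ofReal (Real.exp (θ / ρ * ∑ i, z i ω ^ 2)) ∂P ≤
      ENNReal.ofReal (Real.sqrt (1 / (1 - 2 * θ)) ^ Fintype.card ι) := by
    simp only [← h1]
    rw [lintegral_lintegral_swap]
    · refine (lintegral_mono h2).trans (le_of_eq ?_)
      obtain ⟨hi, hv⟩ := integrable_and_integral_exp_sq hθ
      rw [hγ, lintegral_pi_ofReal_prod (f := fun _ x => Real.exp (θ * x ^ 2))
        (fun i x => (Real.exp_pos _).le) (fun _ => hi)]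
      rw [Finset.prod_const, hv, Finset.card_univ]
    · refine (ENNReal.measurable_ofReal.comp Real.measurable_exp).comp_aemeasurable ?_
      refine AEMeasurable.const_mul ?_ w
      refine Finset.aemeasurable_fun_sum _ fun i _ => AEMeasurable.mul ?_ ?_
      · exact ((measurable_pi_apply i).comp measurable_snd).aemeasurable
      · exact (hzm i).comp_quasiMeasurePreserving Measure.quasiMeasurePreserving_fst
  have h4 := mul_meas_ge_le_lintegral₀ (μ := P)
    (f := fun ω => ENNReal.ofReal (Real.exp (θ / ρ * ∑ i, z i ω ^ 2)))
    ((ENNReal.measurable_ofReal.comp Real.measurable_exp).comp_aemeasurable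
      (AEMeasurable.const_mul (Finset.aemeasurable_fun_sum _ fun i _ => (hzm i).pow_const 2) _))
    (ENNReal.ofReal (Real.exp (θ * y / ρ)))
  have hsubset : {ω | y ≤ ∑ i, z i ω ^ 2} ⊆ {ω | ENNReal.ofReal (Real.exp (θ * y / ρ)) ≤
      ENNReal.ofReal (Real.exp (θ / ρ * ∑ i, z i ω ^ 2))} := by
    intro ω hω
    refine ENNReal.ofReal_le_ofReal (Real.exp_le_exp.2 ?_)
    have := mul_le_mul_of_nonneg_left (show y ≤ ∑ i, z i ω ^ 2 from hω)
      (by positivity : 0 ≤ θ / ρ)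
    calc θ * y / ρ = θ / ρ * y := by ring
      _ ≤ _ := this
  have h5 : ENNReal.ofReal (Real.exp (θ * y / ρ)) * P {ω | y ≤ ∑ i, z i ω ^ 2} ≤
      ENNReal.ofReal (Real.sqrt (1 / (1 - 2 * θ)) ^ Fintype.card ι) :=
    (mul_le_mul_right (measure_mono hsubset) _).trans (h4.trans h3)
  rw [Real.exp_neg, ENNReal.ofReal_mul (by positivity), ENNReal.ofReal_inv_of_pos (Real.exp_pos _),
    mul_comm, ← div_eq_mul_inv, ENNReal.le_div_iff_mul_le (by simp [Real.exp_pos]) (by simp),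
    mul_comm]
  exact h5

end tail

/-! ### Counting sparse supports -/

section counting

/-- The number of subsets with at most `k` elements. A set `T` is given the weight `(k / N) ^ |T|`,
which is at least `(k / N) ^ k`, and all weights sum to `(1 + k / N) ^ |V|`. -/
lemma card_powerset_card_le {ι : Type*} (V : Finset ι) {k N : ℕ} (hk : 0 < k) (hkN : k ≤ N)
    (hV : V.card ≤ N) :
    ((V.powerset.filter fun T => T.card ≤ k).card : ℝ) ≤ (Real.exp 1 * N / k) ^ k := by
  have hk' : (0 : ℝ) < k := by exact_mod_cast hk
  have hN' : (0 : ℝ) < N := by exact_mod_cast hk.trans_le hkN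
  set x : ℝ := k / N with hx
  have hx0 : 0 < x := by positivity
  have hx1 : x ≤ 1 := (div_le_one hN').2 (by exact_mod_cast hkN)
  have h1 : ((V.powerset.filter fun T => T.card ≤ k).card : ℝ) * x ^ k ≤ (1 + x) ^ V.card := by
    rw [add_comm, ← Finset.prod_const, Finset.prod_add_one]
    simp only [Finset.prod_const]
    calc _ = ∑ T ∈ V.powerset.filter (fun T => T.card ≤ k), x ^ k := by
          rw [Finset.sum_const, nsmul_eq_mul]
      _ ≤ ∑ T ∈ V.powerset.filter (fun T => T.card ≤ k), x ^ T.card :=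
          Finset.sum_le_sum fun T hT =>
            pow_le_pow_of_le_one hx0.le hx1 (Finset.mem_filter.1 hT).2
      _ ≤ _ := Finset.sum_le_sum_of_subset_of_nonneg (Finset.filter_subset _ _)
          fun _ _ _ => by positivity
  have h2 : (1 + x) ^ V.card ≤ Real.exp 1 ^ k := by
    calc (1 + x) ^ V.card ≤ (1 + x) ^ N := pow_le_pow_right₀ (by linarith) hV
      _ ≤ Real.exp x ^ N := pow_le_pow_left₀ (by linarith) (by
          rw [add_comm]; exact Real.add_one_le_exp x) _
      _ = Real.exp 1 ^ k := by
          rw [← Real.exp_nat_mul, ← Real.exp_nat_mul]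
          congr 1; rw [hx]; field_simp
  have h3 : Real.exp 1 * N / k = Real.exp 1 / x := by rw [hx]; field_simp
  rw [h3, div_pow, le_div_iff₀ (by positivity)]
  exact h1.trans h2

end counting

/-! ### Least squares on a fixed support -/

section ols

variable {n : ℕ} {ι : Type*} [Fintype ι] [DecidableEq ι] {A : Matrix (Fin n) ι ℝ} {a b : ℝ}

lemma mulVec_gram_dotProduct {ι : Type*} [Fintype ι] (A : Matrix (Fin n) ι ℝ) (u v : ι → ℝ) :
    u ⬝ᵥ ((Aᵀ * A) *ᵥ v) = (A *ᵥ u) ⬝ᵥ (A *ᵥ v) := by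
  rw [← Matrix.mulVec_mulVec, Matrix.mulVec_transpose, dotProduct_comm,
    ← Matrix.dotProduct_mulVec, dotProduct_comm]

lemma dotProduct_self_eq {κ : Type*} [Fintype κ] (v : κ → ℝ) : v ⬝ᵥ v = ∑ i, v i ^ 2 := by
  simp [dotProduct, pow_two]

lemma isUnit_det_gram (ha : 0 < a) (hA : ∀ u, a * ∑ i, u i ^ 2 ≤ ∑ k, ((A *ᵥ u) k) ^ 2) :
    IsUnit (Aᵀ * A).det := by
  rw [← Matrix.isUnit_iff_isUnit_det, ← Matrix.mulVec_injective_iff_isUnit]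
  intro u v huv
  have h0 : (Aᵀ * A) *ᵥ (u - v) = 0 := by rw [Matrix.mulVec_sub, sub_eq_zero]; exact huv
  have h1 := mulVec_gram_dotProduct A (u - v) (u - v)
  rw [h0, dotProduct_zero, dotProduct_self_eq] at h1
  have h2 := hA (u - v)
  rw [← h1] at h2
  have h3 : ∑ i, (u - v) i ^ 2 = 0 :=
    le_antisymm (by nlinarith) (Finset.sum_nonneg fun _ _ => sq_nonneg _)
  funext i
  have h4 := (Finset.sum_eq_zero_iff_of_nonneg (fun i _ => sq_nonneg ((u - v) i))).1 h3 i
    (Finset.mem_univ i)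
  have h5 : (u - v) i = 0 := by simpa using h4
  exact sub_eq_zero.1 h5

lemma gram_inv_mulVec (h : IsUnit (Aᵀ * A).det) (v : ι → ℝ) :
    (Aᵀ * A) *ᵥ ((Aᵀ * A)⁻¹ *ᵥ v) = v := by
  rw [Matrix.mulVec_mulVec, Matrix.mul_nonsing_inv _ h, Matrix.one_mulVec]

lemma sum_sq_mulVec_gram_inv (h : IsUnit (Aᵀ * A).det) (v : ι → ℝ) :
    ∑ k, ((A *ᵥ ((Aᵀ * A)⁻¹ *ᵥ v)) k) ^ 2 = v ⬝ᵥ ((Aᵀ * A)⁻¹ *ᵥ v) := by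
  rw [← dotProduct_self_eq, ← mulVec_gram_dotProduct, gram_inv_mulVec h, dotProduct_comm]

lemma l2_gram_inv_le (ha : 0 < a) (hA : ∀ u, a * ∑ i, u i ^ 2 ≤ ∑ k, ((A *ᵥ u) k) ^ 2)
    (v : ι → ℝ) : a * l2 ((Aᵀ * A)⁻¹ *ᵥ v) ≤ l2 v := by
  have h := isUnit_det_gram ha hA
  have h1 := hA ((Aᵀ * A)⁻¹ *ᵥ v)
  rw [sum_sq_mulVec_gram_inv h, ← l2_sq] at h1
  have h2 : v ⬝ᵥ ((Aᵀ * A)⁻¹ *ᵥ v) ≤ l2 v * l2 ((Aᵀ * A)⁻¹ *ᵥ v) := sum_mul_le_l2 _ _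
  rcases (l2_nonneg ((Aᵀ * A)⁻¹ *ᵥ v)).eq_or_lt with h0 | h0
  · rw [← h0, mul_zero]; exact l2_nonneg v
  · refine le_of_mul_le_mul_right ?_ h0
    nlinarith

lemma sum_sq_mulVec_gram_inv_le (ha : 0 < a)
    (hA : ∀ u, a * ∑ i, u i ^ 2 ≤ ∑ k, ((A *ᵥ u) k) ^ 2) (v : ι → ℝ) :
    ∑ k, ((A *ᵥ ((Aᵀ * A)⁻¹ *ᵥ v)) k) ^ 2 ≤ 1 / a * ∑ i, v i ^ 2 := by
  rw [sum_sq_mulVec_gram_inv (isUnit_det_gram ha hA), ← l2_sq]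
  have h1 := l2_gram_inv_le ha hA v
  have h2 : v ⬝ᵥ ((Aᵀ * A)⁻¹ *ᵥ v) ≤ l2 v * l2 ((Aᵀ * A)⁻¹ *ᵥ v) := sum_mul_le_l2 _ _
  have h3 : l2 ((Aᵀ * A)⁻¹ *ᵥ v) ≤ 1 / a * l2 v := by
    rw [one_div, le_inv_mul_iff₀ ha]; exact h1
  calc _ ≤ l2 v * (1 / a * l2 v) := h2.trans (mul_le_mul_of_nonneg_left h3 (l2_nonneg v))
    _ = _ := by ring

lemma sum_sq_le_gram_inv (hb : 0 ≤ b) (hA : ∀ u, ∑ k, ((A *ᵥ u) k) ^ 2 ≤ b * ∑ i, u i ^ 2)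
    (h : IsUnit (Aᵀ * A).det) (v : ι → ℝ) :
    ∑ i, v i ^ 2 ≤ b * (v ⬝ᵥ ((Aᵀ * A)⁻¹ *ᵥ v)) := by
  rw [← sum_sq_mulVec_gram_inv h]
  have h1 : ∑ i, v i ^ 2 = (A *ᵥ v) ⬝ᵥ (A *ᵥ ((Aᵀ * A)⁻¹ *ᵥ v)) := by
    rw [← mulVec_gram_dotProduct, gram_inv_mulVec h, dotProduct_self_eq]
  have h2 : (A *ᵥ v) ⬝ᵥ (A *ᵥ ((Aᵀ * A)⁻¹ *ᵥ v)) ≤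
      l2 (A *ᵥ v) * l2 (A *ᵥ ((Aᵀ * A)⁻¹ *ᵥ v)) := sum_mul_le_l2 _ _
  have h3 : l2 (A *ᵥ v) ≤ Real.sqrt b * l2 v := by
    rw [l2, l2, ← Real.sqrt_mul hb]; exact Real.sqrt_le_sqrt (hA v)
  rw [← l2_sq, ← l2_sq]
  rw [← l2_sq] at h1
  rcases (l2_nonneg v).eq_or_lt with h0 | h0
  · rw [← h0, zero_pow two_ne_zero]; positivity
  have h4 : l2 v ≤ Real.sqrt b * l2 (A *ᵥ ((Aᵀ * A)⁻¹ *ᵥ v)) := by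
    refine le_of_mul_le_mul_left ?_ h0
    calc l2 v * l2 v = l2 v ^ 2 := by ring
      _ ≤ _ := h1.le.trans h2
      _ ≤ (Real.sqrt b * l2 v) * l2 (A *ᵥ ((Aᵀ * A)⁻¹ *ᵥ v)) :=
        mul_le_mul_of_nonneg_right h3 (l2_nonneg _)
      _ = _ := by ring
  have := pow_le_pow_left₀ (l2_nonneg v) h4 2
  rwa [mul_pow, Real.sq_sqrt hb] at this

/-- The residual maker `I - A (AᵀA)⁻¹ Aᵀ`. -/
def residMat (A : Matrix (Fin n) ι ℝ) : Matrix (Fin n) (Fin n) ℝ :=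
  1 - A * (Aᵀ * A)⁻¹ * Aᵀ

lemma residMat_transpose (A : Matrix (Fin n) ι ℝ) : (residMat A)ᵀ = residMat A := by
  simp [residMat, Matrix.transpose_sub, Matrix.transpose_mul, Matrix.transpose_nonsing_inv,
    Matrix.mul_assoc]

lemma transpose_mul_residMat (h : IsUnit (Aᵀ * A).det) : Aᵀ * residMat A = 0 := by
  rw [residMat, Matrix.mul_sub, Matrix.mul_one, ← Matrix.mul_assoc, ← Matrix.mul_assoc,
    Matrix.mul_nonsing_inv _ h, Matrix.one_mul, sub_self]

lemma residMat_mul_self (h : IsUnit (Aᵀ * A).det) : residMat A * residMat A = residMat A := by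
  conv_lhs => enter [1]; rw [residMat]
  rw [Matrix.sub_mul, Matrix.one_mul, Matrix.mul_assoc, transpose_mul_residMat h, Matrix.mul_zero,
    sub_zero]

lemma sum_sq_residMat_le (h : IsUnit (Aᵀ * A).det) (u : Fin n → ℝ) :
    ∑ k, ((residMat A *ᵥ u) k) ^ 2 ≤ ∑ k, u k ^ 2 := by
  have h1 : ∑ k, ((residMat A *ᵥ u) k) ^ 2 = ∑ k, u k * (residMat A *ᵥ u) k := by
    rw [← dotProduct_self_eq, ← mulVec_gram_dotProduct, residMat_transpose, residMat_mul_self h]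
    rfl
  have h2 := sum_mul_le_l2 u (residMat A *ᵥ u)
  rw [← h1, ← l2_sq] at h2
  rw [← l2_sq, ← l2_sq]
  rcases (l2_nonneg (residMat A *ᵥ u)).eq_or_lt with h0 | h0
  · rw [← h0, zero_pow two_ne_zero]; positivity
  · refine pow_le_pow_left₀ h0.le (le_of_mul_le_mul_right ?_ h0) 2
    rwa [← pow_two]

end ols

section oracle

variable {n d m : ℕ} {X : Matrix (Fin n) (Idx d m) ℝ} {β : Idx d m → ℝ} {σ : ℝ}

/-- The vector on all coordinates that agrees with the oracle estimator on `S` and vanishes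
elsewhere. -/
def oracleVec (X : Matrix (Fin n) (Idx d m) ℝ) (Y : Fin n → ℝ) (S : Finset (Idx d m)) :
    Idx d m → ℝ :=
  fun p => if h : p ∈ S then oracleOLS X Y S ⟨p, h⟩ else 0

lemma supp_off {p : Idx d m} (hp : p ∉ supp β) : β p = 0 := by simpa [supp] using hp

lemma VecRIP.subMatrix_bounds {g k : ℕ} {δ : ℝ} (hX : VecRIP X g k δ) {S : Finset (Idx d m)}
    (hg : (groups S).card ≤ g) (hk : S.card ≤ k) (u : S → ℝ) :
    (n : ℝ) * (1 - δ) * ∑ i, u i ^ 2 ≤ ∑ k, ((subMatrix X S *ᵥ u) k) ^ 2 ∧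
    ∑ k, ((subMatrix X S *ᵥ u) k) ^ 2 ≤ (n : ℝ) * (1 + δ) * ∑ i, u i ^ 2 := by
  set v : Idx d m → ℝ := fun p => if h : p ∈ S then u ⟨p, h⟩ else 0 with hv
  have hoff : ∀ p, p ∉ S → v p = 0 := fun p hp => by simp [hv, hp]
  have hon : (fun q : S => v q) = u := by funext q; simp [hv]
  have hsub : supp v ⊆ S := fun p hp => by
    by_contra h; exact mem_supp.1 hp (hoff p h)
  have h1 := hX v ((Finset.card_le_card (groups_mono hsub)).trans hg)
    ((Finset.card_le_card hsub).trans hk)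
  rw [← subMatrix_mulVec X S hoff, ← sum_subtype_sq S hoff, hon] at h1
  have e : ∀ q : S, v q = u q := fun q => congrFun hon q
  simpa only [e] using h1

lemma oracleOLS_response (h : IsUnit ((subMatrix X (supp β))ᵀ * subMatrix X (supp β)).det)
    (ξ : Fin n → ℝ) (q : supp β) :
    oracleOLS X (response X β σ ξ) (supp β) q - β q =
      σ * (((subMatrix X (supp β))ᵀ * subMatrix X (supp β))⁻¹ *ᵥ
        ((subMatrix X (supp β))ᵀ *ᵥ ξ)) q := by
  have e : response X β σ ξ = subMatrix X (supp β) *ᵥ (fun q : supp β => β q) + σ • ξ := by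
    rw [response, subMatrix_mulVec X _ fun p hp => supp_off hp]
  rw [oracleOLS, e, Matrix.mulVec_add, Matrix.mulVec_add, Matrix.mulVec_mulVec,
    Matrix.mulVec_mulVec, Matrix.mul_assoc, Matrix.nonsing_inv_mul _ h, Matrix.one_mulVec,
    Matrix.mulVec_smul, Matrix.mulVec_smul]
  simp

lemma response_sub_oracleVec
    (h : IsUnit ((subMatrix X (supp β))ᵀ * subMatrix X (supp β)).det) (ξ : Fin n → ℝ) :
    response X β σ ξ - X *ᵥ oracleVec X (response X β σ ξ) (supp β) =
      σ • (residMat (subMatrix X (supp β)) *ᵥ ξ) := by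
  set A := subMatrix X (supp β) with hA
  have e : response X β σ ξ = A *ᵥ (fun q : supp β => β q) + σ • ξ := by
    rw [response, subMatrix_mulVec X _ fun p hp => supp_off hp]
  have e2 : X *ᵥ oracleVec X (response X β σ ξ) (supp β) =
      A *ᵥ oracleOLS X (response X β σ ξ) (supp β) := by
    rw [← subMatrix_mulVec X (supp β) fun p hp => by simp [oracleVec, hp]]
    congr 1; funext q; simp [oracleVec]
  have e3 : oracleOLS X (response X β σ ξ) (supp β) = (fun q : supp β => β q) +
      σ • ((Aᵀ * A)⁻¹ *ᵥ (Aᵀ *ᵥ ξ)) := by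
    funext q
    have := oracleOLS_response (σ := σ) h ξ q
    simp only [Pi.add_apply, Pi.smul_apply, smul_eq_mul]
    rw [← this]; ring
  rw [e2, e3, e, residMat, Matrix.mulVec_add, Matrix.mulVec_smul, Matrix.sub_mulVec,
    Matrix.one_mulVec, smul_sub, Matrix.mulVec_mulVec, Matrix.mulVec_mulVec, Matrix.mul_assoc]
  abel

/-- The noise correlations `(σ/n) Xᵀ ξ`. -/
def noiseVec (X : Matrix (Fin n) (Idx d m) ℝ) (σ : ℝ) (ξ : Fin n → ℝ) : Idx d m → ℝ :=
  (1 / (n : ℝ)) • (Xᵀ *ᵥ (σ • ξ))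

/-- The correlations of the design with the residual of the oracle estimator. -/
def residVec (X : Matrix (Fin n) (Idx d m) ℝ) (S : Finset (Idx d m)) (σ : ℝ) (ξ : Fin n → ℝ) :
    Idx d m → ℝ :=
  (1 / (n : ℝ)) • (Xᵀ *ᵥ (σ • (residMat (subMatrix X S) *ᵥ ξ)))

lemma noiseVec_eq (ξ : Fin n → ℝ) :
    (1 / (n : ℝ)) • (Xᵀ *ᵥ (response X β σ ξ - X *ᵥ β)) = noiseVec X σ ξ := by
  rw [noiseVec, response, add_sub_cancel_left]

lemma residVec_eq_zero {S : Finset (Idx d m)}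
    (h : IsUnit ((subMatrix X S)ᵀ * subMatrix X S).det) (ξ : Fin n → ℝ) {p : Idx d m}
    (hp : p ∈ S) : residVec X S σ ξ p = 0 := by
  have h1 : ((subMatrix X S)ᵀ *ᵥ (residMat (subMatrix X S) *ᵥ ξ)) ⟨p, hp⟩ = 0 := by
    rw [Matrix.mulVec_mulVec, transpose_mul_residMat h]; simp
  have h2 : (Xᵀ *ᵥ (residMat (subMatrix X S) *ᵥ ξ)) p = 0 := h1
  rw [residVec, Matrix.mulVec_smul]
  simp only [Pi.smul_apply, h2, smul_zero]

/-- On the support, the oracle estimator differs from the truth by the inverse Gram matrix applied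
to the noise correlations. -/
lemma l2_oracleVec_sub_le {δ : ℝ} (hn : 0 < n) (hδ : δ < 1)
    (hA : ∀ u : supp β → ℝ, (n : ℝ) * (1 - δ) * ∑ i, u i ^ 2 ≤
      ∑ k, ((subMatrix X (supp β) *ᵥ u) k) ^ 2) (ξ : Fin n → ℝ) :
    (1 - δ) * l2 (oracleVec X (response X β σ ξ) (supp β) - β) ≤
      l2 (res (supp β) (noiseVec X σ ξ)) := by
  set A := subMatrix X (supp β) with hAdef
  have hn' : (0 : ℝ) < n := by exact_mod_cast hn
  have ha : 0 < (n : ℝ) * (1 - δ) := mul_pos hn' (by linarith)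
  have h := isUnit_det_gram ha hA
  have h1 := l2_gram_inv_le ha hA (σ • (Aᵀ *ᵥ ξ))
  have e1 : l2 ((Aᵀ * A)⁻¹ *ᵥ (σ • (Aᵀ *ᵥ ξ))) =
      l2 (oracleVec X (response X β σ ξ) (supp β) - β) := by
    rw [l2, l2]
    congr 1
    rw [← sum_subtype_sq (supp β) (fun p hp => by simp [oracleVec, hp, supp_off hp])]
    refine Finset.sum_congr rfl fun q _ => ?_
    have := oracleOLS_response (σ := σ) h ξ q
    simp only [Pi.sub_apply, oracleVec, q.2, dif_pos]
    rw [this, Matrix.mulVec_smul]; rfl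
  have e2 : l2 (σ • (Aᵀ *ᵥ ξ)) = n * l2 (res (supp β) (noiseVec X σ ξ)) := by
    rw [← abs_of_pos hn', ← l2_smul]
    rw [l2, l2]
    congr 1
    rw [← sum_subtype_sq (supp β) (fun p hp => by simp [res, hp])]
    refine Finset.sum_congr rfl fun q _ => ?_
    have : (Aᵀ *ᵥ ξ) q = (Xᵀ *ᵥ ξ) q := rfl
    simp only [Pi.smul_apply, smul_eq_mul, res, q.2, if_true, noiseVec, Matrix.mulVec_smul, this]
    field_simp
  rw [e1, e2] at h1
  refine le_of_mul_le_mul_left ?_ hn'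
  linarith

end oracle

/-! ### Tail bounds for restrictions of linear images of the noise -/

section tails

variable {n d m : ℕ}

/-- `ρ` bounds the variance proxy of all linear functionals, with coefficients on `T`, of `B ξ` for
a `1`-sub-Gaussian vector `ξ` with independent coordinates. -/
def ProxyBound (B : Matrix (Idx d m) (Fin n) ℝ) (T : Finset (Idx d m)) (ρ : ℝ) : Prop :=
  ∀ v : Idx d m → ℝ, (∀ p, p ∉ T → v p = 0) → ∑ k, ((Bᵀ *ᵥ v) k) ^ 2 ≤ ρ * ∑ p, v p ^ 2

lemma measure_l2_res_gt_le {Ω : Type*} [MeasurableSpace Ω] {P : Measure Ω} [IsProbabilityMeasure P]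
    {ξ : Fin n → Ω → ℝ} (hind : iIndepFun ξ P) (hsub : ∀ k, HasSubgaussianMGF (ξ k) 1 P)
    {B : Matrix (Idx d m) (Fin n) ℝ} {T : Finset (Idx d m)} {ρ θ r : ℝ} (hρ : 0 < ρ)
    (hB : ProxyBound B T ρ) (hθ0 : 0 ≤ θ) (hθ : θ < 1 / 2) (hr : 0 ≤ r) :
    P {ω | r < l2 (res T (B *ᵥ fun k => ξ k ω))} ≤
      ENNReal.ofReal (Real.exp (-(θ * r ^ 2 / ρ)) * Real.sqrt (1 / (1 - 2 * θ)) ^ T.card) := by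
  have h := measure_sum_sq_ge_le hind hsub (fun (q : T) k => B q k) hρ (fun v => ?_) hθ0 hθ (r ^ 2)
  · rw [Fintype.card_coe] at h
    refine (measure_mono fun ω hω => ?_).trans h
    have h1 := pow_le_pow_left₀ hr (le_of_lt (Set.mem_ofPred.1 hω)) 2
    rw [l2_res_sq, ← Finset.sum_coe_sort] at h1
    exact h1
  · set w : Idx d m → ℝ := fun p => if h : p ∈ T then v ⟨p, h⟩ else 0 with hw
    have hoff : ∀ p, p ∉ T → w p = 0 := fun p hp => by simp [hw, hp]
    have h1 := hB w hoff
    rw [← sum_subtype_sq T hoff] at h1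
    have e1 : ∀ q : T, w q = v q := fun q => by simp [hw]
    have e2 : ∀ k, (Bᵀ *ᵥ w) k = ∑ q : T, v q * B q k := by
      intro k
      simp only [Matrix.mulVec, dotProduct, Matrix.transpose_apply]
      rw [← Finset.sum_subset (Finset.subset_univ T) (fun p _ hp => by rw [hoff p hp, mul_zero]),
        ← Finset.sum_coe_sort]
      exact Finset.sum_congr rfl fun q _ => by rw [e1, mul_comm]
    simp only [e1, e2] at h1
    exact h1

/-- The factor `√10` per coordinate belongs to the exponent `9/20`. -/
lemma measure_exists_l2_res_gt_le {Ω : Type*} [MeasurableSpace Ω] {P : Measure Ω}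
    [IsProbabilityMeasure P] {ξ : Fin n → Ω → ℝ} (hind : iIndepFun ξ P)
    (hsub : ∀ k, HasSubgaussianMGF (ξ k) 1 P)
    {B : Matrix (Idx d m) (Fin n) ℝ} {𝒯 : Finset (Finset (Idx d m))} {k : ℕ} {ρ r M : ℝ}
    (hρ : 0 < ρ) (hB : ∀ T ∈ 𝒯, ProxyBound B T ρ) (hk : ∀ T ∈ 𝒯, T.card ≤ k) (hr : 0 ≤ r)
    (hM : (𝒯.card : ℝ) ≤ M) :
    P {ω | ∃ T ∈ 𝒯, r < l2 (res T (B *ᵥ fun k => ξ k ω))} ≤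
      ENNReal.ofReal (M * Real.sqrt 10 ^ k * Real.exp (-(9 / 20 * r ^ 2 / ρ))) := by
  have e : {ω | ∃ T ∈ 𝒯, r < l2 (res T (B *ᵥ fun k => ξ k ω))} =
      ⋃ T ∈ 𝒯, {ω | r < l2 (res T (B *ᵥ fun k => ξ k ω))} := by
    ext ω; simp
  rw [e]
  refine (measure_biUnion_finset_le _ _).trans ?_
  have h1 : ∀ T ∈ 𝒯, P {ω | r < l2 (res T (B *ᵥ fun k => ξ k ω))} ≤
      ENNReal.ofReal (Real.sqrt 10 ^ k * Real.exp (-(9 / 20 * r ^ 2 / ρ))) := by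
    intro T hT
    refine (measure_l2_res_gt_le hind hsub hρ (hB T hT) (θ := 9 / 20) (by norm_num) (by norm_num)
      hr).trans (ENNReal.ofReal_le_ofReal ?_)
    rw [mul_comm]
    refine mul_le_mul_of_nonneg_right ?_ (Real.exp_pos _).le
    have e10 : (1 : ℝ) / (1 - 2 * (9 / 20)) = 10 := by norm_num
    rw [e10]
    exact pow_le_pow_right₀ (Real.one_le_sqrt.2 (by norm_num)) (hk T hT)
  refine (Finset.sum_le_card_nsmul _ _ _ h1).trans ?_
  rw [nsmul_eq_mul, ← ENNReal.ofReal_natCast, ← ENNReal.ofReal_mul (Nat.cast_nonneg _)]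
  refine ENNReal.ofReal_le_ofReal ?_
  rw [mul_assoc]
  exact mul_le_mul_of_nonneg_right hM (by positivity)

lemma measure_exists_abs_gt_le {Ω : Type*} [MeasurableSpace Ω] {P : Measure Ω}
    [IsProbabilityMeasure P] {ξ : Fin n → Ω → ℝ} (hind : iIndepFun ξ P)
    (hsub : ∀ k, HasSubgaussianMGF (ξ k) 1 P)
    {B : Matrix (Idx d m) (Fin n) ℝ} {V : Finset (Idx d m)} {ρ r M : ℝ}
    (hρ : 0 < ρ) (hB : ∀ p ∈ V, ProxyBound B {p} ρ) (hr : 0 ≤ r) (hM : (V.card : ℝ) ≤ M) :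
    P {ω | ∃ p ∈ V, r < |(B *ᵥ fun k => ξ k ω) p|} ≤
      ENNReal.ofReal (M * Real.sqrt 10 * Real.exp (-(9 / 20 * r ^ 2 / ρ))) := by
  have h := measure_exists_l2_res_gt_le hind hsub (𝒯 := V.image fun p => {p}) (k := 1) hρ
    (fun T hT => by obtain ⟨p, hp, rfl⟩ := Finset.mem_image.1 hT; exact hB p hp)
    (fun T hT => by obtain ⟨p, -, rfl⟩ := Finset.mem_image.1 hT; simp) hr
    (le_trans (by exact_mod_cast Finset.card_image_le) hM)
  rw [pow_one] at h
  refine (measure_mono fun ω hω => ?_).trans h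
  obtain ⟨p, hp, hr⟩ := hω
  refine ⟨{p}, Finset.mem_image_of_mem _ hp, ?_⟩
  have : l2 (res {p} (B *ᵥ fun k => ξ k ω)) = |(B *ᵥ fun k => ξ k ω) p| := by
    rw [← abs_of_nonneg (l2_nonneg _), ← sq_eq_sq_iff_abs_eq_abs, l2_res_sq]; simp
  rwa [this]

variable {X : Matrix (Fin n) (Idx d m) ℝ} {β : Idx d m → ℝ} {σ : ℝ}

/-- The matrix of the noise correlations. -/
def noiseMat (X : Matrix (Fin n) (Idx d m) ℝ) (σ : ℝ) : Matrix (Idx d m) (Fin n) ℝ :=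
  (σ / n) • Xᵀ

/-- The matrix of the correlations with the least squares residual. -/
def residNoiseMat (X : Matrix (Fin n) (Idx d m) ℝ) (S : Finset (Idx d m)) (σ : ℝ) :
    Matrix (Idx d m) (Fin n) ℝ :=
  (σ / n) • (Xᵀ * residMat (subMatrix X S))

/-- The matrix of the error of the oracle estimator. -/
def oracleMat (X : Matrix (Fin n) (Idx d m) ℝ) (S : Finset (Idx d m)) (σ : ℝ) :
    Matrix (Idx d m) (Fin n) ℝ :=
  Matrix.of fun p k => if h : p ∈ S then
    σ * (((subMatrix X S)ᵀ * subMatrix X S)⁻¹ * (subMatrix X S)ᵀ) ⟨p, h⟩ k else 0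

lemma noiseVec_eq_mulVec (ξ : Fin n → ℝ) : noiseVec X σ ξ = noiseMat X σ *ᵥ ξ := by
  rw [noiseVec, noiseMat, Matrix.mulVec_smul, Matrix.smul_mulVec, smul_smul]
  congr 1; ring

lemma residVec_eq_mulVec (S : Finset (Idx d m)) (ξ : Fin n → ℝ) :
    residVec X S σ ξ = residNoiseMat X S σ *ᵥ ξ := by
  rw [residVec, residNoiseMat, Matrix.mulVec_smul, Matrix.smul_mulVec, smul_smul,
    Matrix.mulVec_mulVec]
  congr 1; ring

lemma oracleVec_sub_eq_mulVec (h : IsUnit ((subMatrix X (supp β))ᵀ * subMatrix X (supp β)).det)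
    (ξ : Fin n → ℝ) :
    oracleVec X (response X β σ ξ) (supp β) - β = oracleMat X (supp β) σ *ᵥ ξ := by
  funext p
  by_cases hp : p ∈ supp β
  · have := oracleOLS_response (σ := σ) h ξ ⟨p, hp⟩
    rw [Matrix.mulVec_mulVec] at this
    rw [Pi.sub_apply, oracleVec, dif_pos hp, this]
    simp [oracleMat, Matrix.mulVec, dotProduct, hp, Finset.mul_sum, mul_assoc]
  · simp [oracleVec, oracleMat, Matrix.mulVec, dotProduct, hp, supp_off hp]

lemma VecRIP.proxyBound_noise {g k : ℕ} {δ : ℝ} (hX : VecRIP X g k δ) (hn : 0 < n)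
    {T : Finset (Idx d m)} (hg : (groups T).card ≤ g) (hk : T.card ≤ k) :
    ProxyBound (noiseMat X σ) T (σ ^ 2 * (1 + δ) / n) := by
  intro v hv
  have hsub : supp v ⊆ T := fun p hp => by by_contra h; exact mem_supp.1 hp (hv p h)
  have h1 := (hX v ((Finset.card_le_card (groups_mono hsub)).trans hg)
    ((Finset.card_le_card hsub).trans hk)).2
  have hn' : (0 : ℝ) < n := by exact_mod_cast hn
  simp only [noiseMat, Matrix.transpose_smul, Matrix.transpose_transpose, Matrix.smul_mulVec,
    Pi.smul_apply, smul_eq_mul, mul_pow, ← Finset.mul_sum]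
  calc (σ / n) ^ 2 * ∑ k, (X *ᵥ v) k ^ 2 ≤ (σ / n) ^ 2 * (n * (1 + δ) * ∑ p, v p ^ 2) :=
        mul_le_mul_of_nonneg_left h1 (sq_nonneg _)
    _ = _ := by field_simp

lemma VecRIP.proxyBound_resid {g k : ℕ} {δ : ℝ} (hX : VecRIP X g k δ) (hn : 0 < n)
    {S : Finset (Idx d m)} (h : IsUnit ((subMatrix X S)ᵀ * subMatrix X S).det)
    {T : Finset (Idx d m)} (hg : (groups T).card ≤ g) (hk : T.card ≤ k) :
    ProxyBound (residNoiseMat X S σ) T (σ ^ 2 * (1 + δ) / n) := by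
  intro v hv
  refine le_trans ?_ (hX.proxyBound_noise (σ := σ) hn hg hk v hv)
  simp only [residNoiseMat, noiseMat, Matrix.transpose_smul, Matrix.transpose_transpose,
    Matrix.transpose_mul, residMat_transpose, Matrix.smul_mulVec, Pi.smul_apply, smul_eq_mul,
    mul_pow, ← Finset.mul_sum, ← Matrix.mulVec_mulVec]
  exact mul_le_mul_of_nonneg_left (sum_sq_residMat_le h _) (sq_nonneg _)

lemma proxyBound_oracle {S : Finset (Idx d m)} {a : ℝ} (ha : 0 < a)
    (hA : ∀ u : S → ℝ, a * ∑ i, u i ^ 2 ≤ ∑ k, ((subMatrix X S *ᵥ u) k) ^ 2)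
    {T : Finset (Idx d m)} : ProxyBound (oracleMat X S σ) T (σ ^ 2 / a) := by
  intro v _
  have h1 := sum_sq_mulVec_gram_inv_le ha hA (fun q : S => v q)
  have e : ∀ k, ((oracleMat X S σ)ᵀ *ᵥ v) k = σ * (subMatrix X S *ᵥ
      (((subMatrix X S)ᵀ * subMatrix X S)⁻¹ *ᵥ fun q : S => v q)) k := by
    intro k
    have e1 : subMatrix X S * ((subMatrix X S)ᵀ * subMatrix X S)⁻¹ =
        (((subMatrix X S)ᵀ * subMatrix X S)⁻¹ * (subMatrix X S)ᵀ)ᵀ := by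
      simp [Matrix.transpose_mul, Matrix.transpose_nonsing_inv]
    rw [Matrix.mulVec_mulVec, e1]
    simp only [oracleMat, Matrix.mulVec, dotProduct, Matrix.transpose_apply, Matrix.of_apply]
    rw [← Finset.sum_subset (Finset.subset_univ S) (fun p _ hp => by simp [hp]),
      ← Finset.sum_coe_sort, Finset.mul_sum]
    exact Finset.sum_congr rfl fun q _ => by simp [mul_assoc]
  simp only [e, mul_pow, ← Finset.mul_sum]
  have h2 : ∑ q : S, v q ^ 2 ≤ ∑ p, v p ^ 2 := by
    rw [Finset.sum_coe_sort S fun p => v p ^ 2]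
    exact Finset.sum_le_sum_of_subset_of_nonneg (Finset.subset_univ _) fun _ _ _ => sq_nonneg _
  calc _ ≤ σ ^ 2 * (1 / a * ∑ p, v p ^ 2) :=
        mul_le_mul_of_nonneg_left (h1.trans (mul_le_mul_of_nonneg_left h2 (by positivity)))
          (sq_nonneg _)
    _ = _ := by ring

end tails

/-! ### Probabilities of the noise events -/

section events

variable {n d m s s₀ : ℕ}

lemma exp_one_mul_div_pos {a b : ℕ} (ha : 0 < a) (hb : 0 < b) : 0 < Real.exp 1 * a / b := by
  have : (0 : ℝ) < a := by exact_mod_cast ha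
  have : (0 : ℝ) < b := by exact_mod_cast hb
  positivity

lemma one_le_log_exp_one_mul_div {a b : ℕ} (hb : 0 < b) (h : b ≤ a) :
    1 ≤ Real.log (Real.exp 1 * a / b) := by
  have hb' : (0 : ℝ) < b := by exact_mod_cast hb
  have h' : (b : ℝ) ≤ a := by exact_mod_cast h
  rw [Real.le_log_iff_exp_le (exp_one_mul_div_pos (hb.trans_le h) hb), le_div_iff₀ hb']
  exact mul_le_mul_of_nonneg_left h' (Real.exp_pos _).le

lemma log_le_Delta (hs : 0 < s) (hsm : s ≤ m) :
    Real.log (Real.exp 1 * d / s₀) ≤ Delta d m s s₀ := by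
  have h1 := one_le_log_exp_one_mul_div hs hsm
  have : 0 ≤ 1 / (s₀ : ℝ) * Real.log (Real.exp 1 * m / s) :=
    mul_nonneg (by positivity) (by linarith)
  rw [Delta]; linarith

lemma one_le_Delta (hs : 0 < s) (hsm : s ≤ m) (hs₀ : 0 < s₀) (hsd : s₀ ≤ d) :
    1 ≤ Delta d m s s₀ :=
  (one_le_log_exp_one_mul_div hs₀ hsd).trans (log_le_Delta hs hsm)

lemma mul_Delta (hs₀ : 0 < s₀) : (s₀ : ℝ) * Delta d m s s₀ =
    Real.log (Real.exp 1 * m / s) + s₀ * Real.log (Real.exp 1 * d / s₀) := by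
  have : (s₀ : ℝ) ≠ 0 := by exact_mod_cast hs₀.ne'
  rw [Delta]; field_simp

/-- The quantity `s₀ Δ` diverges with `d`. -/
lemma log_le_mul_Delta (hs : 0 < s) (hsm : s ≤ m) (hs₀ : 0 < s₀) (hsd : s₀ ≤ d) :
    Real.log d ≤ s₀ * Delta d m s s₀ := by
  have hs₀' : (1 : ℝ) ≤ s₀ := by exact_mod_cast hs₀
  have hd' : (1 : ℝ) ≤ d := by exact_mod_cast hs₀.trans_le hsd
  have h1 := one_le_log_exp_one_mul_div hs₀ hsd
  have h2 : Real.log (Real.exp 1 * d / s₀) = 1 + Real.log d - Real.log s₀ := by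
    rw [Real.log_div (by positivity) (by positivity), Real.log_mul (by positivity) (by positivity),
      Real.log_exp]
  have h3 : Real.log s₀ ≤ s₀ - 1 := Real.log_le_sub_one_of_pos (by linarith)
  have h4 := one_le_log_exp_one_mul_div hs hsm
  rw [mul_Delta hs₀]
  -- `s₀ L ≥ L + (s₀ - 1)` for `L ≥ 1`
  nlinarith [mul_le_mul_of_nonneg_left h1 (by linarith : (0 : ℝ) ≤ s₀ - 1)]

lemma sqrt_ten_le : Real.sqrt 10 ≤ Real.exp (6 / 5) := by
  rw [Real.sqrt_le_left (Real.exp_pos _).le, ← Real.exp_nat_mul]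
  have h1 : Real.exp ((2 : ℕ) * (6 / 5)) = Real.exp 1 * Real.exp 1 * Real.exp (2 / 5) := by
    rw [← Real.exp_add, ← Real.exp_add]; norm_num
  have h2 := Real.exp_one_gt_d9
  have h3 := Real.quadratic_le_exp_of_nonneg (x := 2 / 5) (by norm_num)
  rw [h1]
  have h4 : (7.3 : ℝ) ≤ Real.exp 1 * Real.exp 1 := by nlinarith
  nlinarith

variable {Ω : Type*} [MeasurableSpace Ω] {P : Measure Ω} [IsProbabilityMeasure P]
  {ξ : Fin n → Ω → ℝ} {B : Matrix (Idx d m) (Fin n) ℝ} {ρ r y : ℝ}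

lemma card_filter_groups (G : Finset (Fin m)) :
    (Finset.univ.filter fun p : Idx d m => p.2 ∈ G).card = d * G.card := by
  have : (Finset.univ.filter fun p : Idx d m => p.2 ∈ G) = Finset.univ ×ˢ G := by
    ext p; simp
  rw [this, Finset.card_product, Finset.card_univ, Fintype.card_fin]

/-- The union bound over few coordinates, in logarithmic form. -/
lemma measure_exists_abs_gt_le_exp (hind : iIndepFun ξ P)
    (hsub : ∀ k, HasSubgaussianMGF (ξ k) 1 P) {V : Finset (Idx d m)} {l η : ℝ} (hρ : 0 < ρ)
    (hB : ∀ p ∈ V, ProxyBound B {p} ρ) (hr : 0 ≤ r) (hV : (V.card : ℝ) ≤ Real.exp l)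
    (hrl : (1 + η) * l * ρ ≤ 9 / 20 * r ^ 2) :
    P {ω | ∃ p ∈ V, r < |(B *ᵥ fun k => ξ k ω) p|} ≤
      ENNReal.ofReal (Real.sqrt 10 * Real.exp (-(η * l))) := by
  refine (measure_exists_abs_gt_le hind hsub hρ hB hr hV).trans (ENNReal.ofReal_le_ofReal ?_)
  have h1 : (1 + η) * l ≤ 9 / 20 * r ^ 2 / ρ := by rwa [le_div_iff₀ hρ]
  calc Real.exp l * Real.sqrt 10 * Real.exp (-(9 / 20 * r ^ 2 / ρ))
      = Real.sqrt 10 * Real.exp (l - 9 / 20 * r ^ 2 / ρ) := by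
        rw [sub_eq_add_neg, Real.exp_add]; ring
    _ ≤ _ := by
        refine mul_le_mul_of_nonneg_left (Real.exp_le_exp.2 ?_) (Real.sqrt_nonneg _)
        linarith

/-- Noise on the true support, with the exponential parameter `1 / 10`: the bound
`exp (3 R / 25 - 13 R Δ / 100)` uses `(5 / 4) ^ (1 / 2) ≤ exp (3 / 25)`. -/
lemma measure_support_gt_le (hind : iIndepFun ξ P) (hsub : ∀ k, HasSubgaussianMGF (ξ k) 1 P)
    {S : Finset (Idx d m)} (hρ : 0 < ρ) (hB : ProxyBound B S ρ) (hr : 0 ≤ r)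
    {R Δ : ℝ} (hS : (S.card : ℝ) ≤ R) (hΔ : 1 ≤ Δ) (hry : 13 / 10 * R * Δ * ρ ≤ r ^ 2) :
    P {ω | r < l2 (res S (B *ᵥ fun k => ξ k ω))} ≤
      ENNReal.ofReal (Real.exp (-(1 / 100 * (R * Δ)))) := by
  refine (measure_l2_res_gt_le hind hsub hρ hB (θ := 1 / 10) (by norm_num) (by norm_num)
    hr).trans (ENNReal.ofReal_le_ofReal ?_)
  have hR : 0 ≤ R := (Nat.cast_nonneg _).trans hS
  have h1 : 13 / 10 * R * Δ ≤ r ^ 2 / ρ := by rwa [le_div_iff₀ hρ]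
  have h2 : Real.sqrt (1 / (1 - 2 * (1 / 10))) ≤ Real.exp (3 / 25) := by
    rw [Real.sqrt_le_left (Real.exp_pos _).le, ← Real.exp_nat_mul]
    have := Real.quadratic_le_exp_of_nonneg (x := ((2 : ℕ) : ℝ) * (3 / 25)) (by norm_num)
    refine le_trans ?_ this
    norm_num
  have h3 : Real.sqrt (1 / (1 - 2 * (1 / 10))) ^ S.card ≤ Real.exp (3 / 25 * R) := by
    refine (pow_le_pow_left₀ (Real.sqrt_nonneg _) h2 _).trans ?_
    rw [← Real.exp_nat_mul]
    exact Real.exp_le_exp.2 (by nlinarith)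
  calc _ ≤ Real.exp (-(1 / 10 * r ^ 2 / ρ)) * Real.exp (3 / 25 * R) :=
        mul_le_mul_of_nonneg_left h3 (Real.exp_pos _).le
    _ = Real.exp (3 / 25 * R - 1 / 10 * (r ^ 2 / ρ)) := by
        rw [← Real.exp_add]; congr 1; ring
    _ ≤ _ := by
        refine Real.exp_le_exp.2 ?_
        nlinarith [mul_le_mul_of_nonneg_left hΔ hR]

/-- Noise on the test sets in the true groups. The constant `C` bounds `s s₀ / k`. -/
lemma measure_inner_gt_le (hind : iIndepFun ξ P) (hsub : ∀ k, HasSubgaussianMGF (ξ k) 1 P)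
    {S : Finset (Idx d m)} {G : Finset (Fin m)} {N : ℕ} {C η : ℝ} (hρ : 0 < ρ)
    (hB : ∀ T, IsInner S G N T → ProxyBound B T ρ) (hr : 0 ≤ r) (hG : G.card ≤ s)
    (hs : 0 < s) (hsm : s ≤ m) (hs₀ : 0 < s₀) (hsd : s₀ ≤ d) (hC : 1 ≤ C)
    (hCk : (s : ℝ) * s₀ ≤ C * ((N : ℝ) + 1))
    (hCy : C * Real.sqrt 10 ≤ Real.exp (9 / 20 * y - 1 - η))
    (hry : y * ((N : ℝ) + 1) * Delta d m s s₀ * ρ ≤ r ^ 2) :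
    P {ω | ∃ T, IsInner S G N T ∧ r < l2 (res T (B *ᵥ fun k => ξ k ω))} ≤
      ENNReal.ofReal (Real.exp (-(η * (((N : ℝ) + 1) * Delta d m s s₀)))) := by
  classical
  set Δ := Delta d m s s₀ with hΔdef
  have hΔ : 1 ≤ Δ := one_le_Delta hs hsm hs₀ hsd
  set V : Finset (Idx d m) := Finset.univ.filter fun p => p ∉ S ∧ p.2 ∈ G with hV
  set N' := max (N + 1) (d * s) with hN'
  have hVc : V.card ≤ N' := by
    refine le_trans ?_ (le_max_right _ _)
    calc V.card ≤ (Finset.univ.filter fun p : Idx d m => p.2 ∈ G).card :=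
          Finset.card_le_card fun p hp => by simp [hV] at hp ⊢; exact hp.2
      _ = d * G.card := card_filter_groups G
      _ ≤ d * s := Nat.mul_le_mul_left _ hG
  have hcount := card_powerset_card_le V (k := N + 1) (N := N') (Nat.succ_pos _)
    (le_max_left _ _) hVc
  have hmem : ∀ T, T ∈ (V.powerset.filter fun T => T.card ≤ N + 1) ↔ IsInner S G N T := by
    intro T
    rw [Finset.mem_filter, Finset.mem_powerset, IsInner, and_comm]
    refine and_congr_right fun _ => ⟨fun h p hp => ?_, fun h p hp => ?_⟩
    · simpa [hV] using h hp
    · simpa [hV] using h p hp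
  have hk0 : (0 : ℝ) < (N : ℝ) + 1 := by positivity
  have hs' : (0 : ℝ) < s := by exact_mod_cast hs
  have hs₀' : (0 : ℝ) < s₀ := by exact_mod_cast hs₀
  have hbase : Real.exp 1 * (N' : ℝ) / ((N + 1 : ℕ) : ℝ) ≤ C * Real.exp Δ := by
    push_cast
    rw [div_le_iff₀ hk0, hN', Nat.cast_max, mul_max_of_nonneg _ _ (Real.exp_pos _).le]
    refine max_le ?_ ?_
    · push_cast
      refine mul_le_mul_of_nonneg_right ?_ hk0.le
      calc Real.exp 1 ≤ 1 * Real.exp Δ := by rw [one_mul]; exact Real.exp_le_exp.2 hΔ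
        _ ≤ _ := mul_le_mul_of_nonneg_right hC (Real.exp_pos _).le
    · have h1 : Real.exp 1 * d / s₀ ≤ Real.exp Δ := by
        rw [← Real.log_le_iff_le_exp (exp_one_mul_div_pos (hs₀.trans_le hsd) hs₀)]
        exact log_le_Delta hs hsm
      rw [div_le_iff₀ hs₀'] at h1
      push_cast
      calc Real.exp 1 * ((d : ℝ) * s) = (Real.exp 1 * d) * s := by ring
        _ ≤ (Real.exp Δ * s₀) * s := mul_le_mul_of_nonneg_right h1 hs'.le
        _ = Real.exp Δ * (s * s₀) := by ring
        _ ≤ Real.exp Δ * (C * ((N : ℝ) + 1)) := mul_le_mul_of_nonneg_left hCk (Real.exp_pos _).le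
        _ = _ := by ring
  have h := measure_exists_l2_res_gt_le hind hsub
    (𝒯 := V.powerset.filter fun T => T.card ≤ N + 1) (k := N + 1) hρ
    (fun T hT => hB T ((hmem T).1 hT)) (fun T hT => (Finset.mem_filter.1 hT).2) hr hcount
  simp only [hmem] at h
  refine h.trans (ENNReal.ofReal_le_ofReal ?_)
  have hexp : 0 ≤ 9 / 20 * y - 1 - η := by
    rw [← Real.one_le_exp_iff]
    refine le_trans ?_ hCy
    have : 1 ≤ Real.sqrt 10 := Real.one_le_sqrt.2 (by norm_num)
    nlinarith
  have h1 : y * (((N : ℝ) + 1) * Δ) ≤ r ^ 2 / ρ := by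
    rw [le_div_iff₀ hρ]; linarith
  have h2 : C * Real.exp Δ * Real.sqrt 10 ≤ Real.exp ((9 / 20 * y - η) * Δ) := by
    calc C * Real.exp Δ * Real.sqrt 10 = C * Real.sqrt 10 * Real.exp Δ := by ring
      _ ≤ Real.exp ((9 / 20 * y - 1 - η) * Δ) * Real.exp Δ := by
        refine mul_le_mul_of_nonneg_right (hCy.trans (Real.exp_le_exp.2 ?_)) (Real.exp_pos _).le
        nlinarith
      _ = _ := by rw [← Real.exp_add]; congr 1; ring
  calc _ ≤ (C * Real.exp Δ) ^ (N + 1) * Real.sqrt 10 ^ (N + 1) *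
        Real.exp (-(9 / 20 * r ^ 2 / ρ)) := by gcongr
    _ = (C * Real.exp Δ * Real.sqrt 10) ^ (N + 1) * Real.exp (-(9 / 20 * r ^ 2 / ρ)) := by
        rw [← mul_pow]
    _ ≤ Real.exp ((9 / 20 * y - η) * Δ) ^ (N + 1) * Real.exp (-(9 / 20 * r ^ 2 / ρ)) := by gcongr
    _ = Real.exp ((9 / 20 * y - η) * Δ * ((N : ℝ) + 1) - 9 / 20 * (r ^ 2 / ρ)) := by
        rw [← Real.exp_nat_mul, ← Real.exp_add]; congr 1; push_cast; ring
    _ ≤ _ := Real.exp_le_exp.2 (by nlinarith)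

/-- The number of test sets with at most `a` groups and `a s₀` entries. The constant `C` bounds
`s / a`. -/
lemma card_outer_le {a : ℕ} {C : ℝ} (ha : 0 < a) (hs : 0 < s) (hsm : s ≤ m) (hs₀ : 0 < s₀)
    (hsd : s₀ ≤ d) (hC : 1 ≤ C) (hCa : (s : ℝ) ≤ C * a) {𝒯 : Finset (Finset (Idx d m))}
    (h𝒯 : ∀ T ∈ 𝒯, (groups T).card ≤ a ∧ T.card ≤ a * s₀) :
    (𝒯.card : ℝ) ≤ Real.exp (a * (Real.log C + s₀ * Delta d m s s₀)) := by
  classical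
  set 𝒥 := (Finset.univ : Finset (Fin m)).powerset.filter fun J => J.card ≤ a with h𝒥
  have hsub : 𝒯 ⊆ 𝒥.biUnion fun J =>
      (Finset.univ.filter fun p : Idx d m => p.2 ∈ J).powerset.filter fun T => T.card ≤ a * s₀ := by
    intro T hT
    obtain ⟨h1, h2⟩ := h𝒯 T hT
    rw [Finset.mem_biUnion]
    refine ⟨groups T, ?_, ?_⟩
    · simp [h𝒥, h1]
    · rw [Finset.mem_filter, Finset.mem_powerset]
      refine ⟨fun p hp => ?_, h2⟩
      rw [Finset.mem_filter]
      exact ⟨Finset.mem_univ _, Finset.mem_image_of_mem _ hp⟩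
  have ha' : (0 : ℝ) < a := by exact_mod_cast ha
  have hs' : (0 : ℝ) < s := by exact_mod_cast hs
  have hs₀' : (0 : ℝ) < s₀ := by exact_mod_cast hs₀
  have hd' : (0 : ℝ) < d := by exact_mod_cast hs₀.trans_le hsd
  have hm' : (0 : ℝ) < m := by exact_mod_cast hs.trans_le hsm
  have hD := exp_one_mul_div_pos (hs₀.trans_le hsd) hs₀
  have hM := exp_one_mul_div_pos (hs.trans_le hsm) hs
  have hJ : (𝒥.card : ℝ) ≤ (C * (Real.exp 1 * m / s)) ^ a := by
    have h := card_powerset_card_le (Finset.univ : Finset (Fin m)) (k := a) (N := max a m) ha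
      (le_max_left _ _) (by simp)
    refine h.trans (pow_le_pow_left₀ (by positivity) ?_ _)
    rw [div_le_iff₀ ha', Nat.cast_max, mul_max_of_nonneg _ _ (Real.exp_pos _).le]
    have hsm' : (s : ℝ) ≤ m := by exact_mod_cast hsm
    refine max_le ?_ ?_
    · refine mul_le_mul_of_nonneg_right ?_ ha'.le
      calc Real.exp 1 = 1 * (Real.exp 1 * s / s) := by field_simp
        _ ≤ C * (Real.exp 1 * m / s) := by gcongr
    · rw [mul_div_assoc', div_mul_eq_mul_div, le_div_iff₀ hs']
      calc Real.exp 1 * m * s ≤ Real.exp 1 * m * (C * a) := by gcongr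
        _ = _ := by ring
  have hT : ∀ J ∈ 𝒥, (((Finset.univ.filter fun p : Idx d m => p.2 ∈ J).powerset.filter
      fun T => T.card ≤ a * s₀).card : ℝ) ≤ (Real.exp 1 * d / s₀) ^ (a * s₀) := by
    intro J hJ
    have hJc : J.card ≤ a := (Finset.mem_filter.1 hJ).2
    have h := card_powerset_card_le (Finset.univ.filter fun p : Idx d m => p.2 ∈ J)
      (k := a * s₀) (N := a * d) (Nat.mul_pos ha hs₀) (Nat.mul_le_mul_left _ hsd)
      (by rw [card_filter_groups, mul_comm]; exact Nat.mul_le_mul_right _ hJc)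
    refine h.trans_eq ?_
    congr 1; push_cast; field_simp
  have hΔ := mul_Delta (d := d) (m := m) (s := s) hs₀
  calc (𝒯.card : ℝ) ≤ ((𝒥.biUnion fun J => (Finset.univ.filter fun p : Idx d m =>
          p.2 ∈ J).powerset.filter fun T => T.card ≤ a * s₀).card : ℝ) := by
        exact_mod_cast Finset.card_le_card hsub
    _ ≤ ∑ J ∈ 𝒥, (((Finset.univ.filter fun p : Idx d m => p.2 ∈ J).powerset.filter
          fun T => T.card ≤ a * s₀).card : ℝ) := by exact_mod_cast Finset.card_biUnion_le
    _ ≤ 𝒥.card * (Real.exp 1 * d / s₀) ^ (a * s₀) := by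
        rw [← nsmul_eq_mul]; exact Finset.sum_le_card_nsmul _ _ _ hT
    _ ≤ (C * (Real.exp 1 * m / s)) ^ a * (Real.exp 1 * d / s₀) ^ (a * s₀) := by gcongr
    _ = Real.exp (a * (Real.log C + s₀ * Delta d m s s₀)) := by
        rw [hΔ, pow_mul', ← mul_pow, Real.exp_nat_mul, ← add_assoc, Real.exp_add, Real.exp_add,
          Real.exp_log (by linarith), Real.exp_log hM, Real.exp_nat_mul, Real.exp_log hD]

/-- Noise on the test sets outside the true groups: of the exponent `9 / 20 * 5` the number of test
sets takes `1`, the factor `√10 ≤ exp (6 / 5)` per entry the rest but `1 / 20`. -/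
lemma measure_outer_gt_le (hind : iIndepFun ξ P) (hsub : ∀ k, HasSubgaussianMGF (ξ k) 1 P)
    {G : Finset (Fin m)} {a : ℕ} {C : ℝ} (hρ : 0 < ρ)
    (hB : ∀ T, IsOuter G a (a * s₀) T → ProxyBound B T ρ) (hr : 0 ≤ r) (ha : 0 < a)
    (hs : 0 < s) (hsm : s ≤ m) (hs₀ : 0 < s₀) (hsd : s₀ ≤ d) (hC : 1 ≤ C)
    (hCa : (s : ℝ) ≤ C * a) (hry : 5 * ((a * s₀ : ℕ) : ℝ) * Delta d m s s₀ * ρ ≤ r ^ 2) :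
    P {ω | ∃ T, IsOuter G a (a * s₀) T ∧ r < l2 (res T (B *ᵥ fun k => ξ k ω))} ≤
      ENNReal.ofReal (Real.exp (a * (Real.log C - 1 / 20 * (s₀ * Delta d m s s₀)))) := by
  classical
  set Δ := Delta d m s s₀ with hΔdef
  have hΔ : 1 ≤ Δ := one_le_Delta hs hsm hs₀ hsd
  have h := measure_exists_l2_res_gt_le hind hsub
    (𝒯 := Finset.univ.filter fun T => IsOuter G a (a * s₀) T) (k := a * s₀) hρ
    (fun T hT => hB T (Finset.mem_filter.1 hT).2)
    (fun T hT => (Finset.mem_filter.1 hT).2.2.1) hr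
    (card_outer_le ha hs hsm hs₀ hsd hC hCa fun T hT =>
      ⟨(Finset.mem_filter.1 hT).2.1, (Finset.mem_filter.1 hT).2.2.1⟩)
  simp only [Finset.mem_filter, Finset.mem_univ, true_and] at h
  refine h.trans (ENNReal.ofReal_le_ofReal ?_)
  have h1 : 5 * ((a : ℝ) * s₀ * Δ) ≤ r ^ 2 / ρ := by
    rw [le_div_iff₀ hρ]; push_cast at hry; linarith
  have hq : (0 : ℝ) ≤ (a : ℝ) * s₀ := by positivity
  calc _ ≤ Real.exp (a * (Real.log C + s₀ * Δ)) * Real.exp (6 / 5) ^ (a * s₀) *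
        Real.exp (-(9 / 20 * r ^ 2 / ρ)) := by
        gcongr; exact sqrt_ten_le
    _ = Real.exp (a * (Real.log C + s₀ * Δ) + (a : ℝ) * s₀ * (6 / 5) - 9 / 20 * (r ^ 2 / ρ)) := by
        rw [← Real.exp_nat_mul, ← Real.exp_add, ← Real.exp_add]; congr 1; push_cast; ring
    _ ≤ _ := Real.exp_le_exp.2 (by nlinarith [mul_le_mul_of_nonneg_left hΔ hq])

/-- Noise on at most `s₀` coordinates of a single group. -/
lemma measure_group_gt_le (hind : iIndepFun ξ P) (hsub : ∀ k, HasSubgaussianMGF (ξ k) 1 P)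
    {l : ℝ} (hρ : 0 < ρ)
    (hB : ∀ T : Finset (Idx d m), (groups T).card ≤ 1 → T.card ≤ s₀ → ProxyBound B T ρ)
    (hr : 0 ≤ r) (hm : 0 < m) (hs₀ : 0 < s₀) (hsd : s₀ ≤ d)
    (hl1 : 1 ≤ l) (hl : Real.log (Real.exp 1 * d / s₀) ≤ l)
    (hrl : 9 / 4 * (Real.log (Real.exp 1 * m) + s₀ * l) * ρ ≤ 9 / 20 * r ^ 2) :
    P {ω | ∃ (j : Fin m) (T : Finset (Fin d)), T.card ≤ s₀ ∧
        r ^ 2 < ∑ i ∈ T, (B *ᵥ fun k => ξ k ω) (i, j) ^ 2} ≤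
      ENNReal.ofReal (Real.exp (-(5 / 4 * Real.log m))) := by
  classical
  set 𝒟 := (Finset.univ : Finset (Fin d)).powerset.filter fun T => T.card ≤ s₀ with h𝒟
  set f : Fin m × Finset (Fin d) → Finset (Idx d m) := fun x => x.2 ×ˢ {x.1} with hf
  have hfc : ∀ x, (f x).card = x.2.card := fun x => by simp [hf]
  have hfg : ∀ x, (groups (f x)).card ≤ 1 := fun x => by
    refine (Finset.card_le_card (t := {x.1}) fun j hj => ?_).trans (by simp)
    obtain ⟨p, hp, rfl⟩ := Finset.mem_image.1 hj
    exact (Finset.mem_product.1 hp).2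
  set 𝒯 := ((Finset.univ : Finset (Fin m)) ×ˢ 𝒟).image f with h𝒯
  have hmem : ∀ T ∈ 𝒯, (groups T).card ≤ 1 ∧ T.card ≤ s₀ := by
    intro T hT
    obtain ⟨x, hx, rfl⟩ := Finset.mem_image.1 hT
    refine ⟨hfg x, ?_⟩
    rw [hfc]
    exact (Finset.mem_filter.1 (Finset.mem_product.1 hx).2).2
  have hm' : (0 : ℝ) < m := by exact_mod_cast hm
  have hs₀' : (0 : ℝ) < s₀ := by exact_mod_cast hs₀
  have hD := exp_one_mul_div_pos (hs₀.trans_le hsd) hs₀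
  have hcount : (𝒯.card : ℝ) ≤ Real.exp (Real.log m + s₀ * l) := by
    have h1 := card_powerset_card_le (Finset.univ : Finset (Fin d)) (k := s₀) (N := d) hs₀ hsd
      (by simp)
    calc (𝒯.card : ℝ) ≤ (m * 𝒟.card : ℕ) := by
          refine Nat.cast_le.2 (Finset.card_image_le.trans ?_)
          rw [Finset.card_product, Finset.card_univ, Fintype.card_fin]
      _ = (m : ℝ) * 𝒟.card := by push_cast; rfl
      _ ≤ m * (Real.exp 1 * d / s₀) ^ s₀ := by gcongr
      _ = Real.exp (Real.log m + s₀ * Real.log (Real.exp 1 * d / s₀)) := by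
          rw [Real.exp_add, Real.exp_log hm', Real.exp_nat_mul, Real.exp_log hD]
      _ ≤ _ := Real.exp_le_exp.2 (by nlinarith)
  have h := measure_exists_l2_res_gt_le hind hsub (𝒯 := 𝒯) (k := s₀) hρ
    (fun T hT => hB T (hmem T hT).1 (hmem T hT).2) (fun T hT => (hmem T hT).2) hr hcount
  refine (measure_mono ?_).trans (h.trans (ENNReal.ofReal_le_ofReal ?_))
  · rintro ω ⟨j, T, hT, hω⟩
    refine ⟨f (j, T), Finset.mem_image_of_mem _ (Finset.mem_product.2 ⟨Finset.mem_univ _, ?_⟩), ?_⟩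
    · simp [h𝒟, hT]
    · refine lt_of_pow_lt_pow_left₀ 2 (l2_nonneg _) ?_
      rw [l2_res_sq]
      simpa [hf, Finset.sum_product] using hω
  · have hlm : Real.log (Real.exp 1 * m) = 1 + Real.log m := by
      rw [Real.log_mul (Real.exp_pos _).ne' hm'.ne', Real.log_exp]
    have h1 : 9 / 4 * (1 + Real.log m + s₀ * l) ≤ 9 / 20 * r ^ 2 / ρ := by
      rw [le_div_iff₀ hρ, ← hlm]; exact hrl
    calc _ ≤ Real.exp (Real.log m + s₀ * l) * Real.exp (6 / 5) ^ s₀ *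
          Real.exp (-(9 / 20 * r ^ 2 / ρ)) := by gcongr; exact sqrt_ten_le
      _ = Real.exp (Real.log m + s₀ * l + s₀ * (6 / 5) - 9 / 20 * r ^ 2 / ρ) := by
          rw [← Real.exp_nat_mul, ← Real.exp_add, ← Real.exp_add]; congr 1
      _ ≤ _ := Real.exp_le_exp.2 (by nlinarith [mul_le_mul_of_nonneg_left hl1 hs₀'.le])

end events

/-! ### Choice of the constants -/

section constants

/-- `A s` rounded up. -/
def numExtra (κ δ : ℝ) (s : ℕ) : ℕ := ⌈Acst κ δ * s⌉₊

/-- The variance proxy `(1 + δ) σ² / n` in units of `λ_(∞)² / (40 Δ)`. -/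
def proxyRatio (κ δ : ℝ) : ℝ := (1 + δ) / (1 + Real.sqrt 3 * (δ / (κ - δ))) ^ 2

/-- Constants that make the step lemma applicable at the given sparsity: `N`, `a`, `a s₀` cap the
extra entries and groups, and the noise levels `z₁`, `z₂`, `zS` are large enough for the tail
bounds, with exponents governed by `y`. -/
structure Tuned (κ δ δW C y : ℝ) (s s₀ N a : ℕ) (δT z₁ z₂ zS W : ℝ) : Prop where
  a_pos : 0 < a
  groups_le : a ≤ s + 2 * numExtra κ δ s
  outer_le : a * s₀ ≤ s * s₀ + 4 * (numExtra κ δ s * s₀)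
  inner_le : N + 1 ≤ s * s₀ + 4 * (numExtra κ δ s * s₀)
  gapBound : ∀ {n d m : ℕ} {X : Matrix (Fin n) (Idx d m) ℝ} {S : Finset (Idx d m)},
    VecRIP X (s + 2 * numExtra κ δ s) (s * s₀ + 4 * (numExtra κ δ s * s₀)) δ → 0 < n →
      S.card ≤ s * s₀ → (groups S).card ≤ s → GapBound X S (groups S) N a (a * s₀) δT δW
  le_inner : (s : ℝ) * s₀ ≤ C * ((N : ℝ) + 1)
  le_groups : (s : ℝ) ≤ 41 * a
  z₁_nonneg : 0 ≤ z₁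
  z₂_nonneg : 0 ≤ z₂
  zS_nonneg : 0 ≤ zS
  z₁_sq : y * proxyRatio κ δ / 40 * ((N : ℝ) + 1) ≤ z₁ ^ 2
  z₂_sq : 5 * proxyRatio κ δ / 40 * ((a * s₀ : ℕ) : ℝ) ≤ z₂ ^ 2
  zS_sq : 13 / 10 * proxyRatio κ δ / 40 * ((s : ℝ) * s₀) ≤ zS ^ 2
  W_nonneg : 0 ≤ W
  δT_ge : δ ≤ δT
  inner : δT * W + z₁ < Real.sqrt (N + 1)
  outer : δT * W + z₂ < Real.sqrt ((a * s₀ : ℕ) : ℝ)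
  whole : δW * W + Real.sqrt ((Real.sqrt 2 * Real.sqrt ((s : ℝ) * s₀) + zS) ^ 2 + z₁ ^ 2 + z₂ ^ 2)
    ≤ κ * W
  init : Real.sqrt 2 * κ * Real.sqrt ((s : ℝ) * s₀) ≤ (1 - δ) * W

lemma sqrt_two_le : Real.sqrt 2 ≤ 1.41422 := by
  rw [Real.sqrt_le_left (by norm_num)]; norm_num

lemma le_sqrt_three : 1.732 ≤ Real.sqrt 3 := Real.le_sqrt_of_sq_le (by norm_num)

/-- The size condition of the step lemma, reduced to an inequality `hnum` between numbers. Here `w`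
is the ratio `δT / (κ - δW)`, and `R`, `√k`, `√q` are the scales of the true support and of the two
kinds of test sets. -/
lemma mul_sqrt_add_lt {w R k q η₁ η₂ ηS e eS α t₁ t₂ : ℝ} (hk : 0 < k) (hq : 0 ≤ q)
    (hα : w ^ 2 * R ^ 2 ≤ α * k) (h1 : w ^ 2 * η₁ ^ 2 ≤ t₁)
    (h2 : w ^ 2 * (η₂ ^ 2 * q) ≤ t₂ * k)
    (hηS0 : 0 ≤ ηS) (hηS : ηS ≤ eS) (he : η₁ ≤ e) (he1 : e ≤ 1)
    (hnum : α * (1.41422 + eS) ^ 2 + t₁ + t₂ < (1 - e) ^ 2) :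
    w * Real.sqrt ((Real.sqrt 2 * R + ηS * R) ^ 2 + (η₁ * Real.sqrt k) ^ 2 +
      (η₂ * Real.sqrt q) ^ 2) + η₁ * Real.sqrt k < Real.sqrt k := by
  have h2' := sqrt_two_le
  have hs2 := Real.sqrt_nonneg 2
  have e0 : (Real.sqrt 2 * R + ηS * R) ^ 2 + (η₁ * Real.sqrt k) ^ 2 + (η₂ * Real.sqrt q) ^ 2 =
      (Real.sqrt 2 + ηS) ^ 2 * R ^ 2 + η₁ ^ 2 * k + η₂ ^ 2 * q := by
    rw [mul_pow, mul_pow, Real.sq_sqrt hk.le, Real.sq_sqrt hq]; ring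
  have h3 : (Real.sqrt 2 + ηS) ^ 2 ≤ (1.41422 + eS) ^ 2 :=
    pow_le_pow_left₀ (by positivity) (by linarith) 2
  have h4 : w ^ 2 * ((Real.sqrt 2 + ηS) ^ 2 * R ^ 2 + η₁ ^ 2 * k + η₂ ^ 2 * q) <
      (1 - e) ^ 2 * k := by
    calc _ = (Real.sqrt 2 + ηS) ^ 2 * (w ^ 2 * R ^ 2) + (w ^ 2 * η₁ ^ 2) * k +
          w ^ 2 * (η₂ ^ 2 * q) := by ring
      _ ≤ (1.41422 + eS) ^ 2 * (α * k) + t₁ * k + t₂ * k := by gcongr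
      _ = (α * (1.41422 + eS) ^ 2 + t₁ + t₂) * k := by ring
      _ < _ := mul_lt_mul_of_pos_right hnum hk
  rw [e0]
  have h5 : w * Real.sqrt ((Real.sqrt 2 + ηS) ^ 2 * R ^ 2 + η₁ ^ 2 * k + η₂ ^ 2 * q) <
      (1 - e) * Real.sqrt k := by
    refine lt_of_pow_lt_pow_left₀ 2 (mul_nonneg (by linarith) (Real.sqrt_nonneg _)) ?_
    rw [mul_pow, mul_pow, Real.sq_sqrt hk.le, Real.sq_sqrt (by positivity)]
    exact h4
  nlinarith [Real.sqrt_pos.2 hk]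

/-- Upper bounds for `proxyRatio` follow from inequalities in the single variable `δ / (κ - δ)`, as
`κ < 1` bounds `1 + δ` by a function of it. -/
lemma proxyRatio_le {κ δ c : ℝ} (hδ : 0 < δ) (hκ : δ < κ) (hκ1 : κ < 1)
    (hc : 1 + 2 * (δ / (κ - δ)) ≤
      c * ((1 + δ / (κ - δ)) * (1 + 1.732 * (δ / (κ - δ))) ^ 2)) (hc0 : 0 ≤ c) :
    proxyRatio κ δ ≤ c := by
  set x := δ / (κ - δ) with hx
  have hκδ : 0 < κ - δ := by linarith
  have hx0 : 0 < x := div_pos hδ hκδ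
  have h1 : (1 + δ) * (1 + x) ≤ 1 + 2 * x := by
    have : δ * (1 + x) ≤ x := by
      have : δ * (1 + x) = κ * x := by rw [hx]; field_simp; ring
      rw [this]; nlinarith
    nlinarith
  have h3 := le_sqrt_three
  rw [proxyRatio, ← hx, div_le_iff₀ (by positivity)]
  refine le_of_mul_le_mul_right ?_ (by linarith : 0 < 1 + x)
  calc (1 + δ) * (1 + x) ≤ c * ((1 + x) * (1 + 1.732 * x) ^ 2) := h1.trans hc
    _ ≤ c * ((1 + x) * (1 + Real.sqrt 3 * x) ^ 2) := by gcongr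
    _ = _ := by ring

/-- The bound needed when `δ / (κ - δ)` is unbounded, from `1 + δ ≤ 2` and `(√3) ^ 2 = 3`. -/
lemma sq_mul_proxyRatio_le {κ δ : ℝ} (hδ : 0 < δ) (hκ : δ < κ) (hκ1 : κ < 1) :
    (δ / (κ - δ)) ^ 2 * proxyRatio κ δ ≤ 2 / 3 := by
  set x := δ / (κ - δ) with hx
  have hx0 : 0 < x := div_pos hδ (by linarith)
  have h3 := Real.sq_sqrt (by norm_num : (0 : ℝ) ≤ 3)
  have h3' := Real.sqrt_nonneg 3
  rw [proxyRatio, ← hx, mul_div_assoc', div_le_iff₀ (by positivity)]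
  have : (1 + Real.sqrt 3 * x) ^ 2 = 1 + 2 * (Real.sqrt 3 * x) + 3 * x ^ 2 := by
    rw [add_sq, mul_pow, h3]; ring
  rw [this]
  have h4 : 0 ≤ Real.sqrt 3 * x := by positivity
  nlinarith [sq_nonneg x]

lemma proxyRatio_pos {κ δ : ℝ} (hδ : 0 < δ) (hκ : δ < κ) : 0 < proxyRatio κ δ := by
  have : 0 < κ - δ := by linarith
  unfold proxyRatio; positivity

lemma init_ineq {κ δ δW M R : ℝ} (hκ1 : κ < 1) (hδW : δ ≤ δW)
    (hκ : δW < κ) (hR : 0 ≤ R) (hM : Real.sqrt 2 * R ≤ M) :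
    Real.sqrt 2 * κ * R ≤ (1 - δ) * (M / (κ - δW)) := by
  have h0 : 0 < κ - δW := by linarith
  rw [mul_div_assoc', le_div_iff₀ h0]
  have h1 : κ * (κ - δW) ≤ 1 - δ := by nlinarith
  have h2 : 0 ≤ Real.sqrt 2 * R := by positivity
  calc Real.sqrt 2 * κ * R * (κ - δW) = κ * (κ - δW) * (Real.sqrt 2 * R) := by ring
    _ ≤ (1 - δ) * (Real.sqrt 2 * R) := mul_le_mul_of_nonneg_right h1 h2
    _ ≤ (1 - δ) * M := mul_le_mul_of_nonneg_left hM (by linarith)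

lemma numExtra_pos {κ δ : ℝ} (hδ : 0 < δ) (hκ : δ < κ) {s : ℕ} (hs : 0 < s) :
    0 < numExtra κ δ s := by
  have : 0 < κ - δ := by linarith
  have : (0 : ℝ) < s := by exact_mod_cast hs
  unfold numExtra Acst
  exact Nat.ceil_pos.2 (by positivity)

lemma le_numExtra {κ δ : ℝ} (s : ℕ) :
    8 * (δ / (κ - δ)) ^ 2 * s ≤ numExtra κ δ s := by
  have := Nat.le_ceil (Acst κ δ * s)
  rw [numExtra]
  refine le_trans (le_of_eq ?_) this
  rw [Acst, div_pow]; ring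

lemma sqrt_le_of_le {a b : ℝ} (hb : 0 ≤ b) (h : a ≤ b ^ 2) : Real.sqrt a ≤ b :=
  (Real.sqrt_le_left hb).2 h

/-- The existence of tuned constants reduces to inequalities between numbers. The regimes of `κ`
differ only in the size of the test sets, the bounds for the gap and the numbers supplied here. -/
lemma exists_tuned_of_room {κ δ δW C y δT : ℝ} {s s₀ N a : ℕ} (hδ : 0 < δ) (hκ : δ < κ)
    (hκ1 : κ < 1) (hδW : δ ≤ δW) (hδWκ : δW < κ) (hδT : δ ≤ δT) (hs₀ : 0 < s₀) (ha : 0 < a)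
    (hy : 0 ≤ y)
    (groups_le : a ≤ s + 2 * numExtra κ δ s)
    (outer_le : a * s₀ ≤ s * s₀ + 4 * (numExtra κ δ s * s₀))
    (inner_le : N + 1 ≤ s * s₀ + 4 * (numExtra κ δ s * s₀))
    (gapBound : ∀ {n d m : ℕ} {X : Matrix (Fin n) (Idx d m) ℝ} {S : Finset (Idx d m)},
      VecRIP X (s + 2 * numExtra κ δ s) (s * s₀ + 4 * (numExtra κ δ s * s₀)) δ → 0 < n →
        S.card ≤ s * s₀ → (groups S).card ≤ s → GapBound X S (groups S) N a (a * s₀) δT δW)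
    (le_inner : (s : ℝ) * s₀ ≤ C * ((N : ℝ) + 1)) (le_groups : (s : ℝ) ≤ 41 * a)
    {e₁ e₂ eS α₁ α₂ t₁ t₂ t₁' t₂' : ℝ}
    (he₁0 : 0 ≤ e₁) (he₂0 : 0 ≤ e₂) (heS0 : 0 ≤ eS)
    (he₁ : y * proxyRatio κ δ / 40 ≤ e₁ ^ 2) (he₂ : 5 * proxyRatio κ δ / 40 ≤ e₂ ^ 2)
    (heS : 13 / 10 * proxyRatio κ δ / 40 ≤ eS ^ 2) (he₁1 : e₁ ≤ 1) (he₂1 : e₂ ≤ 1)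
    (hα₁ : (δT / (κ - δW)) ^ 2 * ((s : ℝ) * s₀) ≤ α₁ * ((N : ℝ) + 1))
    (hα₂ : (δT / (κ - δW)) ^ 2 * ((s : ℝ) * s₀) ≤ α₂ * ((a : ℝ) * s₀))
    (ht₁ : (δT / (κ - δW)) ^ 2 * (y * proxyRatio κ δ / 40) ≤ t₁)
    (ht₂ : (δT / (κ - δW)) ^ 2 * (5 * proxyRatio κ δ / 40 * ((a : ℝ) * s₀)) ≤
      t₂ * ((N : ℝ) + 1))
    (ht₁' : (δT / (κ - δW)) ^ 2 * (y * proxyRatio κ δ / 40 * ((N : ℝ) + 1)) ≤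
      t₁' * ((a : ℝ) * s₀))
    (ht₂' : (δT / (κ - δW)) ^ 2 * (5 * proxyRatio κ δ / 40) ≤ t₂')
    (hnum₁ : α₁ * (1.41422 + eS) ^ 2 + t₁ + t₂ < (1 - e₁) ^ 2)
    (hnum₂ : α₂ * (1.41422 + eS) ^ 2 + t₂' + t₁' < (1 - e₂) ^ 2) :
    ∃ z₁ z₂ zS W, Tuned κ δ δW C y s s₀ N a δT z₁ z₂ zS W := by
  have hh := (proxyRatio_pos hδ hκ).le
  have hκW : 0 < κ - δW := by linarith
  set R := Real.sqrt ((s : ℝ) * s₀) with hR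
  have hR0 : 0 ≤ R := Real.sqrt_nonneg _
  have hRsq : R ^ 2 = (s : ℝ) * s₀ := Real.sq_sqrt (by positivity)
  have hk : (0 : ℝ) < (N : ℝ) + 1 := by positivity
  have hq : (0 : ℝ) < (a : ℝ) * s₀ := by
    have : (0 : ℝ) < a := by exact_mod_cast ha
    have : (0 : ℝ) < s₀ := by exact_mod_cast hs₀
    positivity
  set η₁ := Real.sqrt (y * proxyRatio κ δ / 40) with hη₁
  set η₂ := Real.sqrt (5 * proxyRatio κ δ / 40) with hη₂
  set ηS := Real.sqrt (13 / 10 * proxyRatio κ δ / 40) with hηS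
  have q1 : η₁ ^ 2 = y * proxyRatio κ δ / 40 := Real.sq_sqrt (by positivity)
  have q2 : η₂ ^ 2 = 5 * proxyRatio κ δ / 40 := Real.sq_sqrt (by positivity)
  have qS : ηS ^ 2 = 13 / 10 * proxyRatio κ δ / 40 := Real.sq_sqrt (by positivity)
  set M := Real.sqrt ((Real.sqrt 2 * R + ηS * R) ^ 2 + (η₁ * Real.sqrt ((N : ℝ) + 1)) ^ 2 +
    (η₂ * Real.sqrt ((a : ℝ) * s₀)) ^ 2) with hM
  have hMW : δT * (M / (κ - δW)) = δT / (κ - δW) * M := by ring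
  have hcast : ((a * s₀ : ℕ) : ℝ) = (a : ℝ) * s₀ := by push_cast; ring
  -- the noise levels are the smallest admissible ones, and the radius `M / (κ - δW)` satisfies the
  -- contraction condition `whole` with equality
  refine ⟨η₁ * Real.sqrt ((N : ℝ) + 1), η₂ * Real.sqrt ((a : ℝ) * s₀), ηS * R, M / (κ - δW),
    ha, groups_le, outer_le, inner_le, gapBound, le_inner, le_groups, by positivity, by positivity,
    by positivity, ?_, ?_, ?_, by positivity, hδT, ?_, ?_, ?_, ?_⟩
  · rw [mul_pow, Real.sq_sqrt hk.le, q1]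
  · rw [mul_pow, Real.sq_sqrt hq.le, q2, hcast]
  · rw [mul_pow, hRsq, qS]
  · rw [hMW]
    refine mul_sqrt_add_lt hk hq.le (by rw [hRsq]; exact hα₁) (by rw [q1]; exact ht₁)
      (by rw [q2]; exact ht₂) (Real.sqrt_nonneg _) (sqrt_le_of_le heS0 heS)
      (sqrt_le_of_le he₁0 he₁) he₁1 hnum₁
  · rw [hMW, hcast, hM, add_right_comm ((Real.sqrt 2 * R + ηS * R) ^ 2)]
    refine mul_sqrt_add_lt hq hk.le (by rw [hRsq]; exact hα₂) (by rw [q2]; exact ht₂')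
      (by rw [q1]; exact ht₁') (Real.sqrt_nonneg _) (sqrt_le_of_le heS0 heS)
      (sqrt_le_of_le he₂0 he₂) he₂1 hnum₂
  · refine le_of_eq ?_
    have : M = (κ - δW) * (M / (κ - δW)) := by field_simp
    calc δW * (M / (κ - δW)) + M
        = δW * (M / (κ - δW)) + (κ - δW) * (M / (κ - δW)) := by rw [← this]
      _ = _ := by ring
  · refine init_ineq hκ1 hδW hδWκ hR0 ?_
    refine Real.le_sqrt_of_sq_le ?_
    have : (Real.sqrt 2 * R) ^ 2 ≤ (Real.sqrt 2 * R + ηS * R) ^ 2 :=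
      pow_le_pow_left₀ (by positivity) (le_add_of_nonneg_right (by positivity)) 2
    have h1 := sq_nonneg (η₁ * Real.sqrt ((N : ℝ) + 1))
    have h2 := sq_nonneg (η₂ * Real.sqrt ((a : ℝ) * s₀))
    linarith

/-- The regime `κ ≤ 8 δ`: all supports fit into the class of the restricted isometry property, with
as many extra groups as that class allows. -/
lemma exists_tuned_direct {κ δ : ℝ} (hδ : 0 < δ) (hκ : δ < κ) (hκ1 : κ < 1) (hκδ : κ ≤ 8 * δ)
    {s s₀ : ℕ} (hs : 0 < s) (hs₀ : 0 < s₀) :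
    ∃ N a z₁ z₂ zS W, Tuned κ δ δ (49 / 8) 9 s s₀ N a δ z₁ z₂ zS W := by
  set a := numExtra κ δ s with ha
  have ha0 : 0 < a := numExtra_pos hδ hκ hs
  have hκδ0 : 0 < κ - δ := by linarith
  set x := δ / (κ - δ) with hx
  have hx7 : 1 / 7 ≤ x := by rw [hx, le_div_iff₀ hκδ0]; linarith
  have hax : 8 * x ^ 2 * s ≤ a := le_numExtra s
  have hN : a * s₀ - 1 + 1 = a * s₀ := Nat.sub_add_cancel (Nat.mul_pos ha0 hs₀)
  have hNr : ((a * s₀ - 1 : ℕ) : ℝ) + 1 = (a : ℝ) * s₀ := by exact_mod_cast hN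
  have hs₀' : (0 : ℝ) < s₀ := by exact_mod_cast hs₀
  have hs' : (0 : ℝ) < s := by exact_mod_cast hs
  have hq : (0 : ℝ) < (a : ℝ) * s₀ := by
    have : (0 : ℝ) < a := by exact_mod_cast ha0
    positivity
  have haxq : 8 * x ^ 2 * (s * s₀) ≤ (a : ℝ) * s₀ := by nlinarith
  have hx2 : 1 / 49 ≤ x ^ 2 := by nlinarith
  have hh0 := proxyRatio_pos hδ hκ
  -- the numbers differ for moderate and for large `δ / (κ - δ)`
  obtain ⟨e, eS, t, u, he0, heS0, he, heS, he1, ht, hu, hnum⟩ : ∃ e eS t u : ℝ, 0 ≤ e ∧ 0 ≤ eS ∧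
      9 * proxyRatio κ δ / 40 ≤ e ^ 2 ∧ 13 / 10 * proxyRatio κ δ / 40 ≤ eS ^ 2 ∧ e ≤ 1 ∧
      x ^ 2 * (9 * proxyRatio κ δ / 40) ≤ t ∧ x ^ 2 * (5 * proxyRatio κ δ / 40) ≤ u ∧
      1 / 8 * (1.41422 + eS) ^ 2 + t + u < (1 - e) ^ 2 := by
    rcases le_total x 0.6 with h6 | h6
    · have h1 : proxyRatio κ δ ≤ 0.724 := by
        refine proxyRatio_le hδ hκ hκ1 ?_ (by norm_num)
        rw [← hx]; nlinarith [mul_nonneg (sub_nonneg.2 hx7) (sub_nonneg.2 hx7),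
          mul_nonneg (mul_nonneg (sub_nonneg.2 hx7) (sub_nonneg.2 hx7)) (sub_nonneg.2 hx7)]
      have h3 := le_sqrt_three
      have h2 : x ^ 2 * proxyRatio κ δ ≤ 0.12 := by
        have hxp : 0 < x := by linarith
        have h4 : proxyRatio κ δ ≤ 0.12 / x ^ 2 := by
          refine proxyRatio_le hδ hκ hκ1 ?_ (by positivity)
          rw [← hx, div_mul_eq_mul_div, le_div_iff₀ (by positivity)]
          have h5 : 0 ≤ 0.6 - x := by linarith
          nlinarith [mul_nonneg hxp.le h5, mul_nonneg (mul_nonneg hxp.le hxp.le) h5,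
            mul_nonneg h5 h5]
        rw [le_div_iff₀ (by positivity)] at h4; linarith
      exact ⟨0.4037, 0.1535, 0.027, 0.015, by norm_num, by norm_num, by norm_num; linarith,
        by norm_num; linarith, by norm_num, by linarith, by linarith, by norm_num⟩
    · have h1 : proxyRatio κ δ ≤ 0.331 := by
        refine proxyRatio_le hδ hκ hκ1 ?_ (by norm_num)
        rw [← hx]; nlinarith [mul_nonneg (sub_nonneg.2 h6) (sub_nonneg.2 h6),
          mul_nonneg (mul_nonneg (sub_nonneg.2 h6) (sub_nonneg.2 h6)) (sub_nonneg.2 h6)]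
      have h2 := sq_mul_proxyRatio_le hδ hκ hκ1
      rw [← hx] at h2
      exact ⟨0.2730, 0.1038, 0.15, 1 / 12, by norm_num, by norm_num, by norm_num; linarith,
        by norm_num; linarith, by norm_num, by linarith, by linarith, by norm_num⟩
  refine ⟨a * s₀ - 1, a, exists_tuned_of_room hδ hκ hκ1 le_rfl hκ le_rfl hs₀ ha0 (by norm_num)
    (by omega) (by rw [← ha]; omega) (by rw [← ha]; omega)
    (fun hX hn hS hG => hX.gapBound_direct hn hδ.le hS hG hN) ?_ ?_
    (e₁ := e) (e₂ := e) (eS := eS) (α₁ := 1 / 8) (α₂ := 1 / 8) (t₁ := t) (t₂ := u) (t₁' := t)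
    (t₂' := u) he0 he0 heS0 he (by linarith) heS he1 he1 ?_ ?_ ht ?_ ?_ hu hnum
    (by linarith)⟩
  · rw [hNr]; nlinarith
  · nlinarith
  · rw [hNr]; linarith
  · linarith
  · rw [hNr, ← mul_assoc]; exact mul_le_mul_of_nonneg_right hu hq.le
  · rw [hNr, ← mul_assoc]; exact mul_le_mul_of_nonneg_right ht hq.le

set_option maxHeartbeats 800000 in
/-- The regime `8 δ < κ ≤ 19 δ`, reduced to inequalities between numbers: the cap for extra entries
in the true groups is raised by the factor `3 / 2`, at the price of the factor `√2` in the gap. The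
number `c` bounds the squared ratio of `δ / (κ - √2 δ)` and `δ / (κ - δ)`. -/
lemma exists_tuned_two_of_room {κ δ : ℝ} (hδ : 0 < δ) (hκ : 8 * δ < κ) (hκ1 : κ < 1)
    (hκδ : κ ≤ 19 * δ) {s s₀ : ℕ} (hs : 0 < s) (hs₀ : 0 < s₀) {c h X2 e₁ e₂ eS : ℝ}
    (hc0 : 0 ≤ c) (hh00 : 0 ≤ h) (hX0 : 0 ≤ X2) (he₁0 : 0 ≤ e₁) (he₂0 : 0 ≤ e₂) (heS0 : 0 ≤ eS)
    (hc : 1 ≤ c * (1 - 0.41422 * (δ / (κ - δ))) ^ 2) (hh : proxyRatio κ δ ≤ h)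
    (hX : (δ / (κ - δ)) ^ 2 ≤ X2) (he₁ : 12.2 * h / 40 ≤ e₁ ^ 2) (he₂ : 5 * h / 40 ≤ e₂ ^ 2)
    (heS : 13 / 10 * h / 40 ≤ eS ^ 2) (he₁1 : e₁ ≤ 1) (he₂1 : e₂ ≤ 1)
    (hn1 : c / 12 * (1.41422 + eS) ^ 2 + c * X2 * (12.2 * h / 40) +
      c * X2 * (5 * h / 40) * (2 / 3) < (1 - e₁) ^ 2)
    (hn2 : c / 8 * (1.41422 + eS) ^ 2 + c * X2 * (5 * h / 40) + c * X2 * (12.2 * h / 40) * 2 <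
      (1 - e₂) ^ 2) :
    ∃ N a z₁ z₂ zS W, Tuned κ δ (Real.sqrt 2 * δ) 27 12.2 s s₀ N a δ z₁ z₂ zS W := by
  have hκ' : δ < κ := by linarith
  set a := numExtra κ δ s with ha
  have ha0 : 0 < a := numExtra_pos hδ hκ' hs
  have hκδ0 : 0 < κ - δ := by linarith
  have hax : 8 * (δ / (κ - δ)) ^ 2 * s ≤ a := le_numExtra s
  have hx7 : δ / (κ - δ) ≤ 1 / 7 := by rw [div_le_iff₀ hκδ0]; linarith
  have hx18 : 1 / 18 ≤ δ / (κ - δ) := by rw [le_div_iff₀ hκδ0]; linarith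
  have hxδ : δ / (κ - δ) * (κ - δ) = δ := div_mul_cancel₀ _ hκδ0.ne'
  generalize δ / (κ - δ) = x at *
  set N := (3 * (a * s₀) - 1) / 2 with hN
  have hqpos := Nat.mul_pos ha0 hs₀
  have hN1 : 3 * (a * s₀) ≤ 2 * (N + 1) := by omega
  have hN2 : N + 1 ≤ 2 * (a * s₀) := by omega
  have hs₀' : (0 : ℝ) < s₀ := by exact_mod_cast hs₀
  have hs' : (0 : ℝ) < s := by exact_mod_cast hs
  have hN1r : 3 * ((a : ℝ) * s₀) ≤ 2 * ((N : ℝ) + 1) := by exact_mod_cast hN1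
  have hN2r : (N : ℝ) + 1 ≤ 2 * ((a : ℝ) * s₀) := by exact_mod_cast hN2
  have hq : (0 : ℝ) < (a : ℝ) * s₀ := by exact_mod_cast hqpos
  have haxq : 8 * x ^ 2 * (s * s₀) ≤ (a : ℝ) * s₀ := by
    have := mul_le_mul_of_nonneg_right hax hs₀'.le
    linarith only [this]
  have hx2 : 1 / 324 ≤ x ^ 2 := by
    have := pow_le_pow_left₀ (by norm_num) hx18 2
    linarith only [this]
  have hh0 := proxyRatio_pos hδ hκ'
  have h2le := sqrt_two_le
  have h2ge : 1 ≤ Real.sqrt 2 := Real.one_le_sqrt.2 (by norm_num)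
  have hδW : Real.sqrt 2 * δ < κ := by
    have := mul_le_mul_of_nonneg_right h2le hδ.le
    linarith only [this, hκ, hδ]
  have hκW : 0 < κ - Real.sqrt 2 * δ := by linarith
  have hw0 : 0 < δ / (κ - Real.sqrt 2 * δ) := div_pos hδ hκW
  have hwδ : δ / (κ - Real.sqrt 2 * δ) * (κ - Real.sqrt 2 * δ) = δ := div_mul_cancel₀ _ hκW.ne'
  have room := @exists_tuned_of_room κ δ (Real.sqrt 2 * δ) 27 12.2 δ s s₀ N a hδ hκ' hκ1
    (le_mul_of_one_le_left hδ.le h2ge) hδW le_rfl hs₀ ha0 (by norm_num)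
    (by omega) (by rw [← ha]; omega) (by rw [← ha]; omega)
    (fun hX hn hS hG => hX.gapBound_two hn hδ.le hS hG (by rw [← ha]; omega))
  generalize δ / (κ - Real.sqrt 2 * δ) = w at *
  have hwx : w * (1 - 0.41422 * x) ≤ x := by
    have e : w * (1 - (Real.sqrt 2 - 1) * x) = x := by
      refine mul_right_cancel₀ hκδ0.ne' ?_
      calc w * (1 - (Real.sqrt 2 - 1) * x) * (κ - δ)
          = w * ((κ - δ) - (Real.sqrt 2 - 1) * (x * (κ - δ))) := by ring
        _ = w * (κ - Real.sqrt 2 * δ) := by rw [hxδ]; ring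
        _ = x * (κ - δ) := by rw [hwδ, hxδ]
    have : 0 ≤ w * x * (1.41422 - Real.sqrt 2) :=
      mul_nonneg (mul_nonneg hw0.le (by linarith only [hx18])) (by linarith only [h2le])
    linarith only [this, e]
  have hwc : w ^ 2 ≤ c * x ^ 2 := by
    have h1 : (w * (1 - 0.41422 * x)) ^ 2 ≤ x ^ 2 :=
      pow_le_pow_left₀ (mul_nonneg hw0.le (by linarith only [hx7])) hwx 2
    calc w ^ 2 ≤ w ^ 2 * (c * (1 - 0.41422 * x) ^ 2) := le_mul_of_one_le_right (sq_nonneg _) hc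
      _ = c * (w * (1 - 0.41422 * x)) ^ 2 := by ring
      _ ≤ _ := mul_le_mul_of_nonneg_left h1 hc0
  have hwX : w ^ 2 ≤ c * X2 := hwc.trans (mul_le_mul_of_nonneg_left hX hc0)
  have hwR : w ^ 2 * ((s : ℝ) * s₀) ≤ c / 8 * ((a : ℝ) * s₀) := by
    calc w ^ 2 * ((s : ℝ) * s₀) ≤ c * x ^ 2 * (s * s₀) := by gcongr
      _ = c / 8 * (8 * x ^ 2 * (s * s₀)) := by ring
      _ ≤ _ := mul_le_mul_of_nonneg_left haxq (by positivity)
  have hx2s := mul_le_mul_of_nonneg_right hx2 hs'.le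
  have hx2ss := mul_le_mul_of_nonneg_right hx2 (mul_pos hs' hs₀').le
  have t1 : (s : ℝ) * s₀ ≤ 27 * ((N : ℝ) + 1) := by linarith only [hx2ss, haxq, hN1r]
  have t2 : (s : ℝ) ≤ 41 * a := by linarith only [hx2s, hax, hs']
  have t3 : w ^ 2 * ((s : ℝ) * s₀) ≤ c / 12 * ((N : ℝ) + 1) := by
    refine hwR.trans ?_
    have := mul_le_mul_of_nonneg_left hN1r hc0
    linarith only [this]
  have t4 : w ^ 2 * (12.2 * proxyRatio κ δ / 40) ≤ c * X2 * (12.2 * h / 40) := by gcongr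
  have t5 : w ^ 2 * (5 * proxyRatio κ δ / 40 * ((a : ℝ) * s₀)) ≤
      c * X2 * (5 * h / 40) * (2 / 3) * ((N : ℝ) + 1) := by
    have h23 : (a : ℝ) * s₀ ≤ (N + 1) * (2 / 3) := by linarith only [hN1r]
    calc _ ≤ c * X2 * (5 * h / 40 * ((N + 1) * (2 / 3))) :=
          mul_le_mul hwX (mul_le_mul (by gcongr) h23 hq.le (by positivity)) (by positivity)
            (by positivity)
      _ = _ := by ring
  have t6 : w ^ 2 * (12.2 * proxyRatio κ δ / 40 * ((N : ℝ) + 1)) ≤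
      c * X2 * (12.2 * h / 40) * 2 * ((a : ℝ) * s₀) := by
    calc _ ≤ c * X2 * (12.2 * h / 40 * (2 * (a * s₀))) := by gcongr
      _ = _ := by ring
  have t7 : w ^ 2 * (5 * proxyRatio κ δ / 40) ≤ c * X2 * (5 * h / 40) := by gcongr
  exact ⟨N, a, room t1 t2 he₁0 he₂0 heS0 (by linarith only [hh, he₁])
    (by linarith only [hh, he₂]) (by linarith only [hh, heS]) he₁1 he₂1 t3 hwR
    t4 t5 t6 t7 hn1 hn2⟩

/-- The regime `8 δ < κ ≤ 19 δ`, where `δ / (κ - δ)` lies between `1 / 18` and `1 / 7`; the numbers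
differ below and above `0.1`. -/
lemma exists_tuned_two {κ δ : ℝ} (hδ : 0 < δ) (hκ : 8 * δ < κ) (hκ1 : κ < 1) (hκδ : κ ≤ 19 * δ)
    {s s₀ : ℕ} (hs : 0 < s) (hs₀ : 0 < s₀) :
    ∃ N a z₁ z₂ zS W, Tuned κ δ (Real.sqrt 2 * δ) 27 12.2 s s₀ N a δ z₁ z₂ zS W := by
  have hκ' : δ < κ := by linarith
  have hκδ0 : 0 < κ - δ := by linarith
  have hx7 : δ / (κ - δ) ≤ 1 / 7 := by rw [div_le_iff₀ hκδ0]; linarith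
  have hx18 : 1 / 18 ≤ δ / (κ - δ) := by rw [le_div_iff₀ hκδ0]; linarith
  rcases le_total (δ / (κ - δ)) 0.1 with h6 | h6
  · have h1 : proxyRatio κ δ ≤ 0.8761 := by
      refine proxyRatio_le hδ hκ' hκ1 ?_ (by norm_num)
      generalize δ / (κ - δ) = x at *
      nlinarith [mul_nonneg (sub_nonneg.2 hx18) (sub_nonneg.2 hx18),
        mul_nonneg (mul_nonneg (sub_nonneg.2 hx18) (sub_nonneg.2 hx18)) (sub_nonneg.2 hx18)]
    refine exists_tuned_two_of_room hδ hκ hκ1 hκδ hs hs₀ (c := 1.0885) (h := 0.8761) (X2 := 0.01)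
      (e₁ := 0.517) (e₂ := 0.331) (eS := 0.1688) (by norm_num) (by norm_num) (by norm_num)
      (by norm_num) (by norm_num) (by norm_num) ?_ h1 ?_ (by norm_num) (by norm_num) (by norm_num)
      (by norm_num) (by norm_num) (by norm_num) (by norm_num)
    · generalize δ / (κ - δ) = x at *; nlinarith
    · generalize δ / (κ - δ) = x at *; nlinarith
  · have h1 : proxyRatio κ δ ≤ 0.793 := by
      refine proxyRatio_le hδ hκ' hκ1 ?_ (by norm_num)
      generalize δ / (κ - δ) = x at *
      nlinarith [mul_nonneg (sub_nonneg.2 h6) (sub_nonneg.2 h6),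
        mul_nonneg (mul_nonneg (sub_nonneg.2 h6) (sub_nonneg.2 h6)) (sub_nonneg.2 h6)]
    refine exists_tuned_two_of_room hδ hκ hκ1 hκδ hs hs₀ (c := 1.13) (h := 0.793) (X2 := 1 / 49)
      (e₁ := 0.492) (e₂ := 0.315) (eS := 0.1606) (by norm_num) (by norm_num) (by norm_num)
      (by norm_num) (by norm_num) (by norm_num) ?_ h1 ?_ (by norm_num) (by norm_num) (by norm_num)
      (by norm_num) (by norm_num) (by norm_num) (by norm_num)
    · generalize δ / (κ - δ) = x at *; nlinarith
    · generalize δ / (κ - δ) = x at *; nlinarith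

/-- The regime `19 δ < κ`, where `A s` is too small a cap for the extras: about `s / 2` extra
groups are admitted, and the supports are split into blocks. -/
lemma exists_tuned_blocks {κ δ : ℝ} (hδ : 0 < δ) (hκδ : 19 * δ < κ) (hκ1 : κ < 1)
    {s s₀ : ℕ} (hs : 0 < s) (hs₀ : 0 < s₀) :
    ∃ N a z₁ z₂ zS W, Tuned κ δ (5 * δ) 2 6.4 s s₀ N a (Real.sqrt 10 * δ) z₁ z₂ zS W := by
  have hκ' : δ < κ := by linarith
  have ha0' : 0 < numExtra κ δ s := numExtra_pos hδ hκ' hs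
  set a := (s + 1) / 2 with ha
  have ha0 : 0 < a := by omega
  have hsa : s ≤ 2 * a := by omega
  have has : 2 * a ≤ s + 1 := by omega
  have hN : a * s₀ - 1 + 1 = a * s₀ := Nat.sub_add_cancel (Nat.mul_pos ha0 hs₀)
  have hNr : ((a * s₀ - 1 : ℕ) : ℝ) + 1 = (a : ℝ) * s₀ := by exact_mod_cast hN
  have hs₀' : (0 : ℝ) < s₀ := by exact_mod_cast hs₀
  have hs' : (0 : ℝ) < s := by exact_mod_cast hs
  have hq : (0 : ℝ) < (a : ℝ) * s₀ := by exact_mod_cast Nat.mul_pos ha0 hs₀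
  have hsar : (s : ℝ) ≤ 2 * a := by exact_mod_cast hsa
  have hR : (s : ℝ) * s₀ ≤ 2 * ((a : ℝ) * s₀) := by nlinarith
  have hcap : 2 * (a * s₀) ≤ s * s₀ + 4 * (numExtra κ δ s * s₀) := by
    have h1 : 2 * a * s₀ ≤ (s + 1) * s₀ := Nat.mul_le_mul_right _ has
    have h2 : 1 * s₀ ≤ numExtra κ δ s * s₀ := Nat.mul_le_mul_right _ ha0'
    rw [mul_assoc, add_mul] at h1
    omega
  have hh0 := proxyRatio_pos hδ hκ'
  have hh : proxyRatio κ δ ≤ 1 := by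
    refine proxyRatio_le hδ hκ' hκ1 ?_ (by norm_num)
    have : 0 < δ / (κ - δ) := div_pos hδ (by linarith)
    nlinarith [pow_pos this 2, pow_pos this 3]
  have h10 : 1 ≤ Real.sqrt 10 := Real.one_le_sqrt.2 (by norm_num)
  have hκ5 : 0 < κ - 5 * δ := by linarith
  have hw : (Real.sqrt 10 * δ / (κ - 5 * δ)) ^ 2 ≤ 10 / 196 := by
    rw [div_pow, mul_pow, Real.sq_sqrt (by norm_num), div_le_iff₀ (by positivity)]
    nlinarith
  set w := Real.sqrt 10 * δ / (κ - 5 * δ) with hwdef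
  have hwR : w ^ 2 * ((s : ℝ) * s₀) ≤ 20 / 196 * ((a : ℝ) * s₀) := by
    calc _ ≤ 10 / 196 * (2 * ((a : ℝ) * s₀)) := by gcongr
      _ = _ := by ring
  have ht1 : w ^ 2 * (6.4 * proxyRatio κ δ / 40) ≤ 10 / 196 * (6.4 * 1 / 40) := by gcongr
  have ht2 : w ^ 2 * (5 * proxyRatio κ δ / 40) ≤ 10 / 196 * (5 * 1 / 40) := by gcongr
  refine ⟨a * s₀ - 1, a, exists_tuned_of_room hδ hκ' hκ1 (by linarith) (by linarith)
    (le_mul_of_one_le_left hδ.le h10) hs₀ ha0 (by norm_num) (by omega) (by omega)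
    (by rw [hN]; omega) (fun hX hn hS hG => hX.gapBound_blocks hn hδ.le hS hG (by omega) hcap
      hsa hN) ?_ ?_
    (e₁ := 0.4) (e₂ := 0.4) (eS := 0.181) (α₁ := 20 / 196) (α₂ := 20 / 196)
    (t₁ := 10 / 196 * (6.4 * 1 / 40)) (t₂ := 10 / 196 * (5 * 1 / 40))
    (t₁' := 10 / 196 * (6.4 * 1 / 40)) (t₂' := 10 / 196 * (5 * 1 / 40))
    (by norm_num) (by norm_num) (by norm_num) (by norm_num; linarith) (by norm_num; linarith)
    (by norm_num; linarith) (by norm_num) (by norm_num) ?_ hwR ht1 ?_ ?_ ht2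
    (by norm_num) (by norm_num)⟩
  · rw [hNr]; exact hR
  · linarith
  · rw [hNr]; exact hwR
  · rw [hNr, ← mul_assoc]; exact mul_le_mul_of_nonneg_right ht2 hq.le
  · rw [hNr, ← mul_assoc]; exact mul_le_mul_of_nonneg_right ht1 hq.le

end constants

/-! ### Contraction rate of the second stage -/

section rate

/-- The relative signal strength of the oracle estimator, in units of `μ`. -/
def signalConst (δ : ℝ) : ℝ := 17 / 10 + Real.sqrt 6 * (δ / (1 - δ))

/-- The relative size of the residual correlations, in units of `μ`. -/
def residConst (δ : ℝ) : ℝ := 1 / 2 / Real.sqrt (1 + 3 * (δ / (1 - δ)) ^ 2)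

/-- The loss factor of thresholding near the oracle estimator. -/
def lossConst (δ : ℝ) : ℝ :=
  max (Real.sqrt (signalConst δ ^ 2 * (2 * signalConst δ - 1) / (2 * (signalConst δ - 1) ^ 3)))
    (1 / (1 - residConst δ))

/-- An upper bound, depending on `δ` only, for the contraction factor of the second stage: `5`,
`√2` and `1` are the losses in the three regimes of `κ`, which occur only if `19 δ < 1`, `8 δ < 1`,
and always, respectively. -/
def rate (δ : ℝ) : ℝ :=
  lossConst δ * ((if 19 * δ < 1 then 5 else if 8 * δ < 1 then Real.sqrt 2 else 1) * δ)

variable {δ : ℝ}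

lemma residConst_pos : 0 < residConst δ := by unfold residConst; positivity

lemma residConst_sq : residConst δ ^ 2 = 1 / 4 / (1 + 3 * (δ / (1 - δ)) ^ 2) := by
  rw [residConst, div_pow, Real.sq_sqrt (by positivity)]; norm_num

lemma residConst_le : residConst δ ≤ 1 / 2 := by
  refine abs_le_of_sq_le_sq' ?_ (by norm_num) |>.2
  rw [residConst_sq, div_le_iff₀ (by positivity)]
  nlinarith [sq_nonneg (δ / (1 - δ))]

lemma residConst_lt (h0 : 0 < δ) (h1 : δ < 1) : residConst δ < 1 - δ := by
  have hd : 0 < 1 - δ := by linarith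
  refine lt_of_pow_lt_pow_left₀ 2 hd.le ?_
  rw [residConst_sq, div_lt_iff₀ (by positivity)]
  have e : (1 - δ) ^ 2 * (1 + 3 * (δ / (1 - δ)) ^ 2) = (1 - δ) ^ 2 + 3 * δ ^ 2 := by
    field_simp
  rw [e]; nlinarith [sq_nonneg (δ - 1 / 4)]

lemma le_signalConst (h0 : 0 < δ) (h1 : δ < 1) : 17 / 10 ≤ signalConst δ := by
  have hd : 0 < 1 - δ := by linarith
  have : 0 ≤ Real.sqrt 6 * (δ / (1 - δ)) := by positivity
  rw [signalConst]; linarith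

lemma lossConst_pos (h0 : 0 < δ) (h1 : δ < 1) : 0 < lossConst δ := by
  have := residConst_lt h0 h1
  exact lt_max_of_lt_right (by rw [one_div, inv_pos]; linarith)

lemma one_le_lossConst_mul (h0 : 0 < δ) (h1 : δ < 1) : 1 ≤ lossConst δ * (1 - residConst δ) := by
  have h := residConst_lt h0 h1
  have h2 : 0 < 1 - residConst δ := by linarith
  rw [← div_le_iff₀ h2]
  exact le_max_right _ _

lemma signalConst_le_lossConst (h0 : 0 < δ) (h1 : δ < 1) :
    signalConst δ ^ 2 * (2 * signalConst δ - 1) ≤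
      lossConst δ ^ 2 * (2 * (signalConst δ - 1) ^ 3) := by
  have hQ := le_signalConst h0 h1
  have h3 : 0 < 2 * (signalConst δ - 1) ^ 3 := by
    have : 0 < signalConst δ - 1 := by linarith
    positivity
  rw [← div_le_iff₀ h3]
  refine (Real.sqrt_le_left (lossConst_pos h0 h1).le).1 (le_max_left _ _)

lemma lossConst_mul_lt_one {f : ℝ} (h0 : 0 < δ) (h1 : δ < 1) (hf : 0 < f)
    (hε : f * δ < 1 - residConst δ)
    (hQ : (f * δ) ^ 2 * (signalConst δ ^ 2 * (2 * signalConst δ - 1)) <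
      2 * (signalConst δ - 1) ^ 3) : lossConst δ * (f * δ) < 1 := by
  have hfδ : 0 < f * δ := mul_pos hf h0
  have h2 := residConst_lt h0 h1
  have h17 := le_signalConst h0 h1
  have h3 : 0 < 2 * (signalConst δ - 1) ^ 3 := by
    have : 0 < signalConst δ - 1 := by linarith
    positivity
  rw [← lt_div_iff₀ hfδ]
  refine max_lt ?_ ?_
  · rw [Real.sqrt_lt' (by positivity), div_lt_iff₀ h3, div_pow, one_pow, div_mul_eq_mul_div,
      one_mul, lt_div_iff₀ (by positivity)]
    linarith
  · exact one_div_lt_one_div_of_lt hfδ hε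

lemma rate_pos (h0 : 0 < δ) (h1 : δ < 1) : 0 < rate δ := by
  refine mul_pos (lossConst_pos h0 h1) (mul_pos ?_ h0)
  split_ifs <;> positivity

/-- For `19 δ < 1` and `8 δ < 1` the bounds for `δ` suffice. Without them, in terms of
`v = δ / (1 - δ)`, all coefficients of the difference of the two sides of the inequality for the
signal strength are nonnegative. -/
lemma rate_lt_one (h0 : 0 < δ) (h1 : δ < 1) : rate δ < 1 := by
  have hd : 0 < 1 - δ := by linarith
  have h17 := le_signalConst h0 h1
  have hg0 := Real.sqrt_nonneg 6
  have hg2 : Real.sqrt 6 ^ 2 = 6 := Real.sq_sqrt (by norm_num)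
  have hg1 : Real.sqrt 6 ≤ 2.45 := by rw [Real.sqrt_le_left (by norm_num)]; norm_num
  have hε := residConst_le (δ := δ)
  unfold rate
  split_ifs with h19 h8
  · refine lossConst_mul_lt_one h0 h1 (by norm_num) (by linarith) ?_
    have hv : δ / (1 - δ) ≤ 1 / 18 := by rw [div_le_iff₀ hd]; linarith
    have hQ : signalConst δ ≤ 1.8362 := by
      rw [signalConst]
      have := mul_le_mul hg1 hv (div_nonneg h0.le hd.le) (by norm_num)
      linarith
    calc (5 * δ) ^ 2 * (signalConst δ ^ 2 * (2 * signalConst δ - 1))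
        ≤ (5 * (1 / 19)) ^ 2 * (1.8362 ^ 2 * (2 * 1.8362 - 1)) := by
          have h4 : 0 ≤ 2 * signalConst δ - 1 := by linarith
          have h5 : 0 ≤ signalConst δ := by linarith
          gcongr
          linarith
      _ < 2 * (17 / 10 - 1) ^ 3 := by norm_num
      _ ≤ _ := by gcongr
  · have h2le := sqrt_two_le
    have h2 : Real.sqrt 2 * δ ≤ 1.41422 * (1 / 8) := by gcongr; linarith
    refine lossConst_mul_lt_one h0 h1 (by positivity) (by linarith) ?_
    have hv : δ / (1 - δ) ≤ 1 / 7 := by rw [div_le_iff₀ hd]; linarith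
    have hQ : signalConst δ ≤ 2.05 := by
      rw [signalConst]
      have := mul_le_mul hg1 hv (div_nonneg h0.le hd.le) (by norm_num)
      linarith
    calc (Real.sqrt 2 * δ) ^ 2 * (signalConst δ ^ 2 * (2 * signalConst δ - 1))
        ≤ (1.41422 * (1 / 8)) ^ 2 * (2.05 ^ 2 * (2 * 2.05 - 1)) := by
          have h4 : 0 ≤ 2 * signalConst δ - 1 := by linarith
          have h5 : 0 ≤ signalConst δ := by linarith
          gcongr
      _ < 2 * (17 / 10 - 1) ^ 3 := by norm_num
      _ ≤ _ := by gcongr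
  · refine lossConst_mul_lt_one h0 h1 one_pos (by linarith [residConst_lt h0 h1]) ?_
    set v := δ / (1 - δ) with hv
    have hv0 : 0 < v := div_pos h0 hd
    have hδv : δ = v / (1 + v) := by rw [hv]; field_simp; ring
    rw [one_mul, signalConst, ← hv]
    have e0 : δ ^ 2 * (1 + v) ^ 2 = v ^ 2 := by
      rw [← mul_pow]; congr 1; rw [hδv]; field_simp
    refine lt_of_mul_lt_mul_right ?_ (sq_nonneg (1 + v))
    rw [mul_right_comm, e0]
    clear_value v
    set g := Real.sqrt 6
    have e1 : (17 / 10 + g * v) ^ 2 = 2.89 + 3.4 * g * v + 6 * v ^ 2 := by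
      linear_combination v ^ 2 * hg2
    have e2 : (17 / 10 + g * v - 1) ^ 3 = 0.343 + 1.47 * g * v + 12.6 * v ^ 2 + 6 * g * v ^ 3 := by
      linear_combination (2.1 * v ^ 2 + g * v ^ 3) * hg2
    rw [e1, e2]
    have h3 : 0 < g := Real.sqrt_pos.2 (by norm_num)
    have e3 : 2 * (0.343 + 1.47 * g * v + 12.6 * v ^ 2 + 6 * g * v ^ 3) * (1 + v) ^ 2 -
        v ^ 2 * ((2.89 + 3.4 * g * v + 6 * v ^ 2) * (2 * (17 / 10 + g * v) - 1)) =
        0.686 + (2.94 * g + 1.372) * v + (18.95 + 5.88 * g) * v ^ 2 + (50.4 + g) * v ^ 3 +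
        (24 * g - 30) * v ^ 4 := by
      linear_combination (-6.8 * v ^ 4) * hg2
    have h4 : 0 ≤ 24 * g - 30 := by nlinarith
    have h5 : 0 < 0.686 + (2.94 * g + 1.372) * v + (18.95 + 5.88 * g) * v ^ 2 +
        (50.4 + g) * v ^ 3 + (24 * g - 30) * v ^ 4 := by positivity
    linarith

/-- In each regime of `κ` there are constants for the step lemma; the union bound over the test sets
in the true groups succeeds with a margin `η`. -/
lemma exists_tuned {κ : ℝ} (h0 : 0 < δ) (hκ : δ < κ) (hκ1 : κ < 1) :
    ∃ δW C y η : ℝ, 0 < η ∧ 0 ≤ δW ∧ lossConst δ * δW ≤ rate δ ∧ 1 ≤ C ∧ 0 ≤ y ∧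
      C * Real.sqrt 10 ≤ Real.exp (9 / 20 * y - 1 - η) ∧
      ∀ s s₀ : ℕ, 0 < s → 0 < s₀ →
        ∃ N a δT z₁ z₂ zS W, Tuned κ δ δW C y s s₀ N a δT z₁ z₂ zS W := by
  have hΓ := (lossConst_pos h0 (hκ.trans hκ1)).le
  have h10 : Real.sqrt 10 ≤ 3.1623 := by rw [Real.sqrt_le_left (by norm_num)]; norm_num
  have h2le := sqrt_two_le
  have h2ge : 1 ≤ Real.sqrt 2 := Real.one_le_sqrt.2 (by norm_num)
  have he := Real.exp_one_gt_d9
  have hexp : ∀ x : ℝ, 0 ≤ x → 1 + x + x ^ 2 / 2 + x ^ 3 / 6 + x ^ 4 / 24 ≤ Real.exp x := by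
    intro x hx
    have := Real.sum_le_exp_of_nonneg hx 5
    simp only [Finset.sum_range_succ, Finset.sum_range_zero, Nat.factorial] at this
    norm_num at this
    linarith
  have hfac : ∀ f : ℝ, f ≤ (if 19 * δ < 1 then 5 else if 8 * δ < 1 then Real.sqrt 2 else 1) →
      lossConst δ * (f * δ) ≤ rate δ := fun f hf =>
    mul_le_mul_of_nonneg_left (mul_le_mul_of_nonneg_right hf h0.le) hΓ
  rcases le_or_gt κ (8 * δ) with h8 | h8
  · refine ⟨δ, 49 / 8, 9, 1 / 20, by norm_num, h0.le, ?_, by norm_num, by norm_num, ?_,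
      fun s s₀ hs hs₀ => ?_⟩
    · have := hfac 1 (by split_ifs <;> linarith)
      rwa [one_mul] at this
    -- the exponent is `3`, and `49 / 8 * √10 < 20 < exp 3`
    · have e : Real.exp (9 / 20 * 9 - 1 - 1 / 20) = Real.exp 1 ^ 3 := by
        rw [← Real.exp_nat_mul]; norm_num
      rw [e]
      have := pow_le_pow_left₀ (by norm_num) he.le 3
      norm_num at this
      linarith
    · obtain ⟨N, a, z₁, z₂, zS, W, h⟩ := exists_tuned_direct h0 hκ hκ1 h8 hs hs₀
      exact ⟨N, a, δ, z₁, z₂, zS, W, h⟩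
  · rcases le_or_gt κ (19 * δ) with h19 | h19
    · refine ⟨Real.sqrt 2 * δ, 27, 12.2, 1 / 25, by norm_num, by positivity, hfac _ ?_, by norm_num,
        by norm_num, ?_, fun s s₀ hs hs₀ => ?_⟩
      · rw [if_pos (show 8 * δ < 1 by linarith)]; split_ifs <;> linarith
      -- the exponent is `4.45`
      · have e : Real.exp (9 / 20 * 12.2 - 1 - 1 / 25) = Real.exp 1 ^ 4 * Real.exp 0.45 := by
          rw [← Real.exp_nat_mul, ← Real.exp_add]; norm_num
        rw [e]
        have h4 := pow_le_pow_left₀ (by norm_num) he.le 4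
        have h5 := hexp 0.45 (by norm_num)
        calc 27 * Real.sqrt 10 ≤ 27 * 3.1623 := by gcongr
          _ ≤ 2.7182818283 ^ 4 * (1 + 0.45 + 0.45 ^ 2 / 2 + 0.45 ^ 3 / 6 + 0.45 ^ 4 / 24) := by
            norm_num
          _ ≤ _ := by gcongr
      · obtain ⟨N, a, z₁, z₂, zS, W, h⟩ := exists_tuned_two h0 h8 hκ1 h19 hs hs₀
        exact ⟨N, a, δ, z₁, z₂, zS, W, h⟩
    · refine ⟨5 * δ, 2, 6.4, 3 / 100, by norm_num, by positivity, hfac _ ?_, by norm_num,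
        by norm_num, ?_, fun s s₀ hs hs₀ => ?_⟩
      · rw [if_pos (h19.trans hκ1)]
      -- the exponent is `1.85`
      · have e : Real.exp (9 / 20 * 6.4 - 1 - 3 / 100) = Real.exp 1 * Real.exp 0.85 := by
          rw [← Real.exp_add]; norm_num
        rw [e]
        have h5 := hexp 0.85 (by norm_num)
        calc 2 * Real.sqrt 10 ≤ 2 * 3.1623 := by gcongr
          _ ≤ 2.7182818283 * (1 + 0.85 + 0.85 ^ 2 / 2 + 0.85 ^ 3 / 6 + 0.85 ^ 4 / 24) := by
            norm_num
          _ ≤ _ := by gcongr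
      · obtain ⟨N, a, z₁, z₂, zS, W, h⟩ := exists_tuned_blocks h0 h19 hκ1 hs hs₀
        exact ⟨N, a, Real.sqrt 10 * δ, z₁, z₂, zS, W, h⟩

end rate

/-! ### The two-stage estimator on a good noise realization -/

section good

variable {n d m : ℕ} {X : Matrix (Fin n) (Idx d m) ℝ} {β : Idx d m → ℝ} {κ δ σ : ℝ} {s s₀ : ℕ}

/-- The noise realizations on which the two-stage estimator is close to the oracle: bounds for the
noise correlations on the test sets of the step lemma, for the error of the oracle, and for the
correlations of the design with the oracle residual. -/
structure GoodNoise (X : Matrix (Fin n) (Idx d m) ℝ) (β : Idx d m → ℝ) (κ δ σ : ℝ)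
    (s s₀ N a : ℕ) (z₁ z₂ zS : ℝ) (ξ : Fin n → ℝ) : Prop where
  max : ∀ p, |noiseVec X σ ξ p| ≤ Real.sqrt (10 * σ ^ 2 * Real.log ((d : ℝ) * m) / n)
  support : l2 (res (supp β) (noiseVec X σ ξ)) ≤ zS * lamInf κ δ σ n d m s s₀
  inner : ∀ T, IsInner (supp β) (groupSupp β) N T →
    l2 (res T (noiseVec X σ ξ)) ≤ z₁ * lamInf κ δ σ n d m s s₀
  outer : ∀ T, IsOuter (groupSupp β) a (a * s₀) T →
    l2 (res T (noiseVec X σ ξ)) ≤ z₂ * lamInf κ δ σ n d m s s₀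
  oracle : ∀ p ∈ supp β, |(oracleVec X (response X β σ ξ) (supp β) - β) p| ≤
    3 / 10 * muThr κ δ σ n d m s s₀
  resid : ∀ p : Idx d m, p.2 ∈ groupSupp β →
    |residVec X (supp β) σ ξ p| ≤ residConst δ * muThr κ δ σ n d m s s₀
  resid_group : ∀ (j : Fin m) (T : Finset (Fin d)), T.card ≤ s₀ →
    ∑ i ∈ T, residVec X (supp β) σ ξ (i, j) ^ 2 ≤
      residConst δ ^ 2 * (s₀ * muThr κ δ σ n d m s s₀ ^ 2)

lemma Conditions.vecRIP (h : Conditions X β κ δ σ s s₀) :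
    VecRIP X (s + 2 * numExtra κ δ s) (s * s₀ + 4 * (numExtra κ δ s * s₀)) δ := by
  have hs : (0 : ℝ) < s := by exact_mod_cast h.one_le_s
  have e : Around κ δ s * s = numExtra κ δ s := by
    rw [Around, numExtra, div_mul_cancel₀ _ hs.ne']
  have hA : 0 ≤ Around κ δ s := by unfold Around; positivity
  refine h.dsrip.vecRIP (le_of_eq ?_) (le_of_eq ?_)
  · push_cast; rw [← e]; ring
  · have : 1 + 2 * Around κ δ s ≠ 0 := by positivity
    push_cast; rw [← e]; field_simp

lemma Conditions.card_groupSupp_le (h : Conditions X β κ δ σ s s₀) :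
    (groupSupp β).card ≤ s := by exact_mod_cast h.sparse.1

lemma Conditions.card_supp_le (h : Conditions X β κ δ σ s s₀) : (supp β).card ≤ s * s₀ := by
  exact_mod_cast h.sparse.2

lemma Clam_eq (hκ : δ < κ) :
    Clam κ δ = Real.sqrt 40 * (1 + Real.sqrt 3 * (δ / (κ - δ))) := by
  have : κ - δ ≠ 0 := by linarith
  rw [Clam]; congr 1; field_simp; ring

lemma Clam_pos (h0 : 0 < δ) (hκ : δ < κ) : 0 < Clam κ δ := by
  have : 0 < κ - δ := by linarith
  rw [Clam_eq hκ]; positivity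

lemma Conditions.Delta_ge_one (h : Conditions X β κ δ σ s s₀) : 1 ≤ Delta d m s s₀ :=
  one_le_Delta h.one_le_s h.s_le h.one_le_s₀ h.s₀_le

lemma Conditions.lamInf_pos (h : Conditions X β κ δ σ s s₀) (hn : 0 < n) (h0 : 0 < δ) (hκ : δ < κ)
    (hσ : 0 < σ) : 0 < lamInf κ δ σ n d m s s₀ := by
  have h1 := h.Delta_ge_one
  have h2 := Clam_pos h0 hκ
  have h3 : (0 : ℝ) < n := by exact_mod_cast hn
  have : 0 < Delta d m s s₀ / n := div_pos (by linarith) h3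
  unfold lamInf; positivity

/-- The logarithmic factor of `μ²`. -/
def muLog (d m s s₀ : ℕ) : ℝ :=
  Real.log (Real.exp 1 * m) / s₀ + Real.log (Real.exp 1 * s * d)

lemma Conditions.Delta_le_muLog (h : Conditions X β κ δ σ s s₀) :
    Delta d m s s₀ ≤ muLog d m s s₀ := by
  have hs : (1 : ℝ) ≤ s := by exact_mod_cast h.one_le_s
  have hs₀ : (1 : ℝ) ≤ s₀ := by exact_mod_cast h.one_le_s₀
  have hm : (0 : ℝ) < m := by exact_mod_cast h.one_le_s.trans h.s_le
  have hd : (0 : ℝ) < d := by exact_mod_cast h.one_le_s₀.trans h.s₀_le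
  rw [Delta, muLog, one_div, inv_mul_eq_div]
  gcongr
  · exact div_le_self (by positivity) hs
  · rw [div_le_iff₀ (by positivity)]
    calc Real.exp 1 * d = Real.exp 1 * 1 * d * 1 := by ring
      _ ≤ _ := by gcongr

lemma Conditions.lamInf_le_muThr (h : Conditions X β κ δ σ s s₀) (h0 : 0 < δ) (hκ : δ < κ)
    (hσ : 0 < σ) : lamInf κ δ σ n d m s s₀ ≤ muThr κ δ σ n d m s s₀ := by
  have h1 := Clam_pos h0 hκ
  have h2 : Clam κ δ ≤ κ * Clam κ δ / δ := by
    rw [le_div_iff₀ h0, mul_comm]; exact mul_le_mul_of_nonneg_right hκ.le h1.le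
  have e : σ ^ 2 / n * (Real.log (Real.exp 1 * m) / s₀ + Real.log (Real.exp 1 * s * d)) =
      σ ^ 2 * (muLog d m s s₀ / n) := by rw [muLog]; ring
  rw [lamInf, muThr, e, Real.sqrt_mul (sq_nonneg σ), Real.sqrt_sq hσ.le, mul_assoc]
  refine mul_le_mul (h2.trans (le_max_left _ _)) ?_ (by positivity)
    (le_max_of_le_left (h1.le.trans h2))
  refine mul_le_mul_of_nonneg_left (Real.sqrt_le_sqrt ?_) hσ.le
  exact div_le_div_of_nonneg_right h.Delta_le_muLog (Nat.cast_nonneg _)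

/-- The initial threshold exceeds the final one because of the signal strength. -/
lemma muThr_le_lamZero (h : Conditions X β κ δ σ s s₀) (hn : 0 < n) (h0 : 0 < δ) (hκ : δ < κ)
    (hκ1 : κ < 1) (hne : (supp β).Nonempty) {Y : Fin n → ℝ} {Ξ : Idx d m → ℝ}
    (hμ : 0 ≤ muThr κ δ σ n d m s s₀)
    (hΞ : (1 / (n : ℝ)) • (Xᵀ *ᵥ (Y - X *ᵥ β)) = Ξ)
    (hmax : ∀ p, |Ξ p| ≤ Real.sqrt (10 * σ ^ 2 * Real.log ((d : ℝ) * m) / n)) :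
    muThr κ δ σ n d m s s₀ ≤ lamZero X Y κ σ := by
  have hd : 0 < 1 - δ := by linarith
  have h1 := l2_le_lamZero h.vecRIP hn h0.le (h0.trans hκ)
    (h.card_groupSupp_le.trans (Nat.le_add_right _ _)) (h.card_supp_le.trans (Nat.le_add_right _ _))
    hΞ hmax
  have hc : (0 : ℝ) < (supp β).card := by exact_mod_cast hne.card_pos
  set μ := muThr κ δ σ n d m s s₀
  set L := lamZero X Y κ σ
  have h2 : Real.sqrt (supp β).card * (2 * μ) ≤ (1 - δ) * l2 β := by
    have h3 : ((supp β).card : ℝ) * ((2 + Real.sqrt 6 * δ / (1 - δ)) * μ) ^ 2 ≤ l2 β ^ 2 := by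
      rw [l2_sq, ← nsmul_eq_mul]
      refine (Finset.card_nsmul_le_sum (supp β) (fun p => β p ^ 2) _ fun p hp => ?_).trans
        (Finset.sum_le_sum_of_subset_of_nonneg (Finset.subset_univ _) fun _ _ _ => sq_nonneg _)
      rw [← sq_abs (β p)]
      exact pow_le_pow_left₀ (by positivity) (h.elementSignal p hp) 2
    have h4 : Real.sqrt (supp β).card * ((2 + Real.sqrt 6 * δ / (1 - δ)) * μ) ≤ l2 β := by
      refine abs_le_of_sq_le_sq' ?_ (l2_nonneg _) |>.2
      rwa [mul_pow, Real.sq_sqrt hc.le]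
    have h6 : (2 : ℝ) ≤ Real.sqrt 6 := Real.le_sqrt_of_sq_le (by norm_num)
    have h5 : 2 ≤ (1 - δ) * (2 + Real.sqrt 6 * δ / (1 - δ)) := by
      have : (1 - δ) * (2 + Real.sqrt 6 * δ / (1 - δ)) = 2 * (1 - δ) + Real.sqrt 6 * δ := by
        field_simp
      rw [this]; nlinarith
    calc Real.sqrt (supp β).card * (2 * μ)
        ≤ Real.sqrt (supp β).card * ((1 - δ) * (2 + Real.sqrt 6 * δ / (1 - δ)) * μ) := by gcongr
      _ = (1 - δ) * (Real.sqrt (supp β).card * ((2 + Real.sqrt 6 * δ / (1 - δ)) * μ)) := by ring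
      _ ≤ _ := mul_le_mul_of_nonneg_left h4 hd.le
  have h3 : 2 * μ ≤ Real.sqrt 2 * κ * L :=
    le_of_mul_le_mul_left (h2.trans h1) (Real.sqrt_pos.2 hc)
  have h4 : 0 < Real.sqrt 2 * κ := mul_pos (by positivity) (h0.trans hκ)
  have h5 : Real.sqrt 2 * κ ≤ 2 := by
    have := sqrt_two_le
    nlinarith
  by_contra hlt
  rw [not_le] at hlt
  have h6 : Real.sqrt 2 * κ * L < Real.sqrt 2 * κ * μ := mul_lt_mul_of_pos_left hlt h4
  nlinarith

variable {N a : ℕ} {δW C y δT z₁ z₂ zS W : ℝ} {ξ : Fin n → ℝ}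

lemma GoodNoise.stepData (hg : GoodNoise X β κ δ σ s s₀ N a z₁ z₂ zS ξ)
    (h : Conditions X β κ δ σ s s₀) (ht : Tuned κ δ δW C y s s₀ N a δT z₁ z₂ zS W) (hn : 0 < n)
    (h0 : 0 < δ) (hκ : δ < κ) (hσ : 0 < σ) (hδW : 0 ≤ δW) :
    StepData X β (noiseVec X σ ξ) s s₀ N a (lamInf κ δ σ n d m s s₀) z₁ z₂ zS δT δW κ W where
  lam_pos := h.lamInf_pos hn h0 hκ hσ
  card_supp := h.card_supp_le
  card_groups := h.card_groupSupp_le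
  gapBound := by
    rw [groupSupp_eq]
    exact ht.gapBound h.vecRIP hn h.card_supp_le (by rw [← groupSupp_eq]; exact h.card_groupSupp_le)
  noise := ⟨hg.support, hg.inner, hg.outer⟩
  δT_nonneg := h0.le.trans ht.δT_ge
  δW_nonneg := hδW
  z₁_nonneg := ht.z₁_nonneg
  z₂_nonneg := ht.z₂_nonneg
  zS_nonneg := ht.zS_nonneg
  W_nonneg := ht.W_nonneg
  inner := ht.inner
  outer := ht.outer
  whole := ht.whole

lemma Conditions.isUnit_det (h : Conditions X β κ δ σ s s₀) (hn : 0 < n) (h1 : δ < 1) :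
    IsUnit ((subMatrix X (supp β))ᵀ * subMatrix X (supp β)).det :=
  isUnit_det_gram (mul_pos (by exact_mod_cast hn) (by linarith : 0 < 1 - δ)) fun u =>
    (h.vecRIP.subMatrix_bounds
      (by rw [← groupSupp_eq]; exact h.card_groupSupp_le.trans (Nat.le_add_right _ _))
      (h.card_supp_le.trans (Nat.le_add_right _ _)) u).1

/-- The oracle estimator satisfies the hypotheses under which the second stage contracts to it: the
signal exceeds the threshold by the factor `c = 2 + √6 δ / (1 - δ)`, of which the error of the
oracle takes at most `3 / 10`. -/
lemma GoodNoise.fixedPoint (hg : GoodNoise X β κ δ σ s s₀ N a z₁ z₂ zS ξ)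
    (h : Conditions X β κ δ σ s s₀) (hn : 0 < n) (h0 : 0 < δ) (h1 : δ < 1)
    (hμ : 0 ≤ muThr κ δ σ n d m s s₀) :
    FixedPoint (oracleVec X (response X β σ ξ) (supp β)) (residVec X (supp β) σ ξ) (supp β)
      (groupSupp β) s₀ (muThr κ δ σ n d m s s₀) (signalConst δ) (residConst δ) where
  off p hp := by simp [oracleVec, hp]
  resid p hp := residVec_eq_zero (h.isUnit_det hn h1) ξ hp
  groups p hp := by rw [groupSupp_eq]; exact Finset.mem_image_of_mem _ hp
  entry p hp := by
    have h2 := h.elementSignal p hp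
    have h3 := hg.oracle p hp
    have h4 := abs_sub_abs_le_abs_sub (β p) (oracleVec X (response X β σ ξ) (supp β) p)
    rw [abs_sub_comm] at h4
    rw [Pi.sub_apply] at h3
    rw [signalConst]
    rw [mul_div_assoc] at h2
    linarith
  group j hj := by
    set μ := muThr κ δ σ n d m s s₀
    set c := 2 + Real.sqrt 6 * δ / (1 - δ) with hc
    have hd : 0 < 1 - δ := by linarith
    have hc0 : 0 < c := by positivity
    have hQ : signalConst δ = c - 3 / 10 := by rw [signalConst, hc, mul_div_assoc]; ring
    have hQ0 := le_signalConst h0 h1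
    -- every entry of the oracle keeps the fraction `(c - 3 / 10) / c` of the entry of `β`, hence so
    -- does the group norm
    have h2 : signalConst δ ^ 2 * ∑ i, β (i, j) ^ 2 ≤
        c ^ 2 * ∑ i, oracleVec X (response X β σ ξ) (supp β) (i, j) ^ 2 := by
      rw [Finset.mul_sum, Finset.mul_sum]
      refine Finset.sum_le_sum fun i _ => ?_
      by_cases hp : (i, j) ∈ supp β
      · have h3 := h.elementSignal _ hp
        have h4 := hg.oracle _ hp
        have h5 := abs_sub_abs_le_abs_sub (β (i, j))
          (oracleVec X (response X β σ ξ) (supp β) (i, j))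
        rw [abs_sub_comm] at h5
        rw [Pi.sub_apply] at h4
        have h6 : signalConst δ * |β (i, j)| ≤
            c * |oracleVec X (response X β σ ξ) (supp β) (i, j)| := by
          rw [hQ]
          have h7 := mul_le_mul_of_nonneg_left (h5.trans h4) hc0.le
          linarith
        rw [← mul_pow, ← mul_pow, ← sq_abs, ← sq_abs (c * _), abs_mul, abs_mul,
          abs_of_pos hc0, abs_of_pos (by linarith : 0 < signalConst δ)]
        exact pow_le_pow_left₀ (by positivity) h6 2
      · rw [supp_off hp, zero_pow two_ne_zero, mul_zero]; positivity
    have h3 := pow_le_pow_left₀ (by positivity) (h.groupSignal j hj) 2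
    rw [Real.sq_sqrt (Finset.sum_nonneg fun _ _ => sq_nonneg _), mul_pow, mul_pow,
      Real.sq_sqrt (Nat.cast_nonneg _)] at h3
    refine le_of_mul_le_mul_left ?_ (pow_pos hc0 2)
    calc c ^ 2 * (signalConst δ ^ 2 * (s₀ * μ ^ 2))
        = signalConst δ ^ 2 * (c ^ 2 * s₀ * μ ^ 2) := by ring
      _ ≤ signalConst δ ^ 2 * ∑ i, β (i, j) ^ 2 := mul_le_mul_of_nonneg_left h3 (sq_nonneg _)
      _ ≤ _ := h2
  noise_inner p _ hp := hg.resid p hp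
  noise_outer j _ T hT := hg.resid_group j T hT

/-- The size of the constant `W` in the step lemma. -/
lemma Tuned.W_le (ht : Tuned κ δ δW C y s s₀ N a δT z₁ z₂ zS W) (h0 : 0 < δ) (hs : 0 < s) :
    W ≤ Real.sqrt (5 + 4 * (Acst κ δ + 1)) / δ * Real.sqrt ((s : ℝ) * s₀) := by
  have hs' : (1 : ℝ) ≤ s := by exact_mod_cast hs
  have hA : 0 ≤ Acst κ δ := by unfold Acst; positivity
  have h1 : (numExtra κ δ s : ℝ) ≤ (Acst κ δ + 1) * s := by
    have := Nat.ceil_lt_add_one (show 0 ≤ Acst κ δ * s by positivity)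
    rw [numExtra]; nlinarith
  have h2 : (N : ℝ) + 1 ≤ (5 + 4 * (Acst κ δ + 1)) * (s * s₀) := by
    have h3 : ((N + 1 : ℕ) : ℝ) ≤ ((s * s₀ + 4 * (numExtra κ δ s * s₀) : ℕ) : ℝ) := by
      exact_mod_cast ht.inner_le
    push_cast at h3
    have h4 := mul_le_mul_of_nonneg_right h1 (Nat.cast_nonneg (α := ℝ) s₀)
    have h5 : (0 : ℝ) ≤ s * s₀ := by positivity
    linarith
  have h3 : δ * W ≤ Real.sqrt ((5 + 4 * (Acst κ δ + 1)) * (s * s₀)) := by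
    calc δ * W ≤ δT * W := mul_le_mul_of_nonneg_right ht.δT_ge ht.W_nonneg
      _ ≤ Real.sqrt ((N : ℝ) + 1) := by linarith [ht.inner, ht.z₁_nonneg]
      _ ≤ _ := Real.sqrt_le_sqrt h2
  rw [Real.sqrt_mul (by positivity)] at h3
  rw [div_mul_eq_mul_div, le_div_iff₀ h0, mul_comm]
  exact h3

/-- The constant in the bound for the distance of the first-stage output from the oracle. -/
def stageConst (κ δ σ : ℝ) : ℝ :=
  2 / (1 - δ) * (Real.sqrt (5 + 4 * (Acst κ δ + 1)) / δ) * (Clam κ δ * σ)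

/-- On good noise realizations the second-stage iterates converge geometrically to the oracle. -/
theorem GoodNoise.l2_twoStage_sub_le (hg : GoodNoise X β κ δ σ s s₀ N a z₁ z₂ zS ξ)
    (h : Conditions X β κ δ σ s s₀) (ht : Tuned κ δ δW C y s s₀ N a δT z₁ z₂ zS W) (hn : 0 < n)
    (h0 : 0 < δ) (hκ : δ < κ) (hκ1 : κ < 1) (hσ : 0 < σ) (hδW : 0 ≤ δW)
    (hrate : lossConst δ * δW ≤ rate δ) (hne : (supp β).Nonempty) (t : ℕ) :
    l2 (twoStage X (response X β σ ξ) κ δ σ s s₀ t -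
        oracleVec X (response X β σ ξ) (supp β)) ≤
      rate δ ^ t * (stageConst κ δ σ * Real.sqrt ((s : ℝ) * s₀ * Delta d m s s₀ / n)) := by
  have h1 : δ < 1 := hκ.trans hκ1
  have hd : 0 < 1 - δ := by linarith
  have hκ0 : 0 < κ := h0.trans hκ
  have D := hg.stepData h ht hn h0 hκ hσ hδW
  have hΞ := noiseVec_eq (X := X) (β := β) (σ := σ) ξ
  have hlamμ := h.lamInf_le_muThr (n := n) h0 hκ hσ
  have hlam := h.lamInf_pos hn h0 hκ hσ
  have hμ : 0 ≤ muThr κ δ σ n d m s s₀ := hlam.le.trans hlamμ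
  have hstart := hlamμ.trans (muThr_le_lamZero h hn h0 hκ hκ1 hne hμ hΞ hg.max)
  have hL0 : 0 < lamZero X (response X β σ ξ) κ σ := hlam.trans_le hstart
  have hinit : l2 β ≤ W * lamZero X (response X β σ ξ) κ σ := by
    have h2 := l2_le_lamZero h.vecRIP hn h0.le hκ0
      (h.card_groupSupp_le.trans (Nat.le_add_right _ _))
      (h.card_supp_le.trans (Nat.le_add_right _ _)) hΞ hg.max
    refine le_of_mul_le_mul_left ?_ hd
    have h3 : Real.sqrt (supp β).card ≤ Real.sqrt ((s : ℝ) * s₀) :=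
      Real.sqrt_le_sqrt (by exact_mod_cast h.card_supp_le)
    calc (1 - δ) * l2 β
        ≤ Real.sqrt ((s : ℝ) * s₀) * (Real.sqrt 2 * κ * lamZero X (response X β σ ξ) κ σ) :=
          h2.trans (mul_le_mul_of_nonneg_right h3 (by positivity))
      _ = (Real.sqrt 2 * κ * Real.sqrt ((s : ℝ) * s₀)) * lamZero X (response X β σ ξ) κ σ := by ring
      _ ≤ ((1 - δ) * W) * lamZero X (response X β σ ξ) κ σ :=
          mul_le_mul_of_nonneg_right ht.init hL0.le
      _ = _ := by ring
  have hfirst := D.near_dsiht hκ0 hκ1 hΞ hstart hinit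
  have hfirst' := hfirst.mono (r' := W * muThr κ δ σ n d m s s₀) (by
    have h2 := mul_le_mul_of_nonneg_left hlamμ D.W_nonneg
    have h3 := mul_le_of_le_one_left (mul_nonneg D.W_nonneg hlam.le) hκ1.le
    linarith)
  have hΞb : (1 / (n : ℝ)) • (Xᵀ *ᵥ (response X β σ ξ -
      X *ᵥ oracleVec X (response X β σ ξ) (supp β))) = residVec X (supp β) σ ξ := by
    rw [response_sub_oracleVec (h.isUnit_det hn h1), residVec]
  have hcon := (D.secondStage_contract hκ1 hΞ hΞb (hg.fixedPoint h hn h0 h1 hμ) h.one_le_s₀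
    (by linarith [le_signalConst h0 h1]) residConst_pos.le
    (by linarith [residConst_le (δ := δ)])
    (one_le_lossConst_mul h0 h1) (signalConst_le_lossConst h0 h1) hlamμ hfirst' t).2
  have horacle := l2_oracleVec_sub_le (σ := σ) hn h1 (fun u => (h.vecRIP.subMatrix_bounds
      (by rw [← groupSupp_eq]; exact h.card_groupSupp_le.trans (Nat.le_add_right _ _))
      (h.card_supp_le.trans (Nat.le_add_right _ _)) u).1) ξ
  have hzS : zS ≤ W := by
    have h2 := ht.whole
    have h3 : zS ≤ Real.sqrt ((Real.sqrt 2 * Real.sqrt ((s : ℝ) * s₀) + zS) ^ 2 +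
        z₁ ^ 2 + z₂ ^ 2) := by
      refine Real.le_sqrt_of_sq_le ?_
      have := pow_le_pow_left₀ ht.zS_nonneg (show zS ≤ Real.sqrt 2 * Real.sqrt ((s : ℝ) * s₀) + zS
        from le_add_of_nonneg_left (by positivity)) 2
      have h5 := sq_nonneg z₁
      have h6 := sq_nonneg z₂
      linarith
    have h4 := mul_nonneg hδW ht.W_nonneg
    have h5 := mul_le_of_le_one_left ht.W_nonneg hκ1.le
    linarith
  have hdist : l2 (dsiht X (response X β σ ξ) κ σ (lamInf κ δ σ n d m s s₀) s₀ -
      oracleVec X (response X β σ ξ) (supp β)) ≤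
      2 / (1 - δ) * (W * lamInf κ δ σ n d m s s₀) := by
    have h2 := l2_sub_le (dsiht X (response X β σ ξ) κ σ (lamInf κ δ σ n d m s s₀) s₀ - β)
      (oracleVec X (response X β σ ξ) (supp β) - β)
    rw [sub_sub_sub_cancel_right] at h2
    have h3 : l2 (oracleVec X (response X β σ ξ) (supp β) - β) ≤
        1 / (1 - δ) * (W * lamInf κ δ σ n d m s s₀) := by
      rw [div_mul_eq_mul_div, one_mul, le_div_iff₀ hd, mul_comm]
      exact horacle.trans (hg.support.trans (mul_le_mul_of_nonneg_right hzS hlam.le))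
    have hWl := mul_nonneg ht.W_nonneg hlam.le
    have h4 : κ * W * lamInf κ δ σ n d m s s₀ ≤ 1 / (1 - δ) * (W * lamInf κ δ σ n d m s s₀) := by
      rw [mul_assoc]
      refine mul_le_mul_of_nonneg_right (hκ1.le.trans ?_) hWl
      rw [le_div_iff₀ hd]; linarith
    calc _ ≤ κ * W * lamInf κ δ σ n d m s s₀ + 1 / (1 - δ) * (W * lamInf κ δ σ n d m s s₀) :=
          h2.trans (add_le_add hfirst.2 h3)
      _ ≤ 1 / (1 - δ) * (W * lamInf κ δ σ n d m s s₀) +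
          1 / (1 - δ) * (W * lamInf κ δ σ n d m s s₀) := by linarith
      _ = _ := by ring
  have hΓ := lossConst_pos h0 h1
  rw [twoStage]
  refine hcon.trans (mul_le_mul (pow_le_pow_left₀ (mul_nonneg hΓ.le hδW) hrate t)
    (hdist.trans ?_) (l2_nonneg _) (pow_nonneg (rate_pos h0 h1).le _))
  have hW := ht.W_le h0 h.one_le_s
  have e : Real.sqrt ((s : ℝ) * s₀ * Delta d m s s₀ / n) =
      Real.sqrt ((s : ℝ) * s₀) * Real.sqrt (Delta d m s s₀ / n) := by
    rw [← Real.sqrt_mul (by positivity)]; congr 1; ring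
  rw [stageConst, e, lamInf]
  have hC := Clam_pos h0 hκ
  calc 2 / (1 - δ) * (W * (Clam κ δ * σ * Real.sqrt (Delta d m s s₀ / n)))
      ≤ 2 / (1 - δ) * ((Real.sqrt (5 + 4 * (Acst κ δ + 1)) / δ * Real.sqrt ((s : ℝ) * s₀)) *
        (Clam κ δ * σ * Real.sqrt (Delta d m s s₀ / n))) := by gcongr
    _ = _ := by ring

end good

/-! ### Good noise has high probability -/

section goodProb

variable {n d m : ℕ} {X : Matrix (Fin n) (Idx d m) ℝ} {β : Idx d m → ℝ} {κ δ σ : ℝ} {s s₀ : ℕ}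

lemma lamInf_sq (hΔ : 0 ≤ Delta d m s s₀) (hκ : δ < κ) :
    lamInf κ δ σ n d m s s₀ ^ 2 =
      40 * (1 + Real.sqrt 3 * (δ / (κ - δ))) ^ 2 * σ ^ 2 * (Delta d m s s₀ / n) := by
  rw [lamInf, mul_pow, mul_pow, Real.sq_sqrt (by positivity), Clam_eq hκ, mul_pow,
    Real.sq_sqrt (by norm_num)]

/-- `λ_(∞)` is calibrated so that `proxyRatio` converts thresholds into variance proxies. -/
lemma proxyRatio_mul_lamInf_sq (hΔ : 0 ≤ Delta d m s s₀) (h0 : 0 < δ) (hκ : δ < κ) :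
    proxyRatio κ δ / 40 * lamInf κ δ σ n d m s s₀ ^ 2 =
      Delta d m s s₀ * (σ ^ 2 * (1 + δ) / n) := by
  have h1 : 0 < δ / (κ - δ) := div_pos h0 (by linarith)
  rw [lamInf_sq hΔ hκ, proxyRatio]
  have : 1 + Real.sqrt 3 * (δ / (κ - δ)) ≠ 0 := by positivity
  generalize 1 + Real.sqrt 3 * (δ / (κ - δ)) = r at *
  field_simp

lemma muLog_ge (hm : 0 < m) :
    Real.log (Real.exp 1 * s * d) ≤ muLog d m s s₀ := by
  have hm' : (1 : ℝ) ≤ m := by exact_mod_cast hm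
  have : 0 ≤ Real.log (Real.exp 1 * m) := Real.log_nonneg (by
    have := Real.add_one_le_exp 1; nlinarith)
  have h2 : 0 ≤ Real.log (Real.exp 1 * m) / s₀ := by positivity
  rw [muLog]; linarith

lemma le_muThr_sq (hL : 0 ≤ muLog d m s s₀) (h0 : 0 < δ) (h1 : δ < 1) :
    40 * (1 + 3 * (δ / (1 - δ)) ^ 2) * (σ ^ 2 / n * muLog d m s s₀) ≤
      muThr κ δ σ n d m s s₀ ^ 2 := by
  have hd : 0 < 1 - δ := by linarith
  have e : 40 * (1 + 3 * (δ / (1 - δ)) ^ 2) = 40 + 120 * δ ^ 2 / (1 - δ) ^ 2 := by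
    rw [div_pow]; ring
  have hB : 0 ≤ σ ^ 2 / n * muLog d m s s₀ := by positivity
  rw [e, muThr, mul_pow]
  change _ ≤ _ * Real.sqrt (σ ^ 2 / n * muLog d m s s₀) ^ 2
  rw [Real.sq_sqrt hB]
  refine mul_le_mul_of_nonneg_right ?_ hB
  have h2 := pow_le_pow_left₀ (Real.sqrt_nonneg _)
    (le_max_right (κ * Clam κ δ / δ) (Real.sqrt (40 + 120 * δ ^ 2 / (1 - δ) ^ 2))) 2
  rwa [Real.sq_sqrt (by positivity)] at h2

variable {Ω : Type*} [MeasurableSpace Ω] {P : Measure Ω} [IsProbabilityMeasure P]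
  {ξ : Fin n → Ω → ℝ} {N a : ℕ} {δW C y η δT z₁ z₂ zS W : ℝ}

lemma measure_not_goodNoise_le (hind : iIndepFun ξ P) (hsub : ∀ k, HasSubgaussianMGF (ξ k) 1 P)
    (h : Conditions X β κ δ σ s s₀) (ht : Tuned κ δ δW C y s s₀ N a δT z₁ z₂ zS W) (hn : 0 < n)
    (h0 : 0 < δ) (hκ : δ < κ) (hκ1 : κ < 1) (hσ : 0 < σ) (hC : 1 ≤ C)
    (hCy : C * Real.sqrt 10 ≤ Real.exp (9 / 20 * y - 1 - η)) :
    P {ω | ¬ GoodNoise X β κ δ σ s s₀ N a z₁ z₂ zS fun k => ξ k ω} ≤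
      ENNReal.ofReal (Real.sqrt 10 * Real.exp (-(5 / 4 * Real.log ((d : ℝ) * m)))) +
      ENNReal.ofReal (Real.exp (-(1 / 100 * ((s : ℝ) * s₀ * Delta d m s s₀)))) +
      ENNReal.ofReal (Real.exp (-(η * (((N : ℝ) + 1) * Delta d m s s₀)))) +
      ENNReal.ofReal (Real.exp (a * (Real.log 41 - 1 / 20 * (s₀ * Delta d m s s₀)))) +
      ENNReal.ofReal (Real.sqrt 10 * Real.exp (-(1 / 2 * Real.log (Real.exp 1 * s * d)))) +
      ENNReal.ofReal (Real.sqrt 10 * Real.exp (-(5 / 4 * Real.log (Real.exp 1 * s * d)))) +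
      ENNReal.ofReal (Real.exp (-(5 / 4 * Real.log m))) := by
  have h1 : δ < 1 := hκ.trans hκ1
  have hd1 : 0 < 1 - δ := by linarith
  have hn' : (0 : ℝ) < n := by exact_mod_cast hn
  have hs : 0 < s := h.one_le_s
  have hs₀ : 0 < s₀ := h.one_le_s₀
  have hs' : (1 : ℝ) ≤ s := by exact_mod_cast hs
  have hs₀' : (1 : ℝ) ≤ s₀ := by exact_mod_cast hs₀
  have hm : 0 < m := hs.trans_le h.s_le
  have hdpos : 0 < d := hs₀.trans_le h.s₀_le
  have hm' : (1 : ℝ) ≤ m := by exact_mod_cast hm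
  have hd' : (1 : ℝ) ≤ d := by exact_mod_cast hdpos
  have hΔ := h.Delta_ge_one
  have hX := h.vecRIP
  have hdet := h.isUnit_det hn h1
  set ρ := σ ^ 2 * (1 + δ) / n with hρdef
  have hρ : 0 < ρ := by positivity
  have hρ2 : ρ ≤ 2 * (σ ^ 2 / n) := by
    rw [hρdef, mul_div_assoc', mul_comm 2]
    gcongr; linarith
  set lam := lamInf κ δ σ n d m s s₀ with hlamdef
  have hlam : 0 < lam := h.lamInf_pos hn h0 hκ hσ
  have hcal : proxyRatio κ δ / 40 * lam ^ 2 = Delta d m s s₀ * ρ :=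
    proxyRatio_mul_lamInf_sq (by linarith) h0 hκ
  set μ := muThr κ δ σ n d m s s₀ with hμdef
  have hμ : 0 ≤ μ := hlam.le.trans (h.lamInf_le_muThr h0 hκ hσ)
  set l := Real.log (Real.exp 1 * s * d) with hl
  have hesd : 0 < Real.exp 1 * s * d := by positivity
  have hexpl : Real.exp l = Real.exp 1 * s * d := Real.exp_log hesd
  have hl1 : 1 ≤ l := by
    rw [hl, Real.le_log_iff_exp_le hesd]
    calc Real.exp 1 = Real.exp 1 * 1 * 1 := by ring
      _ ≤ _ := by gcongr
  have hlM : l ≤ muLog d m s s₀ := muLog_ge hm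
  have hμsq := le_muThr_sq (κ := κ) (σ := σ) (n := n) (hl1.trans hlM |>.trans' zero_le_one) h0 h1
  rw [← hμdef] at hμsq
  set v2 := (δ / (1 - δ)) ^ 2 with hv2
  have hv20 : 0 ≤ v2 := sq_nonneg _
  have hεsq : residConst δ ^ 2 * (1 + 3 * v2) = 1 / 4 := by
    rw [residConst_sq, ← hv2, div_mul_cancel₀]; positivity
  have hσn : 0 < σ ^ 2 / n := by positivity
  -- `ε² μ²` against the variance proxy
  have hεμ : 10 * (σ ^ 2 / n * muLog d m s s₀) ≤ (residConst δ * μ) ^ 2 := by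
    rw [mul_pow]
    calc 10 * (σ ^ 2 / n * muLog d m s s₀) = residConst δ ^ 2 * (1 + 3 * v2) *
          (40 * (σ ^ 2 / n * muLog d m s s₀)) := by rw [hεsq]; ring
      _ = residConst δ ^ 2 * (40 * (1 + 3 * v2) * (σ ^ 2 / n * muLog d m s s₀)) := by ring
      _ ≤ _ := mul_le_mul_of_nonneg_left hμsq (sq_nonneg _)
  have hone : ∀ T : Finset (Idx d m), (groups T).card ≤ 1 → T.card ≤ s₀ →
      (groups T).card ≤ s + 2 * numExtra κ δ s ∧
      T.card ≤ s * s₀ + 4 * (numExtra κ δ s * s₀) := fun T h2 h3 =>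
    ⟨h2.trans (hs.trans_le (Nat.le_add_right _ _)),
      (h3.trans (Nat.le_mul_of_pos_left _ hs)).trans (Nat.le_add_right _ _)⟩
  have hsing : ∀ p : Idx d m, (groups ({p} : Finset (Idx d m))).card ≤ s + 2 * numExtra κ δ s ∧
      ({p} : Finset (Idx d m)).card ≤ s * s₀ + 4 * (numExtra κ δ s * s₀) := fun p =>
    hone {p} (by simp [groups]) (by rw [Finset.card_singleton]; exact hs₀)
  have hSg : (groups (supp β)).card ≤ s + 2 * numExtra κ δ s := by
    rw [← groupSupp_eq]; exact h.card_groupSupp_le.trans (Nat.le_add_right _ _)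
  have hSk : (supp β).card ≤ s * s₀ + 4 * (numExtra κ δ s * s₀) :=
    h.card_supp_le.trans (Nat.le_add_right _ _)
  -- one event per clause of `GoodNoise`
  have b1 := measure_exists_abs_gt_le_exp (V := Finset.univ) (l := Real.log ((d : ℝ) * m))
    (η := 5 / 4) hind hsub hρ
    (fun p _ => hX.proxyBound_noise (σ := σ) hn (hsing p).1 (hsing p).2)
    (Real.sqrt_nonneg (10 * σ ^ 2 * Real.log ((d : ℝ) * m) / n))
    (by rw [Real.exp_log (by positivity), Finset.card_univ, Fintype.card_prod]; simp)
    (by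
      have hlog : 0 ≤ Real.log ((d : ℝ) * m) := Real.log_nonneg (by nlinarith)
      rw [Real.sq_sqrt (by positivity)]
      have := mul_le_mul_of_nonneg_left hρ2 hlog
      have e : 10 * σ ^ 2 * Real.log ((d : ℝ) * m) / n =
        10 * (σ ^ 2 / n * Real.log ((d : ℝ) * m)) := by ring
      rw [e]; linarith)
  have b2 := measure_support_gt_le (r := zS * lam) (R := (s : ℝ) * s₀) (Δ := Delta d m s s₀) hind
    hsub hρ (hX.proxyBound_noise (σ := σ) hn hSg hSk) (mul_nonneg ht.zS_nonneg hlam.le)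
    (by exact_mod_cast h.card_supp_le) hΔ (by
      have := mul_le_mul_of_nonneg_right ht.zS_sq (sq_nonneg lam)
      rw [mul_pow]
      refine le_trans (le_of_eq ?_) this
      linear_combination (-(13 / 10) * ((s : ℝ) * s₀)) * hcal)
  have b3 := measure_inner_gt_le (S := supp β) (G := groupSupp β) (N := N) (r := z₁ * lam) (y := y)
    (η := η) hind hsub hρ (fun T hT => hX.proxyBound_noise (σ := σ) hn
      ((Finset.card_le_card hT.groups_subset).trans
        (h.card_groupSupp_le.trans (Nat.le_add_right _ _)))
      (hT.1.trans ht.inner_le)) (mul_nonneg ht.z₁_nonneg hlam.le) h.card_groupSupp_le hs h.s_le hs₀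
    h.s₀_le hC ht.le_inner hCy (by
      have := mul_le_mul_of_nonneg_right ht.z₁_sq (sq_nonneg lam)
      rw [mul_pow]
      refine le_trans (le_of_eq ?_) this
      linear_combination (-y * ((N : ℝ) + 1)) * hcal)
  have b4 := measure_outer_gt_le (G := groupSupp β) (a := a) (C := 41) (r := z₂ * lam) hind hsub hρ
    (fun T hT => hX.proxyBound_noise (σ := σ) hn (hT.1.trans ht.groups_le)
      (hT.2.1.trans ht.outer_le)) (mul_nonneg ht.z₂_nonneg hlam.le) ht.a_pos hs h.s_le hs₀
    h.s₀_le (by norm_num) ht.le_groups (by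
      have := mul_le_mul_of_nonneg_right ht.z₂_sq (sq_nonneg lam)
      rw [mul_pow]
      refine le_trans (le_of_eq ?_) this
      linear_combination (-5 * ((a * s₀ : ℕ) : ℝ)) * hcal)
  have b5 := measure_exists_abs_gt_le_exp (V := supp β) (l := l) (η := 1 / 2) (r := 3 / 10 * μ) hind
    hsub (show 0 < σ ^ 2 / ((n : ℝ) * (1 - δ)) by positivity)
    (fun p _ => proxyBound_oracle (σ := σ) (T := {p}) (mul_pos hn' hd1)
      fun u => (hX.subMatrix_bounds hSg hSk u).1) (by positivity)
    (by
      rw [hexpl]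
      have h2 : ((supp β).card : ℝ) ≤ s * s₀ := by exact_mod_cast h.card_supp_le
      have h3 : (s₀ : ℝ) ≤ d := by exact_mod_cast h.s₀_le
      have h4 : (1 : ℝ) ≤ Real.exp 1 := Real.one_le_exp zero_le_one
      calc ((supp β).card : ℝ) ≤ 1 * s * d := by rw [one_mul]; exact h2.trans (by gcongr)
        _ ≤ _ := by gcongr)
    (by
      have hv : 1 / (1 - δ) = 1 + δ / (1 - δ) := by field_simp; ring
      have e : σ ^ 2 / ((n : ℝ) * (1 - δ)) = (1 + δ / (1 - δ)) * (σ ^ 2 / n) := by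
        rw [← hv]; field_simp
      have hvv : 1.5 * (1 + δ / (1 - δ)) ≤ 1.62 * (1 + 3 * v2) := by
        rw [hv2]; nlinarith [sq_nonneg (δ / (1 - δ) - 0.15432)]
      have h2 : l * (σ ^ 2 / n) ≤ σ ^ 2 / n * muLog d m s s₀ := by
        rw [mul_comm]; exact mul_le_mul_of_nonneg_left hlM hσn.le
      have h3 : 0 ≤ l * (σ ^ 2 / n) := by positivity
      rw [e, mul_pow]
      calc (1 + 1 / 2) * l * ((1 + δ / (1 - δ)) * (σ ^ 2 / n))
          = (1.5 * (1 + δ / (1 - δ))) * (l * (σ ^ 2 / n)) := by ring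
        _ ≤ (1.62 * (1 + 3 * v2)) * (σ ^ 2 / n * muLog d m s s₀) := by gcongr
        _ = 9 / 20 * (9 / 100) * (40 * (1 + 3 * v2) * (σ ^ 2 / n * muLog d m s s₀)) := by ring
        _ ≤ 9 / 20 * (9 / 100) * μ ^ 2 := by gcongr
        _ = _ := by ring)
  have b6 := measure_exists_abs_gt_le_exp
    (V := Finset.univ.filter fun p : Idx d m => p.2 ∈ groupSupp β) (l := l) (η := 5 / 4)
    (r := residConst δ * μ) hind hsub hρ
    (fun p _ => hX.proxyBound_resid (σ := σ) hn hdet (hsing p).1 (hsing p).2)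
    (mul_nonneg residConst_pos.le hμ)
    (by
      rw [hexpl, card_filter_groups]
      have h2 : ((groupSupp β).card : ℝ) ≤ s := by exact_mod_cast h.card_groupSupp_le
      have h4 : (1 : ℝ) ≤ Real.exp 1 := Real.one_le_exp zero_le_one
      push_cast
      calc (d : ℝ) * (groupSupp β).card ≤ d * s := by gcongr
        _ = 1 * s * d := by ring
        _ ≤ _ := by gcongr)
    (by
      have h2 : l * ρ ≤ 2 * (σ ^ 2 / n * muLog d m s s₀) := by
        calc l * ρ ≤ muLog d m s s₀ * (2 * (σ ^ 2 / n)) := by gcongr; linarith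
          _ = _ := by ring
      linarith)
  have b7 := measure_group_gt_le (s₀ := s₀) (l := l) (r := residConst δ * (Real.sqrt s₀ * μ)) hind
    hsub hρ (fun T h2 h3 => hX.proxyBound_resid (σ := σ) hn hdet (hone T h2 h3).1 (hone T h2 h3).2)
    (mul_nonneg residConst_pos.le (by positivity)) hm hs₀ h.s₀_le hl1
    (by
      refine Real.log_le_log (exp_one_mul_div_pos hdpos hs₀) ?_
      rw [div_le_iff₀ (by positivity)]
      calc Real.exp 1 * d = Real.exp 1 * 1 * d * 1 := by ring
        _ ≤ _ := by gcongr)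
    (by
      have e : Real.log (Real.exp 1 * m) + s₀ * l = s₀ * muLog d m s s₀ := by
        rw [muLog, ← hl]; field_simp
      have e2 : (residConst δ * (Real.sqrt s₀ * μ)) ^ 2 = s₀ * (residConst δ * μ) ^ 2 := by
        rw [mul_pow, mul_pow, mul_pow, Real.sq_sqrt (by positivity)]; ring
      rw [e, e2]
      have hM0 : 0 ≤ muLog d m s s₀ := by linarith
      have h2 : muLog d m s s₀ * ρ ≤ 2 * (σ ^ 2 / n * muLog d m s s₀) := by
        calc muLog d m s s₀ * ρ ≤ muLog d m s s₀ * (2 * (σ ^ 2 / n)) := by gcongr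
          _ = _ := by ring
      have h3 : 9 / 4 * (muLog d m s s₀ * ρ) ≤ 9 / 20 * (residConst δ * μ) ^ 2 := by linarith
      have h4 := mul_le_mul_of_nonneg_left h3 (by linarith : (0 : ℝ) ≤ s₀)
      linarith)
  refine le_trans (measure_mono ?_) ((measure_union_le _ _).trans (add_le_add
    ((measure_union_le _ _).trans (add_le_add ((measure_union_le _ _).trans (add_le_add
    ((measure_union_le _ _).trans (add_le_add ((measure_union_le _ _).trans (add_le_add
    ((measure_union_le _ _).trans (add_le_add b1 b2)) b3)) b4)) b5)) b6)) b7))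
  intro ω hω
  by_contra hc
  simp only [Set.mem_union, not_or] at hc
  obtain ⟨⟨⟨⟨⟨⟨c1, c2⟩, c3⟩, c4⟩, c5⟩, c6⟩, c7⟩ := hc
  refine hω ⟨fun p => ?_, ?_, fun T hT => ?_, fun T hT => ?_, fun p hp => ?_, fun p hp => ?_,
    fun j T hT => ?_⟩
  · rw [noiseVec_eq_mulVec]
    by_contra hlt; exact c1 ⟨p, Finset.mem_univ _, not_le.1 hlt⟩
  · rw [noiseVec_eq_mulVec]
    by_contra hlt; exact c2 (not_le.1 hlt)
  · rw [noiseVec_eq_mulVec]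
    by_contra hlt; exact c3 ⟨T, hT, not_le.1 hlt⟩
  · rw [noiseVec_eq_mulVec]
    by_contra hlt; exact c4 ⟨T, hT, not_le.1 hlt⟩
  · rw [oracleVec_sub_eq_mulVec hdet]
    by_contra hlt; exact c5 ⟨p, hp, not_le.1 hlt⟩
  · rw [residVec_eq_mulVec]
    by_contra hlt; exact c6 ⟨p, by simpa using hp, not_le.1 hlt⟩
  · rw [residVec_eq_mulVec]
    by_contra hlt
    refine c7 ⟨j, T, hT, ?_⟩
    rw [mul_pow, mul_pow, Real.sq_sqrt (by positivity)]
    exact not_le.1 hlt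

/-- A bound for the probability of bad noise in terms of `d` and `m` only. -/
def badBound (C η : ℝ) (d m : ℕ) : ℝ :=
  Real.sqrt 10 * Real.exp (-(5 / 4 * Real.log d)) + Real.exp (-(1 / 100 * Real.log d)) +
    Real.exp (-(η / C * Real.log d)) + Real.exp (Real.log 41 - 1 / 20 * Real.log d) +
    Real.sqrt 10 * Real.exp (-(1 / 2 * Real.log d)) +
    Real.sqrt 10 * Real.exp (-(5 / 4 * Real.log d)) + Real.exp (-(5 / 4 * Real.log m))

lemma tendsto_badBound {C η : ℝ} (hC : 0 < C) (hη : 0 < η) {d m : ℕ → ℕ}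
    (hd : Tendsto d atTop atTop) (hm : Tendsto m atTop atTop) :
    Tendsto (fun n => badBound C η (d n) (m n)) atTop (𝓝 0) := by
  have hld : Tendsto (fun n => Real.log (d n)) atTop atTop :=
    Real.tendsto_log_atTop.comp (tendsto_natCast_atTop_atTop.comp hd)
  have hlm : Tendsto (fun n => Real.log (m n)) atTop atTop :=
    Real.tendsto_log_atTop.comp (tendsto_natCast_atTop_atTop.comp hm)
  have key : ∀ {u : ℕ → ℝ}, Tendsto u atTop atTop → ∀ c : ℝ, 0 < c →
      Tendsto (fun n => Real.exp (-(c * u n))) atTop (𝓝 0) := fun hu c hc =>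
    Real.tendsto_exp_neg_atTop_nhds_zero.comp (hu.const_mul_atTop hc)
  have h4 : Tendsto (fun n => Real.exp (Real.log 41 - 1 / 20 * Real.log (d n))) atTop (𝓝 0) := by
    refine Real.tendsto_exp_atBot.comp ?_
    simp only [sub_eq_add_neg]
    exact tendsto_atBot_add_const_left _ _ (tendsto_neg_atTop_atBot.comp
      (hld.const_mul_atTop (by norm_num)))
  have := ((((((key hld (5 / 4) (by norm_num)).const_mul (Real.sqrt 10)).add
    (key hld (1 / 100) (by norm_num))).add (key hld (η / C) (by positivity))).add h4).add
    ((key hld (1 / 2) (by norm_num)).const_mul (Real.sqrt 10))).add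
    ((key hld (5 / 4) (by norm_num)).const_mul (Real.sqrt 10)) |>.add
    (key hlm (5 / 4) (by norm_num))
  simpa only [badBound, mul_zero, add_zero] using this

lemma measure_not_goodNoise_le_badBound (hind : iIndepFun ξ P)
    (hsub : ∀ k, HasSubgaussianMGF (ξ k) 1 P)
    (h : Conditions X β κ δ σ s s₀) (ht : Tuned κ δ δW C y s s₀ N a δT z₁ z₂ zS W) (hn : 0 < n)
    (h0 : 0 < δ) (hκ : δ < κ) (hκ1 : κ < 1) (hσ : 0 < σ) (hC : 1 ≤ C) (hη : 0 < η)
    (hCy : C * Real.sqrt 10 ≤ Real.exp (9 / 20 * y - 1 - η))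
    (hlarge : Real.log 41 ≤ 1 / 20 * Real.log d) :
    P {ω | ¬ GoodNoise X β κ δ σ s s₀ N a z₁ z₂ zS fun k => ξ k ω} ≤
      ENNReal.ofReal (badBound C η d m) := by
  refine (measure_not_goodNoise_le hind hsub h ht hn h0 hκ hκ1 hσ hC hCy).trans ?_
  have hs' : (1 : ℝ) ≤ s := by exact_mod_cast h.one_le_s
  have hs₀' : (1 : ℝ) ≤ s₀ := by exact_mod_cast h.one_le_s₀
  have hm' : (1 : ℝ) ≤ m := by exact_mod_cast h.one_le_s.trans h.s_le
  have hd' : (1 : ℝ) ≤ d := by exact_mod_cast h.one_le_s₀.trans h.s₀_le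
  have ha' : (1 : ℝ) ≤ a := by exact_mod_cast ht.a_pos
  have hld : 0 ≤ Real.log d := Real.log_nonneg hd'
  have hΔ := h.Delta_ge_one
  have h1 := log_le_mul_Delta h.one_le_s h.s_le h.one_le_s₀ h.s₀_le
  have e1 : Real.log d ≤ Real.log ((d : ℝ) * m) :=
    Real.log_le_log (by linarith) (by nlinarith)
  have e2 : Real.log d ≤ (s : ℝ) * s₀ * Delta d m s s₀ := by
    rw [mul_assoc]; exact h1.trans (le_mul_of_one_le_left (by positivity) hs')
  have e3 : η / C * Real.log d ≤ η * (((N : ℝ) + 1) * Delta d m s s₀) := by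
    rw [div_mul_eq_mul_div, div_le_iff₀ (by linarith), mul_assoc]
    refine mul_le_mul_of_nonneg_left (e2.trans ?_) hη.le
    have := mul_le_mul_of_nonneg_right ht.le_inner (by linarith : 0 ≤ Delta d m s s₀)
    linarith
  have e4 : a * (Real.log 41 - 1 / 20 * (s₀ * Delta d m s s₀)) ≤
      Real.log 41 - 1 / 20 * Real.log d := by
    have h2 : Real.log 41 - 1 / 20 * (s₀ * Delta d m s s₀) ≤ Real.log 41 - 1 / 20 * Real.log d := by
      linarith
    nlinarith
  have e5 : Real.log d ≤ Real.log (Real.exp 1 * s * d) := by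
    refine Real.log_le_log (by linarith) ?_
    have : 1 ≤ Real.exp 1 * s := by nlinarith [Real.one_le_exp zero_le_one]
    nlinarith
  rw [← ENNReal.ofReal_add (by positivity) (by positivity),
    ← ENNReal.ofReal_add (by positivity) (by positivity),
    ← ENNReal.ofReal_add (by positivity) (by positivity),
    ← ENNReal.ofReal_add (by positivity) (by positivity),
    ← ENNReal.ofReal_add (by positivity) (by positivity),
    ← ENNReal.ofReal_add (by positivity) (by positivity)]
  refine ENNReal.ofReal_le_ofReal ?_
  rw [badBound]
  gcongr

end goodProb

/-! ### Asymptotic normality from characteristic functions -/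

section levy

variable {K : ℕ}

lemma posSemidef_of_tendsto {ι : Type*} {l : Filter ι} [l.NeBot]
    {Γ : ι → Matrix (Fin K) (Fin K) ℝ} {V : Matrix (Fin K) (Fin K) ℝ}
    (hΓ : Tendsto Γ l (𝓝 V)) (hpsd : ∀ᶠ n in l, (Γ n).PosSemidef) : V.PosSemidef := by
  refine Matrix.PosSemidef.of_dotProduct_mulVec_nonneg ?_ fun x => ?_
  · have h1 : Tendsto (fun n => (Γ n)ᴴ) l (𝓝 Vᴴ) :=
      ((continuous_id.matrix_conjTranspose).tendsto V).comp hΓ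
    refine tendsto_nhds_unique (h1.congr' ?_) hΓ
    filter_upwards [hpsd] with n hn using hn.isHermitian
  · have hc : Continuous fun M : Matrix (Fin K) (Fin K) ℝ => star x ⬝ᵥ (M *ᵥ x) := by fun_prop
    refine ge_of_tendsto ((hc.tendsto V).comp hΓ) ?_
    filter_upwards [hpsd] with n hn using hn.dotProduct_mulVec_nonneg x

lemma tendsto_gaussian_of_charFun {Γ : ℕ → Matrix (Fin K) (Fin K) ℝ}
    {V : Matrix (Fin K) (Fin K) ℝ} (hΓ : Tendsto Γ atTop (𝓝 V))
    (hpsd : ∀ᶠ n in atTop, (Γ n).PosSemidef)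
    {ν : ℕ → ProbabilityMeasure (EuclideanSpace ℝ (Fin K))}
    (hν : ∀ u : EuclideanSpace ℝ (Fin K), Tendsto (fun n => charFun (ν n : Measure _) u -
      Complex.exp (-((u ⬝ᵥ (Γ n *ᵥ u) / 2 : ℝ) : ℂ))) atTop (𝓝 0)) :
    Tendsto ν atTop (𝓝 ⟨multivariateGaussian 0 V, inferInstance⟩) := by
  have hV := posSemidef_of_tendsto hΓ hpsd
  refine ProbabilityMeasure.tendsto_iff_tendsto_charFun.2 fun u => ?_
  have hc : Continuous fun M : Matrix (Fin K) (Fin K) ℝ =>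
      Complex.exp (-((u ⬝ᵥ (M *ᵥ u) / 2 : ℝ) : ℂ)) := by fun_prop
  have h := (hν u).add ((hc.tendsto V).comp hΓ)
  simp only [Function.comp_def, sub_add_cancel, zero_add] at h
  convert h using 2
  change charFun (multivariateGaussian 0 V) u = _
  rw [charFun_multivariateGaussian hV]
  simp

variable {Ω : ℕ → Type*} [∀ n, MeasurableSpace (Ω n)] {P : ∀ n, Measure (Ω n)}
  [∀ n, IsProbabilityMeasure (P n)]

lemma tendstoInDistribution_of_charFun {W : ∀ n, Ω n → EuclideanSpace ℝ (Fin K)}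
    (hW : ∀ n, AEMeasurable (W n) (P n)) {Γ : ℕ → Matrix (Fin K) (Fin K) ℝ}
    {V : Matrix (Fin K) (Fin K) ℝ} (hΓ : Tendsto Γ atTop (𝓝 V))
    (hpsd : ∀ᶠ n in atTop, (Γ n).PosSemidef)
    (hν : ∀ u : EuclideanSpace ℝ (Fin K), Tendsto (fun n => charFun ((P n).map (W n)) u -
      Complex.exp (-((u ⬝ᵥ (Γ n *ᵥ u) / 2 : ℝ) : ℂ))) atTop (𝓝 0)) :
    TendstoInDistribution W atTop
      (id : EuclideanSpace ℝ (Fin K) → EuclideanSpace ℝ (Fin K)) P (multivariateGaussian 0 V) where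
  forall_aemeasurable := hW
  tendsto := by
    have h := tendsto_gaussian_of_charFun hΓ hpsd
      (ν := fun n => ⟨(P n).map (W n), Measure.isProbabilityMeasure_map (hW n)⟩) hν
    simpa only [Measure.map_id] using h

/-- Bounded covariance matrices have convergent subsequences, along which both laws converge to the
same limit. -/
lemma mergesWithGaussian_of_charFun {W : ∀ n, Ω n → EuclideanSpace ℝ (Fin K)}
    (hW : ∀ n, AEMeasurable (W n) (P n)) {Γ : ℕ → Matrix (Fin K) (Fin K) ℝ} {L : ℝ}
    (hbdd : ∀ᶠ n in atTop, ∀ a b, |Γ n a b| ≤ L)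
    (hpsd : ∀ᶠ n in atTop, (Γ n).PosSemidef)
    (hν : ∀ u : EuclideanSpace ℝ (Fin K), Tendsto (fun n => charFun ((P n).map (W n)) u -
      Complex.exp (-((u ⬝ᵥ (Γ n *ᵥ u) / 2 : ℝ) : ℂ))) atTop (𝓝 0)) :
    MergesWithGaussian P W Γ := by
  refine ⟨hW, fun f => tendsto_of_subseq_tendsto fun ns hns => ?_⟩
  set s : Set (Fin K → Fin K → ℝ) := {M | ∀ a b, |M a b| ≤ L} with hs
  have hsb : Bornology.IsBounded s := by
    refine (Metric.isBounded_closedBall (x := (0 : Fin K → Fin K → ℝ)) (r := max L 0)).subset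
      fun M hM => ?_
    rw [mem_closedBall_zero_iff, pi_norm_le_iff_of_nonneg (le_max_right _ _)]
    intro a
    rw [pi_norm_le_iff_of_nonneg (le_max_right _ _)]
    exact fun b => (hM a b).trans (le_max_left _ _)
  obtain ⟨V, -, φ, hφ, hV⟩ := tendsto_subseq_of_frequently_bounded hsb
    (x := fun k => (Γ (ns k) : Fin K → Fin K → ℝ)) (hns.eventually hbdd).frequently
  refine ⟨φ, ?_⟩
  have hsub : Tendsto (fun k => ns (φ k)) atTop atTop := hns.comp hφ.tendsto_atTop
  have hV' : Tendsto (fun k => Γ (ns (φ k))) atTop (𝓝 (V : Matrix (Fin K) (Fin K) ℝ)) := hV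
  have hpsd' : ∀ᶠ k in atTop, (Γ (ns (φ k))).PosSemidef := hsub.eventually hpsd
  have h1 := tendsto_gaussian_of_charFun hV' hpsd'
    (ν := fun k => ⟨(P (ns (φ k))).map (W (ns (φ k))), Measure.isProbabilityMeasure_map (hW _)⟩)
    fun u => (hν u).comp hsub
  have h2 := tendsto_gaussian_of_charFun hV' hpsd'
    (ν := fun k => ⟨multivariateGaussian 0 (Γ (ns (φ k))), inferInstance⟩) fun u => by
      refine tendsto_const_nhds.congr' ?_
      filter_upwards [hpsd'] with k hk
      change 0 = charFun (multivariateGaussian 0 (Γ (ns (φ k)))) u - _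
      rw [charFun_multivariateGaussian hk]
      simp
  have h3 := (ProbabilityMeasure.tendsto_iff_forall_integral_tendsto.1 h1 f).sub
    (ProbabilityMeasure.tendsto_iff_forall_integral_tendsto.1 h2 f)
  rw [sub_self] at h3
  refine h3.congr fun k => ?_
  congr 1
  exact integral_map (hW _) f.continuous.measurable.aestronglyMeasurable

lemma charFun_map_mulVec {Ω : Type*} [MeasurableSpace Ω] {P : Measure Ω} {J : Type*} [Fintype J]
    {Z : Ω → J → ℝ} (A : Matrix (Fin K) J ℝ)
    (hZ : AEMeasurable (fun ω => (WithLp.toLp 2 (A *ᵥ Z ω) : EuclideanSpace ℝ (Fin K))) P)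
    (u : EuclideanSpace ℝ (Fin K)) :
    charFun (P.map fun ω => (WithLp.toLp 2 (A *ᵥ Z ω) : EuclideanSpace ℝ (Fin K))) u =
      ∫ ω, Complex.exp (((∑ q, (Aᵀ *ᵥ u) q * Z ω q : ℝ) : ℂ) * Complex.I) ∂P := by
  rw [charFun_apply, integral_map hZ (by fun_prop)]
  congr 1; funext ω
  congr 3
  have : (∑ q, (Aᵀ *ᵥ u) q * Z ω q) = (u : Fin K → ℝ) ⬝ᵥ (A *ᵥ Z ω) := by
    rw [Matrix.dotProduct_mulVec, Matrix.mulVec_transpose]; rfl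
  rw [this, EuclideanSpace.inner_eq_star_dotProduct]
  simp

/-- Reduction of asymptotic normality to linear functionals with bounded coefficients. -/
theorem asymptoticallyNormal_of_functionals {J : ℕ → Type} [∀ n, Fintype (J n)]
    {Z : ∀ n, Ω n → J n → ℝ} {G : ∀ n, Matrix (J n) (J n) ℝ} {v L L' : ℝ} (hv : 0 ≤ v)
    (hZ : ∀ n q, AEMeasurable (fun ω => Z n ω q) (P n))
    (hpsd : ∀ᶠ n in atTop, (G n).PosSemidef)
    (hle : ∀ᶠ n in atTop, ∀ w w' : J n → ℝ,
      |w ⬝ᵥ (G n *ᵥ w')| ≤ L * (l2 w * l2 w'))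
    (hge : ∀ᶠ n in atTop, ∀ w : J n → ℝ, ∑ q, w q ^ 2 ≤ L' * (w ⬝ᵥ (G n *ᵥ w)))
    (hL : 0 ≤ L) (hL' : 0 ≤ L')
    (hchar : ∀ w : ∀ n, J n → ℝ, (∃ B : ℝ, ∀ᶠ n in atTop, ∑ q, w n q ^ 2 ≤ B) →
      Tendsto (fun n => ∫ ω, Complex.exp (((∑ q, w n q * Z n ω q : ℝ) : ℂ) * Complex.I) ∂(P n) -
        Complex.exp (-((v * (w n ⬝ᵥ (G n *ᵥ w n)) / 2 : ℝ) : ℂ))) atTop (𝓝 0)) :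
    AsymptoticallyNormal P Z G v := by
  intro K A
  have hW : ∀ n, AEMeasurable
      (fun ω => (WithLp.toLp 2 (A n *ᵥ Z n ω) : EuclideanSpace ℝ (Fin K))) (P n) := by
    intro n
    have h1 : AEMeasurable (fun ω => A n *ᵥ Z n ω) (P n) := by
      refine aemeasurable_pi_lambda _ fun a => ?_
      simp only [Matrix.mulVec, dotProduct]
      exact Finset.aemeasurable_fun_sum _ fun q _ => (hZ n q).const_mul _
    exact (WithLp.measurable_toLp 2 (Fin K → ℝ)).comp_aemeasurable h1
  have hpsd' : ∀ᶠ n in atTop, (v • (A n * G n * (A n)ᵀ)).PosSemidef := by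
    filter_upwards [hpsd] with n hn
    have := hn.mul_mul_conjTranspose_same (A n)
    rw [Matrix.conjTranspose_eq_transpose_of_trivial] at this
    exact this.smul hv
  -- the characteristic functions, for coefficient matrices with eventually bounded rows
  have hcf : ∀ R : ℝ, (∀ᶠ n in atTop, ∀ a, ∑ q, A n a q ^ 2 ≤ R) →
      ∀ u : EuclideanSpace ℝ (Fin K), Tendsto (fun n => charFun ((P n).map
        fun ω => (WithLp.toLp 2 (A n *ᵥ Z n ω) : EuclideanSpace ℝ (Fin K))) u -
        Complex.exp (-((u ⬝ᵥ ((v • (A n * G n * (A n)ᵀ)) *ᵥ u) / 2 : ℝ) : ℂ))) atTop (𝓝 0) := by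
    intro R hR u
    have h1 := hchar (fun n => (A n)ᵀ *ᵥ u) ⟨(∑ a, u a ^ 2) * (K * R), by
      filter_upwards [hR] with n hn
      calc ∑ q, ((A n)ᵀ *ᵥ u) q ^ 2 ≤ ∑ q, (∑ a, u a ^ 2) * ∑ a, A n a q ^ 2 := by
            refine Finset.sum_le_sum fun q _ => ?_
            simp only [Matrix.mulVec, dotProduct, Matrix.transpose_apply]
            rw [mul_comm (∑ a, u a ^ 2)]
            exact Finset.sum_mul_sq_le_sq_mul_sq _ _ _
        _ = (∑ a, u a ^ 2) * ∑ a, ∑ q, A n a q ^ 2 := by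
            rw [← Finset.mul_sum, Finset.sum_comm]
        _ ≤ (∑ a, u a ^ 2) * (K * R) := by
            refine mul_le_mul_of_nonneg_left ?_ (Finset.sum_nonneg fun _ _ => sq_nonneg _)
            refine (Finset.sum_le_card_nsmul _ _ R fun a _ => hn a).trans ?_
            simp⟩
    refine h1.congr fun n => ?_
    rw [charFun_map_mulVec (A n) (hW n)]
    congr 5
    rw [Matrix.smul_mulVec, dotProduct_smul, smul_eq_mul, ← Matrix.mulVec_mulVec,
      ← Matrix.mulVec_mulVec, Matrix.dotProduct_mulVec (u : Fin K → ℝ) (A n),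
      ← Matrix.mulVec_transpose]
  refine ⟨fun ⟨R, hR⟩ => ?_, fun V hV => ?_⟩
  · refine mergesWithGaussian_of_charFun hW (L := v * (L * R)) ?_ hpsd'
      (hcf R (Eventually.of_forall fun n => hR n))
    filter_upwards [hle] with n hn
    intro a b
    have e : (A n * G n * (A n)ᵀ) a b = A n a ⬝ᵥ (G n *ᵥ A n b) := by
      rw [Matrix.mul_assoc, Matrix.mul_apply]
      rfl
    rw [Matrix.smul_apply, smul_eq_mul, e, abs_mul, abs_of_nonneg hv]
    refine mul_le_mul_of_nonneg_left ((hn _ _).trans (mul_le_mul_of_nonneg_left ?_ hL)) hv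
    have hR0 : 0 ≤ R := (Finset.sum_nonneg fun _ _ => sq_nonneg _).trans (hR n a)
    calc l2 (A n a) * l2 (A n b) ≤ Real.sqrt R * Real.sqrt R :=
          mul_le_mul (Real.sqrt_le_sqrt (hR n a)) (Real.sqrt_le_sqrt (hR n b)) (l2_nonneg _)
            (Real.sqrt_nonneg _)
      _ = R := Real.mul_self_sqrt hR0
  · refine tendstoInDistribution_of_charFun hW (hV.const_smul v) hpsd'
      (hcf (L' * (∑ a, |V a a| + 1)) ?_)
    -- convergent covariances have bounded diagonals, which bounds the rows of `A n` through `hge`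
    have hdiag : ∀ᶠ n in atTop, ∀ a, (A n * G n * (A n)ᵀ) a a ≤ |V a a| + 1 := by
      rw [eventually_all]
      intro a
      have h1 : Tendsto (fun n => (A n * G n * (A n)ᵀ) a a) atTop (𝓝 (V a a)) :=
        tendsto_pi_nhds.1 (tendsto_pi_nhds.1 hV a) a
      exact h1.eventually_le_const (lt_of_le_of_lt (le_abs_self _) (lt_add_one _))
    filter_upwards [hge, hdiag] with n h1 h2
    intro a
    refine (h1 (A n a)).trans (mul_le_mul_of_nonneg_left ?_ hL')
    have e : (A n * G n * (A n)ᵀ) a a = A n a ⬝ᵥ (G n *ᵥ A n a) := by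
      rw [Matrix.mul_assoc, Matrix.mul_apply]
      rfl
    rw [← e]
    refine (h2 a).trans (add_le_add_left ?_ _)
    exact Finset.single_le_sum (f := fun a => |V a a|) (fun _ _ => abs_nonneg _) (Finset.mem_univ a)

end levy

/-! ### A central limit theorem for linear forms in the noise -/

section noise

variable {Ω : Type*} [MeasurableSpace Ω] {P : Measure Ω}

theorem integrable_exp_abs_of_hasSubgaussianMGF {ξ : Ω → ℝ} (h : HasSubgaussianMGF ξ 1 P) :
    Integrable (fun ω => Real.exp (ξ ω) + Real.exp (-ξ ω)) P ∧
      ∫ ω, Real.exp (ξ ω) + Real.exp (-ξ ω) ∂P ≤ 4 := by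
  have i1 : Integrable (fun ω => Real.exp (ξ ω)) P := by simpa using h.integrable_exp_mul 1
  have i2 : Integrable (fun ω => Real.exp (-ξ ω)) P := by simpa using h.integrable_exp_mul (-1)
  refine ⟨i1.add i2, ?_⟩
  rw [integral_add i1 i2]
  have h1 : ∫ ω, Real.exp (ξ ω) ∂P ≤ Real.exp (1 / 2) := by simpa [mgf] using h.mgf_le 1
  have h2 : ∫ ω, Real.exp (-ξ ω) ∂P ≤ Real.exp (1 / 2) := by simpa [mgf] using h.mgf_le (-1)
  have h3 : Real.exp (1 / 2) ≤ 2 := by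
    have e : Real.exp (1 / 2) ^ 2 = Real.exp 1 := by rw [← Real.exp_nat_mul]; norm_num
    nlinarith [Real.exp_one_lt_d9, Real.exp_pos (1 / 2 : ℝ)]
  linarith

variable [IsProbabilityMeasure P]

/-- Second-order Taylor bound for `exp (i x)` on the whole line: by the exponential series for
`|x| ≤ 1`, and term by term for `|x| ≥ 1`. -/
theorem norm_cexp_mul_I_sub_le (x : ℝ) :
    ‖Complex.exp ((x : ℂ) * Complex.I) - (1 + (x : ℂ) * Complex.I - ((x ^ 2 / 2 : ℝ) : ℂ))‖ ≤
      4 * |x| ^ 3 := by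
  have hn : ‖(x : ℂ) * Complex.I‖ = |x| := by simp
  rcases le_total |x| 1 with h | h
  · have h1 := Complex.exp_bound (x := (x : ℂ) * Complex.I) (by rw [hn]; exact h)
      (n := 3) (by norm_num)
    rw [hn] at h1
    have e : ∑ m ∈ Finset.range 3, ((x : ℂ) * Complex.I) ^ m / (m.factorial : ℂ) =
        1 + (x : ℂ) * Complex.I - ((x ^ 2 / 2 : ℝ) : ℂ) := by
      simp only [Finset.sum_range_succ, Finset.sum_range_zero, mul_pow, Complex.I_sq]
      push_cast
      norm_num [Nat.factorial]
      ring
    rw [e] at h1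
    refine h1.trans ?_
    rw [mul_comm (4 : ℝ)]
    refine mul_le_mul_of_nonneg_left ?_ (by positivity)
    norm_num [Nat.factorial]
  · have h1 : ‖Complex.exp ((x : ℂ) * Complex.I)‖ = 1 := Complex.norm_exp_ofReal_mul_I x
    have h2 : ‖(1 + (x : ℂ) * Complex.I - ((x ^ 2 / 2 : ℝ) : ℂ))‖ ≤ 1 + |x| + |x| ^ 2 / 2 := by
      refine (norm_sub_le _ _).trans (add_le_add ((norm_add_le _ _).trans ?_) ?_)
      · rw [hn]; simp
      · rw [Complex.norm_real, Real.norm_eq_abs, abs_of_nonneg (by positivity), sq_abs]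
    refine (norm_sub_le _ _).trans ?_
    rw [h1]
    nlinarith [mul_nonneg (sub_nonneg.2 h) (sub_nonneg.2 h),
      pow_le_pow_right₀ h (show 2 ≤ 3 by norm_num),
      pow_le_pow_right₀ h (show 1 ≤ 3 by norm_num), pow_le_pow_right₀ h (show 0 ≤ 3 by norm_num)]

/-- Sub-Gaussian variables are centred: `exp (t ^ 2 / 2) - E exp (t ξ)` is minimal at `t = 0`. -/
theorem integral_eq_zero_of_hasSubgaussianMGF {ξ : Ω → ℝ} (h : HasSubgaussianMGF ξ 1 P) :
    ∫ ω, ξ ω ∂P = 0 := by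
  have h0 : (0 : ℝ) ∈ interior (integrableExpSet ξ P) := by
    rw [h.integrableExpSet_eq_univ]; simp
  have h1 : HasDerivAt (mgf ξ P) (∫ ω, ξ ω ∂P) 0 := by
    simpa using hasDerivAt_mgf h0
  have h2 : HasDerivAt (fun t : ℝ => Real.exp (t ^ 2 / 2)) 0 0 := by
    have := ((hasDerivAt_pow 2 (0 : ℝ)).div_const 2).exp
    simpa using this
  have h3 : IsLocalMin (fun t => Real.exp (t ^ 2 / 2) - mgf ξ P t) 0 := by
    refine Eventually.of_forall fun t => ?_
    have := h.mgf_le t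
    simp at this ⊢
    exact this
  have := h3.hasDerivAt_eq_zero (h2.sub h1)
  simpa using this

theorem abs_pow_le_exp_add_exp_neg (x : ℝ) (k : ℕ) :
    |x| ^ k ≤ k.factorial * (Real.exp x + Real.exp (-x)) := by
  have h1 := Real.pow_div_factorial_le_exp _ (abs_nonneg x) k
  have h2 : Real.exp |x| ≤ Real.exp x + Real.exp (-x) := by
    rcases abs_cases x with ⟨h, _⟩ | ⟨h, _⟩ <;> rw [h]
    · linarith [Real.exp_pos (-x)]
    · linarith [Real.exp_pos x]
  rw [div_le_iff₀ (by positivity), mul_comm] at h1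
  exact h1.trans (mul_le_mul_of_nonneg_left h2 (by positivity))

/-- Second-order expansion of the characteristic function of the noise, with a uniform
third-order remainder. -/
theorem norm_integral_cexp_sub_le {ξ : Ω → ℝ} (h : HasSubgaussianMGF ξ 1 P) {c b : ℝ}
    (hc : variance ξ P = c) (hb : |b| ≤ 1 / 2) :
    ‖∫ ω, Complex.exp (((b * ξ ω : ℝ) : ℂ) * Complex.I) ∂P -
      Complex.exp ((-(c * b ^ 2 / 2) : ℝ) : ℂ)‖ ≤ 104 * |b| ^ 3 := by
  obtain ⟨hi, hle⟩ := integrable_exp_abs_of_hasSubgaussianMGF h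
  have hm : AEMeasurable ξ P := h.aemeasurable
  have hL : MemLp ξ 2 P := by simpa using h.memLp 2
  have h0 := integral_eq_zero_of_hasSubgaussianMGF h
  have hI1 : Integrable ξ P := h.integrable
  have hI2 : Integrable (fun ω => ξ ω ^ 2) P := hL.integrable_sq
  have hsq : ∫ ω, ξ ω ^ 2 ∂P = c := by
    rw [← hc, variance_of_integral_eq_zero hm h0]
  -- `x ^ 2 ≤ 2 (exp x + exp (-x))`, and the exponential moments sum to at most `4`
  have hc8 : c ≤ 8 := by
    have h1 : ∫ ω, ξ ω ^ 2 ∂P ≤ ∫ ω, 2 * (Real.exp (ξ ω) + Real.exp (-ξ ω)) ∂P := by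
      refine integral_mono hI2 (hi.const_mul 2) fun ω => ?_
      simpa [Nat.factorial] using abs_pow_le_exp_add_exp_neg (ξ ω) 2
    rw [hsq, integral_const_mul] at h1
    linarith
  have hc0 : 0 ≤ c := hc ▸ variance_nonneg _ _
  have hE : Integrable (fun ω => Complex.exp (((b * ξ ω : ℝ) : ℂ) * Complex.I)) P := by
    refine Integrable.of_bound (C := 1) ?_ (Eventually.of_forall fun ω => ?_)
    · refine AEMeasurable.aestronglyMeasurable ?_
      fun_prop
    · rw [Complex.norm_exp_ofReal_mul_I]
  have hQ : Integrable (fun ω => (1 + ((b * ξ ω : ℝ) : ℂ) * Complex.I -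
      (((b * ξ ω) ^ 2 / 2 : ℝ) : ℂ))) P := by
    refine ((integrable_const _).add ((hI1.const_mul b).ofReal.mul_const _)).sub ?_
    refine Integrable.ofReal ?_
    simp_rw [mul_pow]
    exact (hI2.const_mul _).div_const _
  have hQi : ∫ ω, (1 + ((b * ξ ω : ℝ) : ℂ) * Complex.I - (((b * ξ ω) ^ 2 / 2 : ℝ) : ℂ)) ∂P =
      ((1 - c * b ^ 2 / 2 : ℝ) : ℂ) := by
    rw [integral_sub, integral_add, integral_const, integral_mul_const,
      integral_complex_ofReal, integral_complex_ofReal, integral_const_mul, h0]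
    · have : ∫ ω, (b * ξ ω) ^ 2 / 2 ∂P = c * b ^ 2 / 2 := by
        simp_rw [mul_pow]
        rw [integral_div, integral_const_mul, hsq, mul_comm]
      rw [this]
      simp
    · exact integrable_const _
    · exact (hI1.const_mul b).ofReal.mul_const _
    · exact (integrable_const _).add ((hI1.const_mul b).ofReal.mul_const _)
    · refine Integrable.ofReal ?_
      simp_rw [mul_pow]
      exact (hI2.const_mul _).div_const _
  have h1 : ‖∫ ω, Complex.exp (((b * ξ ω : ℝ) : ℂ) * Complex.I) ∂P -
      ((1 - c * b ^ 2 / 2 : ℝ) : ℂ)‖ ≤ 96 * |b| ^ 3 := by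
    rw [← hQi, ← integral_sub hE hQ]
    calc _ ≤ ∫ ω, 24 * |b| ^ 3 * (Real.exp (ξ ω) + Real.exp (-ξ ω)) ∂P := by
          refine norm_integral_le_of_norm_le (hi.const_mul _) (Eventually.of_forall fun ω => ?_)
          refine (norm_cexp_mul_I_sub_le _).trans ?_
          rw [abs_mul, mul_pow]
          have : |ξ ω| ^ 3 ≤ 6 * (Real.exp (ξ ω) + Real.exp (-ξ ω)) := by
            simpa [Nat.factorial] using abs_pow_le_exp_add_exp_neg (ξ ω) 3
          have hb3 : 0 ≤ |b| ^ 3 := by positivity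
          nlinarith
      _ ≤ 96 * |b| ^ 3 := by
          rw [integral_const_mul]
          have hb3 : 0 ≤ |b| ^ 3 := by positivity
          nlinarith
  have h2 : ‖((1 - c * b ^ 2 / 2 : ℝ) : ℂ) - Complex.exp ((-(c * b ^ 2 / 2) : ℝ) : ℂ)‖ ≤
      8 * |b| ^ 3 := by
    rw [← Complex.ofReal_exp, ← Complex.ofReal_sub, Complex.norm_real, Real.norm_eq_abs,
      abs_sub_comm]
    have hb2 : b ^ 2 ≤ 1 / 4 := by rw [← sq_abs]; nlinarith [abs_nonneg b]
    have hy0 : 0 ≤ c * b ^ 2 / 2 := by positivity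
    have hy1 : c * b ^ 2 / 2 ≤ 4 * b ^ 2 := by nlinarith [sq_nonneg b]
    have h3 := Real.abs_exp_sub_one_sub_id_le (x := -(c * b ^ 2 / 2))
      (by rw [abs_neg, abs_of_nonneg hy0]; linarith)
    have e : Real.exp (-(c * b ^ 2 / 2)) - (1 - c * b ^ 2 / 2) =
        Real.exp (-(c * b ^ 2 / 2)) - 1 - -(c * b ^ 2 / 2) := by ring
    rw [e]
    refine h3.trans ?_
    have h4 : (-(c * b ^ 2 / 2)) ^ 2 ≤ (4 * b ^ 2) ^ 2 := by
      rw [neg_sq]; exact pow_le_pow_left₀ hy0 hy1 2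
    refine h4.trans ?_
    rw [← sq_abs b]
    have h5 : 0 ≤ |b| ^ 3 := by positivity
    nlinarith
  calc _ ≤ 96 * |b| ^ 3 + 8 * |b| ^ 3 := by
        refine le_trans ?_ (add_le_add h1 h2)
        rw [← dist_eq_norm, ← dist_eq_norm, ← dist_eq_norm]
        exact dist_triangle _ _ _
    _ = 104 * |b| ^ 3 := by ring

theorem norm_prod_sub_prod_le {ι : Type*} (T : Finset ι) (z w : ι → ℂ) (hz : ∀ i, ‖z i‖ ≤ 1)
    (hw : ∀ i, ‖w i‖ ≤ 1) : ‖∏ i ∈ T, z i - ∏ i ∈ T, w i‖ ≤ ∑ i ∈ T, ‖z i - w i‖ := by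
  classical
  induction T using Finset.induction_on with
  | empty => simp
  | insert a T ha ih =>
    rw [Finset.prod_insert ha, Finset.prod_insert ha, Finset.sum_insert ha]
    have e : z a * ∏ i ∈ T, z i - w a * ∏ i ∈ T, w i =
        (z a - w a) * ∏ i ∈ T, z i + w a * (∏ i ∈ T, z i - ∏ i ∈ T, w i) := by ring
    rw [e]
    refine (norm_add_le _ _).trans (add_le_add ?_ ?_)
    · rw [norm_mul, norm_prod]
      exact mul_le_of_le_one_right (norm_nonneg _)
        (Finset.prod_le_one (fun _ _ => norm_nonneg _) fun i _ => hz i)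
    · rw [norm_mul]
      exact (mul_le_of_le_one_left (norm_nonneg _) (hw a)).trans ih

/-- Quantitative central limit theorem for linear forms in the noise: the error is of the order of
the largest coefficient. -/
theorem norm_integral_cexp_sum_sub_le {n : ℕ} {ξ : Fin n → Ω → ℝ} (hind : iIndepFun ξ P)
    (hsub : ∀ k, HasSubgaussianMGF (ξ k) 1 P) {c : ℝ} (hc : ∀ k, variance (ξ k) P = c)
    (hc0 : 0 ≤ c) (b : Fin n → ℝ) {η : ℝ} (hη : η ≤ 1 / 2) (hb : ∀ k, |b k| ≤ η) :
    ‖∫ ω, Complex.exp (((∑ k, b k * ξ k ω : ℝ) : ℂ) * Complex.I) ∂P -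
      Complex.exp ((-(c * (∑ k, b k ^ 2) / 2) : ℝ) : ℂ)‖ ≤ 104 * η * ∑ k, b k ^ 2 := by
  have hm : ∀ k, AEMeasurable (fun ω => b k * ξ k ω) P := fun k =>
    (hsub k).aemeasurable.const_mul _
  have hind' : iIndepFun (fun k ω => b k * ξ k ω) P :=
    hind.comp (fun k x => b k * x) fun k => measurable_const_mul _
  have e1 : ∫ ω, Complex.exp (((∑ k, b k * ξ k ω : ℝ) : ℂ) * Complex.I) ∂P =
      ∏ k, ∫ ω, Complex.exp (((b k * ξ k ω : ℝ) : ℂ) * Complex.I) ∂P := by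
    have h := congrFun (hind'.charFun_map_fun_sum_eq_prod hm) 1
    rw [Finset.prod_apply] at h
    have h' : ∀ {f : Ω → ℝ}, AEMeasurable f P → charFun (P.map f) 1 =
        ∫ ω, Complex.exp (((f ω : ℝ) : ℂ) * Complex.I) ∂P := by
      intro f hf
      rw [charFun_apply_real, integral_map hf (by fun_prop)]
      simp
    rw [h' (Finset.aemeasurable_fun_sum _ fun k _ => hm k)] at h
    rw [h]
    exact Finset.prod_congr rfl fun k _ => h' (hm k)
  have e2 : Complex.exp ((-(c * (∑ k, b k ^ 2) / 2) : ℝ) : ℂ) =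
      ∏ k, Complex.exp ((-(c * b k ^ 2 / 2) : ℝ) : ℂ) := by
    rw [← Complex.exp_sum, ← Complex.ofReal_sum]
    congr 2
    rw [Finset.mul_sum, Finset.sum_div, Finset.sum_neg_distrib]
  rw [e1, e2, Finset.mul_sum]
  refine (norm_prod_sub_prod_le _ _ _ (fun k => ?_) fun k => ?_).trans
    (Finset.sum_le_sum fun k _ => ?_)
  · refine (norm_integral_le_of_norm_le_const (C := 1)
      (Eventually.of_forall fun ω => ?_)).trans (by simp)
    rw [Complex.norm_exp_ofReal_mul_I]
  · rw [← Complex.ofReal_exp, Complex.norm_real, Real.norm_eq_abs, Real.abs_exp,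
      Real.exp_le_one_iff]
    have : 0 ≤ c * b k ^ 2 / 2 := by positivity
    linarith
  · refine (norm_integral_cexp_sub_le (hsub k) (hc k) ((hb k).trans hη)).trans ?_
    have h1 : |b k| ^ 3 = |b k| * b k ^ 2 := by rw [← sq_abs (b k)]; ring
    rw [h1]
    nlinarith [mul_le_mul_of_nonneg_right (hb k) (sq_nonneg (b k))]

end noise

/-! ### Linear functionals of the oracle estimator -/

section invGram

variable {n d m : ℕ} {X : Matrix (Fin n) (Idx d m) ℝ} {S : Finset (Idx d m)} {δ : ℝ}

lemma posSemidef_invGram (X : Matrix (Fin n) (Idx d m) ℝ) (S : Finset (Idx d m)) :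
    (invGram X S).PosSemidef := by
  refine Matrix.PosSemidef.inv (Matrix.PosSemidef.smul ?_ (by positivity))
  simpa using Matrix.posSemidef_conjTranspose_mul_self (subMatrix X S)

lemma invGram_eq (hn : 0 < n) (h : IsUnit ((subMatrix X S)ᵀ * subMatrix X S).det) :
    invGram X S = (n : ℝ) • ((subMatrix X S)ᵀ * subMatrix X S)⁻¹ := by
  have hn' : (n : ℝ) ≠ 0 := by exact_mod_cast hn.ne'
  rw [invGram]
  refine Matrix.inv_eq_right_inv ?_
  rw [Matrix.smul_mul, Matrix.mul_smul, smul_smul, Matrix.mul_nonsing_inv _ h, one_div,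
    inv_mul_cancel₀ hn', one_smul]

lemma dotProduct_invGram (hn : 0 < n) (h : IsUnit ((subMatrix X S)ᵀ * subMatrix X S).det)
    (w w' : S → ℝ) : w ⬝ᵥ (invGram X S *ᵥ w') =
      n * (w ⬝ᵥ (((subMatrix X S)ᵀ * subMatrix X S)⁻¹ *ᵥ w')) := by
  rw [invGram_eq hn h, Matrix.smul_mulVec, dotProduct_smul, smul_eq_mul]

lemma abs_dotProduct_invGram_le (hn : 0 < n) (hδ : δ < 1)
    (hA : ∀ u : S → ℝ, (n : ℝ) * (1 - δ) * ∑ i, u i ^ 2 ≤ ∑ k, ((subMatrix X S *ᵥ u) k) ^ 2)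
    (w w' : S → ℝ) : |w ⬝ᵥ (invGram X S *ᵥ w')| ≤ 1 / (1 - δ) * (l2 w * l2 w') := by
  have hn' : (0 : ℝ) < n := by exact_mod_cast hn
  have hd : 0 < 1 - δ := by linarith
  have ha : 0 < (n : ℝ) * (1 - δ) := by positivity
  rw [dotProduct_invGram hn (isUnit_det_gram ha hA), abs_mul, abs_of_pos hn']
  set H := ((subMatrix X S)ᵀ * subMatrix X S)⁻¹
  have h1 : |w ⬝ᵥ (H *ᵥ w')| ≤ l2 w * l2 (H *ᵥ w') := by
    refine abs_le.2 ⟨?_, sum_mul_le_l2 _ _⟩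
    have := sum_mul_le_l2 (-w) (H *ᵥ w')
    rw [l2_neg] at this
    have e : ∑ i, (-w) i * (H *ᵥ w') i = -(w ⬝ᵥ (H *ᵥ w')) := by
      simp [dotProduct, Finset.sum_neg_distrib]
    linarith
  have h2 : n * l2 (H *ᵥ w') ≤ 1 / (1 - δ) * l2 w' := by
    rw [one_div, le_inv_mul_iff₀ hd]
    linarith [l2_gram_inv_le ha hA w']
  calc (n : ℝ) * |w ⬝ᵥ (H *ᵥ w')| ≤ n * (l2 w * l2 (H *ᵥ w')) :=
        mul_le_mul_of_nonneg_left h1 hn'.le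
    _ = l2 w * (n * l2 (H *ᵥ w')) := by ring
    _ ≤ l2 w * (1 / (1 - δ) * l2 w') := mul_le_mul_of_nonneg_left h2 (l2_nonneg _)
    _ = _ := by ring

lemma sum_sq_le_dotProduct_invGram (hn : 0 < n) (hδ : 0 ≤ δ)
    (hA : ∀ u : S → ℝ, ∑ k, ((subMatrix X S *ᵥ u) k) ^ 2 ≤ (n : ℝ) * (1 + δ) * ∑ i, u i ^ 2)
    (h : IsUnit ((subMatrix X S)ᵀ * subMatrix X S).det) (w : S → ℝ) :
    ∑ q, w q ^ 2 ≤ (1 + δ) * (w ⬝ᵥ (invGram X S *ᵥ w)) := by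
  rw [dotProduct_invGram hn h]
  have := sum_sq_le_gram_inv (by positivity) hA h w
  linarith

lemma sqrt_row_le_maxRowNorm (k : Fin n) :
    Real.sqrt (∑ q, subMatrix X S k q ^ 2) ≤ maxRowNorm X S :=
  le_ciSup (f := fun k : Fin n => Real.sqrt (∑ q, subMatrix X S k q ^ 2))
    (Set.finite_range _).bddAbove k

/-- The coefficients of the noise variables in the linear functional `w` of the normalized error
of the oracle estimator. -/
def olsCoeff (X : Matrix (Fin n) (Idx d m) ℝ) (S : Finset (Idx d m)) (σ : ℝ) (w : S → ℝ) :
    Fin n → ℝ :=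
  (Real.sqrt n * σ) • (subMatrix X S *ᵥ (((subMatrix X S)ᵀ * subMatrix X S)⁻¹ *ᵥ w))

lemma sum_sq_olsCoeff (hn : 0 < n) (h : IsUnit ((subMatrix X S)ᵀ * subMatrix X S).det) (σ : ℝ)
    (w : S → ℝ) : ∑ k, olsCoeff X S σ w k ^ 2 = σ ^ 2 * (w ⬝ᵥ (invGram X S *ᵥ w)) := by
  rw [dotProduct_invGram hn h, ← sum_sq_mulVec_gram_inv h]
  simp only [olsCoeff, Pi.smul_apply, smul_eq_mul, mul_pow]
  rw [← Finset.mul_sum, Real.sq_sqrt (Nat.cast_nonneg n)]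
  ring

lemma abs_olsCoeff_le (hn : 0 < n) (hδ : δ < 1) {σ : ℝ} (hσ : 0 ≤ σ)
    (hA : ∀ u : S → ℝ, (n : ℝ) * (1 - δ) * ∑ i, u i ^ 2 ≤ ∑ k, ((subMatrix X S *ᵥ u) k) ^ 2)
    (w : S → ℝ) (k : Fin n) : |olsCoeff X S σ w k| ≤
      σ / (1 - δ) * l2 w * (maxRowNorm X S / Real.sqrt n) := by
  have hn' : (0 : ℝ) < n := by exact_mod_cast hn
  have hd : 0 < 1 - δ := by linarith
  have ha : 0 < (n : ℝ) * (1 - δ) := by positivity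
  have hs : 0 < Real.sqrt n := Real.sqrt_pos.2 hn'
  have hss : Real.sqrt n * Real.sqrt n = n := Real.mul_self_sqrt hn'.le
  set H := ((subMatrix X S)ᵀ * subMatrix X S)⁻¹ with hH
  have h2 : n * l2 (H *ᵥ w) ≤ 1 / (1 - δ) * l2 w := by
    rw [one_div, le_inv_mul_iff₀ hd]
    linarith [l2_gram_inv_le ha hA w]
  have h3 : |(subMatrix X S *ᵥ (H *ᵥ w)) k| ≤ maxRowNorm X S * l2 (H *ᵥ w) := by
    have e : ∀ v : S → ℝ, (subMatrix X S *ᵥ v) k ≤ maxRowNorm X S * l2 v := fun v =>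
      (sum_mul_le_l2 (subMatrix X S k) v).trans
        (mul_le_mul_of_nonneg_right (sqrt_row_le_maxRowNorm k) (l2_nonneg _))
    refine abs_le.2 ⟨?_, e _⟩
    have := e (-(H *ᵥ w))
    rw [l2_neg, Matrix.mulVec_neg, Pi.neg_apply] at this
    linarith
  have hB : 0 ≤ maxRowNorm X S := (Real.sqrt_nonneg _).trans (sqrt_row_le_maxRowNorm k)
  rw [olsCoeff, Pi.smul_apply, smul_eq_mul, abs_mul, abs_of_nonneg (by positivity)]
  calc Real.sqrt n * σ * |(subMatrix X S *ᵥ (H *ᵥ w)) k|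
      ≤ Real.sqrt n * σ * (maxRowNorm X S * l2 (H *ᵥ w)) :=
        mul_le_mul_of_nonneg_left h3 (by positivity)
    _ = σ * (maxRowNorm X S / Real.sqrt n) * ((Real.sqrt n * Real.sqrt n) * l2 (H *ᵥ w)) := by
        field_simp
    _ = σ * (maxRowNorm X S / Real.sqrt n) * (n * l2 (H *ᵥ w)) := by rw [hss]
    _ ≤ σ * (maxRowNorm X S / Real.sqrt n) * (1 / (1 - δ) * l2 w) :=
        mul_le_mul_of_nonneg_left h2 (by positivity)
    _ = _ := by ring

lemma sum_mul_oracleOLS_sub {β : Idx d m → ℝ} {σ : ℝ}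
    (h : IsUnit ((subMatrix X (supp β))ᵀ * subMatrix X (supp β)).det) (ξ : Fin n → ℝ)
    (w : supp β → ℝ) :
    ∑ q, w q * (Real.sqrt n * (oracleOLS X (response X β σ ξ) (supp β) q - β q)) =
      ∑ k, olsCoeff X (supp β) σ w k * ξ k := by
  simp only [oracleOLS_response h, olsCoeff]
  set A := subMatrix X (supp β) with hA
  have e : w ⬝ᵥ ((Aᵀ * A)⁻¹ *ᵥ (Aᵀ *ᵥ ξ)) = (A *ᵥ ((Aᵀ * A)⁻¹ *ᵥ w)) ⬝ᵥ ξ := by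
    have ht : ((Aᵀ * A)⁻¹)ᵀ = (Aᵀ * A)⁻¹ := by
      rw [Matrix.transpose_nonsing_inv, Matrix.transpose_mul, Matrix.transpose_transpose]
    rw [Matrix.dotProduct_mulVec, Matrix.dotProduct_mulVec, ← Matrix.mulVec_transpose,
      ← Matrix.mulVec_transpose, ht, Matrix.transpose_transpose]
  simp only [dotProduct] at e
  calc _ = Real.sqrt n * σ * ∑ q, w q * ((Aᵀ * A)⁻¹ *ᵥ (Aᵀ *ᵥ ξ)) q := by
        rw [Finset.mul_sum]; exact Finset.sum_congr rfl fun q _ => by ring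
    _ = _ := by
        rw [e, Finset.mul_sum]
        exact Finset.sum_congr rfl fun k _ => by simp only [Pi.smul_apply, smul_eq_mul]; ring

end invGram

/-! ### Comparison of characteristic functions -/

section compare

variable {Ω : Type*} [MeasurableSpace Ω] {P : Measure Ω} [IsProbabilityMeasure P]

lemma norm_cexp_mul_I_sub_cexp_mul_I_le (x y : ℝ) :
    ‖Complex.exp ((x : ℂ) * Complex.I) - Complex.exp ((y : ℂ) * Complex.I)‖ ≤ |x - y| := by
  have e : Complex.exp ((x : ℂ) * Complex.I) - Complex.exp ((y : ℂ) * Complex.I) =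
      Complex.exp ((y : ℂ) * Complex.I) * (Complex.exp (Complex.I * ((x - y : ℝ) : ℂ)) - 1) := by
    rw [mul_sub, ← Complex.exp_add, mul_one]
    congr 2
    push_cast; ring
  rw [e, norm_mul, Complex.norm_exp_ofReal_mul_I, one_mul]
  exact Real.norm_exp_I_mul_ofReal_sub_one_le

/-- Characteristic functions of variables that are close off a set of small probability. The set `E`
need not be measurable. -/
lemma norm_integral_cexp_sub_integral_cexp_le {f g : Ω → ℝ} (hf : AEMeasurable f P)
    (hg : AEMeasurable g P) {E : Set Ω} {ε r : ℝ} (hε : 0 ≤ ε) (hr : 0 ≤ r)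
    (hE : P E ≤ ENNReal.ofReal ε) (hfg : ∀ ω, ω ∉ E → |f ω - g ω| ≤ r) :
    ‖∫ ω, Complex.exp ((f ω : ℂ) * Complex.I) ∂P -
      ∫ ω, Complex.exp ((g ω : ℂ) * Complex.I) ∂P‖ ≤ 2 * ε + r := by
  have hi : ∀ {f : Ω → ℝ}, AEMeasurable f P →
      Integrable (fun ω => Complex.exp ((f ω : ℂ) * Complex.I)) P := by
    intro f hf
    refine Integrable.of_bound (C := 1) ?_ (Eventually.of_forall fun ω => ?_)
    · refine AEMeasurable.aestronglyMeasurable ?_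
      fun_prop
    · rw [Complex.norm_exp_ofReal_mul_I]
  set T := toMeasurable P E
  have hT : MeasurableSet T := measurableSet_toMeasurable P E
  have hPT : P.real T ≤ ε := by
    rw [Measure.real, measure_toMeasurable]
    exact ENNReal.toReal_le_of_le_ofReal hε hE
  have hbi : Integrable (fun ω => T.indicator (fun _ => (2 : ℝ)) ω + r) P :=
    ((integrable_const _).indicator hT).add (integrable_const _)
  rw [← integral_sub (hi hf) (hi hg)]
  calc _ ≤ ∫ ω, (T.indicator (fun _ => (2 : ℝ)) ω + r) ∂P := by
        refine norm_integral_le_of_norm_le hbi (Eventually.of_forall fun ω => ?_)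
        by_cases hω : ω ∈ T
        · rw [Set.indicator_of_mem hω]
          refine (norm_sub_le _ _).trans ?_
          rw [Complex.norm_exp_ofReal_mul_I, Complex.norm_exp_ofReal_mul_I]
          linarith
        · rw [Set.indicator_of_notMem hω, zero_add]
          exact (norm_cexp_mul_I_sub_cexp_mul_I_le _ _).trans
            (hfg ω fun h => hω (subset_toMeasurable P E h))
    _ = P.real T * 2 + r := by
        rw [integral_add ((integrable_const _).indicator hT) (integrable_const _),
          integral_indicator_const _ hT]
        simp
    _ ≤ 2 * ε + r := by linarith

end compare

/-! ### Measurability of the estimators -/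

section measurability

variable {n d m : ℕ} {Ω : Type*} [MeasurableSpace Ω]

lemma measurable_mulVec {ι κ : Type*} [Fintype ι] [Fintype κ] (A : Matrix κ ι ℝ) {f : Ω → ι → ℝ}
    (hf : Measurable f) : Measurable fun ω => A *ᵥ f ω :=
  (Continuous.matrix_mulVec continuous_const continuous_id).measurable.comp hf

lemma measurable_thr {f : Ω → Idx d m → ℝ} {lam : Ω → ℝ} (hf : Measurable f)
    (hlam : Measurable lam) (s₀ : ℕ) : Measurable fun ω => thr (lam ω) s₀ (f ω) := by
  have hc : ∀ p, Measurable fun ω => f ω p := fun p => measurable_pi_iff.1 hf p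
  have h1 : ∀ p, Measurable fun ω => thrElem (lam ω) (f ω) p := fun p =>
    Measurable.ite (measurableSet_le hlam (hc p).abs) (hc p) measurable_const
  refine measurable_pi_iff.2 fun p => ?_
  exact Measurable.ite (measurableSet_le ((hlam.pow_const 2).const_mul _)
    (Finset.measurable_fun_sum _ fun i _ => (h1 (i, p.2)).pow_const 2)) (h1 p) measurable_const

lemma measurable_gradStep (X : Matrix (Fin n) (Idx d m) ℝ) {Y : Ω → Fin n → ℝ}
    {f : Ω → Idx d m → ℝ} (hY : Measurable Y) (hf : Measurable f) :
    Measurable fun ω => gradStep X (Y ω) (f ω) :=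
  hf.add ((measurable_mulVec Xᵀ (f := fun ω => Y ω - X *ᵥ f ω)
    (hY.sub (measurable_mulVec X hf))).const_smul (1 / (n : ℝ)))

lemma measurable_lamZero (X : Matrix (Fin n) (Idx d m) ℝ) (κ σ : ℝ) :
    Measurable fun Y => lamZero X Y κ σ := by
  have h1 : Measurable fun Y : Fin n → ℝ => (1 / (n : ℝ)) • (Xᵀ *ᵥ Y) :=
    (measurable_mulVec Xᵀ measurable_id).const_smul (1 / (n : ℝ))
  exact (h1.norm.add_const _).div_const _

lemma measurable_lamSeq (κ lamInfty : ℝ) (t : ℕ) :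
    Measurable fun lam₀ => lamSeq κ lam₀ lamInfty t := by
  induction t with
  | zero => exact measurable_id
  | succ t ih => exact (ih.const_mul κ).max measurable_const

lemma measurable_dsihtIter (X : Matrix (Fin n) (Idx d m) ℝ) (κ σ lamInfty : ℝ) (s₀ t : ℕ) :
    Measurable fun Y => dsihtIter X Y κ (lamZero X Y κ σ) lamInfty s₀ t := by
  induction t with
  | zero => exact measurable_const
  | succ t ih =>
    exact measurable_thr (measurable_gradStep X measurable_id ih)
      ((measurable_lamSeq κ lamInfty t).comp (measurable_lamZero X κ σ)) s₀

/-- The number of first-stage iterations depends on the data, so the output is measurable as a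
countable gluing of the iterates. -/
lemma measurable_dsiht (X : Matrix (Fin n) (Idx d m) ℝ) (κ σ lamInfty : ℝ) (s₀ : ℕ) :
    Measurable fun Y => dsiht X Y κ σ lamInfty s₀ := by
  have hN : Measurable fun Y : Fin n → ℝ =>
      (⌈Real.log (lamInfty / lamZero X Y κ σ) / Real.log κ⌉ + 1).toNat := by
    refine (measurable_of_countable fun z : ℤ => (z + 1).toNat).comp ?_
    exact Int.measurable_ceil.comp
      ((Real.measurable_log.comp ((measurable_lamZero X κ σ).const_div _)).div_const _)
  exact (measurable_from_prod_countable_left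
    (f := fun q : (Fin n → ℝ) × ℕ => dsihtIter X q.1 κ (lamZero X q.1 κ σ) lamInfty s₀ q.2)
    fun t => measurable_dsihtIter X κ σ lamInfty s₀ t).comp (measurable_id.prodMk hN)

lemma measurable_secondStage (X : Matrix (Fin n) (Idx d m) ℝ) (μ : ℝ) (s₀ : ℕ)
    {Y : Ω → Fin n → ℝ} {f : Ω → Idx d m → ℝ} (hY : Measurable Y) (hf : Measurable f) (t : ℕ) :
    Measurable fun ω => secondStage X (Y ω) μ s₀ (f ω) t := by
  induction t with
  | zero => exact hf
  | succ t ih => exact measurable_thr (measurable_gradStep X hY ih) measurable_const s₀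

lemma measurable_twoStage (X : Matrix (Fin n) (Idx d m) ℝ) (κ δ σ : ℝ) (s s₀ t : ℕ) :
    Measurable fun Y => twoStage X Y κ δ σ s s₀ t :=
  measurable_secondStage X _ s₀ measurable_id (measurable_dsiht X κ σ _ s₀) t

lemma measurable_oracleOLS (X : Matrix (Fin n) (Idx d m) ℝ) (S : Finset (Idx d m)) :
    Measurable fun Y => oracleOLS X Y S :=
  measurable_mulVec _ (measurable_mulVec _ measurable_id)

lemma aemeasurable_response (X : Matrix (Fin n) (Idx d m) ℝ) (β : Idx d m → ℝ) (σ : ℝ)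
    {P : Measure Ω} {ξ : Fin n → Ω → ℝ} (hξ : ∀ k, AEMeasurable (ξ k) P) :
    AEMeasurable (fun ω => response X β σ fun k => ξ k ω) P :=
  ((aemeasurable_pi_lambda _ hξ).const_smul σ).const_add _

end measurability

/-! ### Limits of the characteristic functions -/

section oneSize

variable {n d m s s₀ : ℕ} {X : Matrix (Fin n) (Idx d m) ℝ} {β : Idx d m → ℝ} {κ δ σ : ℝ}
  {Ω : Type*} [MeasurableSpace Ω] {P : Measure Ω} {ξ : Fin n → Ω → ℝ}

lemma Conditions.gram_bounds (h : Conditions X β κ δ σ s s₀) (u : supp β → ℝ) :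
    (n : ℝ) * (1 - δ) * ∑ i, u i ^ 2 ≤ ∑ k, ((subMatrix X (supp β) *ᵥ u) k) ^ 2 ∧
      ∑ k, ((subMatrix X (supp β) *ᵥ u) k) ^ 2 ≤ (n : ℝ) * (1 + δ) * ∑ i, u i ^ 2 :=
  h.vecRIP.subMatrix_bounds
    (by rw [← groupSupp_eq]; exact h.card_groupSupp_le.trans (Nat.le_add_right _ _))
    (h.card_supp_le.trans (Nat.le_add_right _ _)) u

/-- The normalized error of the oracle estimator on the support. -/
def oracleErr (X : Matrix (Fin n) (Idx d m) ℝ) (β : Idx d m → ℝ) (σ : ℝ) (ξ : Fin n → ℝ) :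
    supp β → ℝ :=
  fun q => Real.sqrt n * (oracleOLS X (response X β σ ξ) (supp β) q - β q)

/-- The normalized error of the two-stage estimator on the support. -/
def twoStageErr (X : Matrix (Fin n) (Idx d m) ℝ) (β : Idx d m → ℝ) (κ δ σ : ℝ) (s s₀ t : ℕ)
    (ξ : Fin n → ℝ) : supp β → ℝ :=
  fun q => Real.sqrt n * (twoStage X (response X β σ ξ) κ δ σ s s₀ t q - β q)

lemma aemeasurable_oracleErr (hξ : ∀ k, AEMeasurable (ξ k) P) (q : supp β) :
    AEMeasurable (fun ω => oracleErr X β σ (fun k => ξ k ω) q) P :=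
  (((measurable_pi_iff.1 (measurable_oracleOLS X (supp β)) q).comp_aemeasurable
    (aemeasurable_response X β σ hξ)).sub_const _).const_mul _

lemma aemeasurable_twoStageErr (hξ : ∀ k, AEMeasurable (ξ k) P) (t : ℕ) (q : supp β) :
    AEMeasurable (fun ω => twoStageErr X β κ δ σ s s₀ t (fun k => ξ k ω) q) P :=
  (((measurable_pi_iff.1 (measurable_twoStage X κ δ σ s s₀ t) q).comp_aemeasurable
    (aemeasurable_response X β σ hξ)).sub_const _).const_mul _

/-- Gaussian approximation of a linear functional of the oracle error. The error `η` is of the order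
of the maximal row norm over `√n`. -/
lemma norm_integral_cexp_oracleErr_sub_le [IsProbabilityMeasure P]
    (h : Conditions X β κ δ σ s s₀) (hn : 0 < n) (h1 : δ < 1) (hσ : 0 < σ) (hind : iIndepFun ξ P)
    (hsub : ∀ k, HasSubgaussianMGF (ξ k) 1 P) {c : ℝ} (hc : ∀ k, variance (ξ k) P = c)
    (hc0 : 0 ≤ c) {w : supp β → ℝ} {R η : ℝ} (hw : ∑ q, w q ^ 2 ≤ R)
    (hη : σ / (1 - δ) * Real.sqrt R * (maxRowNorm X (supp β) / Real.sqrt n) = η)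
    (hη2 : η ≤ 1 / 2) :
    ‖∫ ω, Complex.exp (((∑ q, w q * oracleErr X β σ (fun k => ξ k ω) q : ℝ) : ℂ) * Complex.I) ∂P -
      Complex.exp (-((c * σ ^ 2 * (w ⬝ᵥ (invGram X (supp β) *ᵥ w)) / 2 : ℝ) : ℂ))‖ ≤
      η * (104 * σ ^ 2 * (1 / (1 - δ)) * R) := by
  have hn' : (0 : ℝ) < n := by exact_mod_cast hn
  have hd : 0 < 1 - δ := by linarith
  have hA := fun u => (h.gram_bounds u).1
  have hdet := h.isUnit_det hn h1
  have hB : 0 ≤ maxRowNorm X (supp β) := Real.iSup_nonneg fun _ => Real.sqrt_nonneg _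
  have hη0 : 0 ≤ η := by rw [← hη]; positivity
  have hlw : l2 w ≤ Real.sqrt R := Real.sqrt_le_sqrt hw
  have hb : ∀ k, |olsCoeff X (supp β) σ w k| ≤ η := fun k => by
    refine (abs_olsCoeff_le hn h1 hσ.le hA w k).trans ?_
    rw [← hη]
    gcongr
  have h2 := norm_integral_cexp_sum_sub_le hind hsub hc hc0 (olsCoeff X (supp β) σ w) hη2 hb
  rw [sum_sq_olsCoeff hn hdet] at h2
  have h3 : w ⬝ᵥ (invGram X (supp β) *ᵥ w) ≤ 1 / (1 - δ) * R := by
    refine (le_abs_self _).trans ((abs_dotProduct_invGram_le hn h1 hA w w).trans ?_)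
    rw [← pow_two, l2_sq]
    gcongr
  have e : ∀ ω, ∑ q, w q * oracleErr X β σ (fun k => ξ k ω) q =
      ∑ k, olsCoeff X (supp β) σ w k * ξ k ω := fun ω =>
    sum_mul_oracleOLS_sub hdet (fun k => ξ k ω) w
  simp only [e]
  have e2 : c * σ ^ 2 * (w ⬝ᵥ (invGram X (supp β) *ᵥ w)) / 2 =
      c * (σ ^ 2 * (w ⬝ᵥ (invGram X (supp β) *ᵥ w))) / 2 := by ring
  rw [e2, ← Complex.ofReal_neg]
  refine h2.trans ?_
  calc 104 * η * (σ ^ 2 * (w ⬝ᵥ (invGram X (supp β) *ᵥ w)))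
      ≤ 104 * η * (σ ^ 2 * (1 / (1 - δ) * R)) := by gcongr
    _ = _ := by ring

/-- On good noise realizations a linear functional hardly distinguishes the two errors. The bound
for the iterates needs a nonempty support; otherwise both functionals vanish. -/
lemma GoodNoise.abs_sum_mul_sub_le {δW C y δT z₁ z₂ zS W : ℝ} {N a : ℕ} {ζ : Fin n → ℝ}
    (hg : GoodNoise X β κ δ σ s s₀ N a z₁ z₂ zS ζ)
    (h : Conditions X β κ δ σ s s₀) (ht : Tuned κ δ δW C y s s₀ N a δT z₁ z₂ zS W) (hn : 0 < n)
    (h0 : 0 < δ) (hκ : δ < κ) (hκ1 : κ < 1) (hσ : 0 < σ) (hδW : 0 ≤ δW)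
    (hrate : lossConst δ * δW ≤ rate δ) (t : ℕ) {w : supp β → ℝ} {R r : ℝ}
    (hw : ∑ q, w q ^ 2 ≤ R)
    (hr : Real.sqrt R * (Real.sqrt n * (rate δ ^ t *
      (stageConst κ δ σ * Real.sqrt ((s : ℝ) * s₀ * Delta d m s s₀ / n)))) ≤ r) (hr0 : 0 ≤ r) :
    |∑ q, w q * twoStageErr X β κ δ σ s s₀ t ζ q - ∑ q, w q * oracleErr X β σ ζ q| ≤ r := by
  rcases (supp β).eq_empty_or_nonempty with he | hne
  · have : IsEmpty (supp β) := by rw [he]; infer_instance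
    simpa using hr0
  set Y := response X β σ ζ with hY
  set D := twoStage X Y κ δ σ s s₀ t - oracleVec X Y (supp β) with hD
  have h1 := hg.l2_twoStage_sub_le h ht hn h0 hκ hκ1 hσ hδW hrate hne t
  have e : ∑ q, w q * twoStageErr X β κ δ σ s s₀ t ζ q - ∑ q, w q * oracleErr X β σ ζ q =
      Real.sqrt n * ∑ q, w q * D q := by
    rw [← Finset.sum_sub_distrib, Finset.mul_sum]
    refine Finset.sum_congr rfl fun q _ => ?_
    simp only [twoStageErr, oracleErr, hD, Pi.sub_apply, oracleVec, q.2, dif_pos, ← hY]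
    ring
  have hlD : l2 (fun q : supp β => D q) ≤ l2 D := by
    refine Real.sqrt_le_sqrt ?_
    rw [Finset.sum_coe_sort (supp β) fun q => D q ^ 2]
    exact Finset.sum_le_univ_sum_of_nonneg fun _ => sq_nonneg _
  have hlw : l2 w ≤ Real.sqrt R := Real.sqrt_le_sqrt hw
  have h2 : |∑ q, w q * D q| ≤ Real.sqrt R * l2 D := by
    have h3 : l2 w * l2 (fun q : supp β => D q) ≤ Real.sqrt R * l2 D :=
      mul_le_mul hlw hlD (l2_nonneg _) (Real.sqrt_nonneg _)
    refine abs_le.2 ⟨?_, (sum_mul_le_l2 w fun q : supp β => D q).trans h3⟩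
    have h4 := sum_mul_le_l2 (-w) fun q : supp β => D q
    rw [l2_neg] at h4
    simp only [Pi.neg_apply, neg_mul, Finset.sum_neg_distrib] at h4
    linarith
  rw [e, abs_mul, abs_of_nonneg (Real.sqrt_nonneg _)]
  refine le_trans ?_ hr
  calc Real.sqrt n * |∑ q, w q * D q| ≤ Real.sqrt n * (Real.sqrt R * l2 D) :=
        mul_le_mul_of_nonneg_left h2 (Real.sqrt_nonneg _)
    _ = Real.sqrt R * (Real.sqrt n * l2 D) := by ring
    _ ≤ _ := by gcongr

end oneSize

section sequences

variable {d m s s₀ t : ℕ → ℕ} {X : ∀ n, Matrix (Fin n) (Idx (d n) (m n)) ℝ}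
  {β : ∀ n, Idx (d n) (m n) → ℝ} {κ δ σ c : ℝ}
  {Ω : ℕ → Type*} [∀ n, MeasurableSpace (Ω n)] {P : ∀ n, Measure (Ω n)}
  [∀ n, IsProbabilityMeasure (P n)] {ξ : ∀ n, Fin n → Ω n → ℝ}

lemma tendsto_maxRowNorm_div_sqrt
    (hB : (fun n => maxRowNorm (X n) (supp (β n)) ^ 3) =o[atTop] (fun n : ℕ => Real.sqrt n)) :
    Tendsto (fun n : ℕ => maxRowNorm (X n) (supp (β n)) / Real.sqrt n) atTop (𝓝 0) := by
  have h1 : Tendsto (fun n : ℕ => 1 / Real.sqrt n) atTop (𝓝 0) := by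
    simp only [one_div]
    exact tendsto_inv_atTop_zero.comp (Real.tendsto_sqrt_atTop.comp tendsto_natCast_atTop_atTop)
  have h2 := hB.tendsto_div_nhds_zero.add h1
  rw [add_zero] at h2
  have h0 : ∀ n, 0 ≤ maxRowNorm (X n) (supp (β n)) := fun n =>
    Real.iSup_nonneg fun _ => Real.sqrt_nonneg _
  refine squeeze_zero (fun n => div_nonneg (h0 n) (Real.sqrt_nonneg _)) (fun n => ?_) h2
  rw [← add_div]
  refine div_le_div_of_nonneg_right ?_ (Real.sqrt_nonneg _)
  have h3 := h0 n
  nlinarith [mul_nonneg h3 (sq_nonneg (maxRowNorm (X n) (supp (β n)) - 1)),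
    sq_nonneg (maxRowNorm (X n) (supp (β n)) - 1)]

lemma tendsto_integral_cexp_oracleErr (h1 : δ < 1) (hσ : 0 < σ)
    (hind : ∀ n, iIndepFun (ξ n) (P n)) (hsub : ∀ n k, HasSubgaussianMGF (ξ n k) 1 (P n))
    (hc : ∀ n k, variance (ξ n k) (P n) = c) (hc0 : 0 ≤ c)
    (hB : (fun n => maxRowNorm (X n) (supp (β n)) ^ 3) =o[atTop] (fun n : ℕ => Real.sqrt n))
    (hcond : ∀ᶠ n : ℕ in atTop, Conditions (X n) (β n) κ δ σ (s n) (s₀ n))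
    (w : ∀ n, supp (β n) → ℝ) (hw : ∃ R, ∀ᶠ n in atTop, ∑ q, w n q ^ 2 ≤ R) :
    Tendsto (fun n => ∫ ω, Complex.exp
        (((∑ q, w n q * oracleErr (X n) (β n) σ (fun k => ξ n k ω) q : ℝ) : ℂ) * Complex.I) ∂(P n) -
      Complex.exp (-((c * σ ^ 2 * (w n ⬝ᵥ (invGram (X n) (supp (β n)) *ᵥ w n)) / 2 : ℝ) : ℂ)))
      atTop (𝓝 0) := by
  obtain ⟨R, hR⟩ := hw
  have hη := (tendsto_maxRowNorm_div_sqrt hB).const_mul (σ / (1 - δ) * Real.sqrt R)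
  rw [mul_zero] at hη
  have hlim := hη.mul_const (104 * σ ^ 2 * (1 / (1 - δ)) * R)
  rw [zero_mul] at hlim
  refine squeeze_zero_norm' ?_ hlim
  filter_upwards [hR, hcond, eventually_gt_atTop 0,
    hη.eventually_le_const (show (0 : ℝ) < 1 / 2 by norm_num)] with n hRn hn hpos hηn
  exact norm_integral_cexp_oracleErr_sub_le hn hpos h1 hσ (hind n) (hsub n) (hc n) hc0 hRn rfl hηn

/-- After `log n / log (1 / ρ)` steps a contraction with factor `ρ` has gained the factor `1 / n`,
which beats the normalization `√n` of a bounded initial error. -/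
lemma tendsto_iteration_error {ρ C M R : ℝ} (hρ : 0 < ρ) (hC : C = 1 / Real.log (1 / ρ))
    (hρ1 : ρ < 1) {T : ℕ → ℕ} {u : ℕ → ℝ} (hM : 0 ≤ M)
    (hu : (fun n => u n) =O[atTop] (fun n : ℕ => (n : ℝ)))
    (hT : ∀ᶠ n : ℕ in atTop, C * Real.log n ≤ T n) :
    Tendsto (fun n : ℕ => Real.sqrt R * (Real.sqrt n * (ρ ^ T n * (M * Real.sqrt (u n / n)))))
      atTop (𝓝 0) := by
  obtain ⟨B, hB⟩ := hu.bound
  have h1 : Tendsto (fun n : ℕ => Real.sqrt R * (M * Real.sqrt B) * (1 / Real.sqrt n)) atTop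
      (𝓝 0) := by
    have h : Tendsto (fun n : ℕ => 1 / Real.sqrt n) atTop (𝓝 0) := by
      simp only [one_div]
      exact tendsto_inv_atTop_zero.comp (Real.tendsto_sqrt_atTop.comp tendsto_natCast_atTop_atTop)
    simpa using h.const_mul (Real.sqrt R * (M * Real.sqrt B))
  refine squeeze_zero' (Eventually.of_forall fun n => by positivity) ?_ h1
  filter_upwards [hB, hT, eventually_gt_atTop 0] with n hBn hTn hn
  have hn' : (0 : ℝ) < n := by exact_mod_cast hn
  have hL : 0 < Real.log (1 / ρ) := Real.log_pos (by rw [lt_div_iff₀ hρ]; linarith)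
  have h2 : ρ ^ T n ≤ 1 / n := by
    have h3 : Real.log n ≤ T n * Real.log (1 / ρ) := by
      rw [hC, one_div_mul_eq_div, div_le_iff₀ hL] at hTn
      exact hTn
    rw [one_div ρ, Real.log_inv] at h3
    rw [← Real.log_le_log_iff (by positivity) (by positivity), Real.log_pow, one_div, Real.log_inv]
    linarith
  have h4 : Real.sqrt (u n / n) ≤ Real.sqrt B := by
    refine Real.sqrt_le_sqrt ?_
    rw [div_le_iff₀ hn']
    refine (le_abs_self _).trans ?_
    simpa [abs_of_pos hn'] using hBn
  have h5 : Real.sqrt n * (1 / n) = 1 / Real.sqrt n := by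
    rw [mul_one_div, Real.sqrt_div_self']
  calc Real.sqrt R * (Real.sqrt n * (ρ ^ T n * (M * Real.sqrt (u n / n))))
      ≤ Real.sqrt R * (Real.sqrt n * (1 / n * (M * Real.sqrt B))) := by gcongr
    _ = Real.sqrt R * (M * Real.sqrt B) * (Real.sqrt n * (1 / n)) := by ring
    _ = _ := by rw [h5]

/-- The linear functionals of the two-stage error and of the oracle error have the same limit law.
-/
lemma tendsto_integral_cexp_twoStageErr_sub (h0 : 0 < δ) (hκ : δ < κ) (hκ1 : κ < 1) (hσ : 0 < σ)
    (hind : ∀ n, iIndepFun (ξ n) (P n)) (hsub : ∀ n k, HasSubgaussianMGF (ξ n k) 1 (P n))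
    (hd : Tendsto d atTop atTop) (hm : Tendsto m atTop atTop)
    (hO : (fun n => (s n : ℝ) * s₀ n * Delta (d n) (m n) (s n) (s₀ n))
      =O[atTop] (fun n : ℕ => (n : ℝ)))
    (hcond : ∀ᶠ n : ℕ in atTop, Conditions (X n) (β n) κ δ σ (s n) (s₀ n))
    (ht : ∀ᶠ n : ℕ in atTop, 1 / Real.log (1 / rate δ) * Real.log n ≤ t n)
    (w : ∀ n, supp (β n) → ℝ) (hw : ∃ R, ∀ᶠ n in atTop, ∑ q, w n q ^ 2 ≤ R) :
    Tendsto (fun n => ∫ ω, Complex.exp (((∑ q, w n q *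
        twoStageErr (X n) (β n) κ δ σ (s n) (s₀ n) (t n) (fun k => ξ n k ω) q : ℝ) : ℂ) *
          Complex.I) ∂(P n) -
      ∫ ω, Complex.exp (((∑ q, w n q * oracleErr (X n) (β n) σ (fun k => ξ n k ω) q : ℝ) : ℂ) *
        Complex.I) ∂(P n)) atTop (𝓝 0) := by
  obtain ⟨R, hR⟩ := hw
  have h1 : δ < 1 := hκ.trans hκ1
  obtain ⟨δW, C, y, η, hη, hδW, hrate, hC, -, hCy, htuned⟩ := exists_tuned h0 hκ hκ1
  have hM : 0 ≤ stageConst κ δ σ := by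
    have := Clam_pos h0 hκ
    have hd : 0 < 1 - δ := by linarith
    have hA : 0 ≤ Acst κ δ := by unfold Acst; positivity
    unfold stageConst; positivity
  have hρ := rate_pos h0 h1
  have hlim := ((tendsto_badBound (by linarith : 0 < C) hη hd hm).const_mul 2).add
    (tendsto_iteration_error (R := R) hρ rfl (rate_lt_one h0 h1) hM hO ht)
  rw [mul_zero, add_zero] at hlim
  have hlarge : ∀ᶠ n in atTop, Real.log 41 ≤ 1 / 20 * Real.log (d n) :=
    ((Real.tendsto_log_atTop.comp (tendsto_natCast_atTop_atTop.comp hd)).const_mul_atTop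
      (by norm_num : (0 : ℝ) < 1 / 20)).eventually_ge_atTop _
  refine squeeze_zero_norm' ?_ hlim
  filter_upwards [hR, hcond, eventually_gt_atTop 0, hlarge] with n hRn hn hpos hln
  obtain ⟨N, a, δT, z₁, z₂, zS, W, htn⟩ := htuned (s n) (s₀ n) hn.one_le_s hn.one_le_s₀
  have hξ : ∀ k, AEMeasurable (ξ n k) (P n) := fun k => (hsub n k).aemeasurable
  have hr0 : 0 ≤ Real.sqrt R * (Real.sqrt n * (rate δ ^ t n * (stageConst κ δ σ *
      Real.sqrt ((s n : ℝ) * s₀ n * Delta (d n) (m n) (s n) (s₀ n) / n)))) := by positivity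
  refine norm_integral_cexp_sub_integral_cexp_le
    (Finset.aemeasurable_fun_sum _ fun q _ =>
      (aemeasurable_twoStageErr hξ (t n) q).const_mul (w n q))
    (Finset.aemeasurable_fun_sum _ fun q _ => (aemeasurable_oracleErr hξ q).const_mul (w n q))
    (by unfold badBound; positivity) hr0
    (measure_not_goodNoise_le_badBound (hind n) (hsub n) hn htn hpos h0 hκ hκ1 hσ hC hη hCy hln)
    fun ω hω => ?_
  exact (not_not.1 hω).abs_sum_mul_sub_le hn htn hpos h0 hκ hκ1 hσ hδW hrate (t n) hRn le_rfl hr0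

/-- A sequence of random vectors indexed by the supports is asymptotically normal as soon as the
characteristic functions of its bounded linear functionals have Gaussian limits. -/
lemma asymptoticallyNormal_invGram (h0 : 0 < δ) (h1 : δ < 1)
    (hcond : ∀ᶠ n : ℕ in atTop, Conditions (X n) (β n) κ δ σ (s n) (s₀ n)) {v : ℝ} (hv : 0 ≤ v)
    {Z : ∀ n, Ω n → supp (β n) → ℝ} (hZ : ∀ n q, AEMeasurable (fun ω => Z n ω q) (P n))
    (hchar : ∀ w : ∀ n, supp (β n) → ℝ, (∃ R, ∀ᶠ n in atTop, ∑ q, w n q ^ 2 ≤ R) →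
      Tendsto (fun n => ∫ ω, Complex.exp (((∑ q, w n q * Z n ω q : ℝ) : ℂ) * Complex.I) ∂(P n) -
        Complex.exp (-((v * (w n ⬝ᵥ (invGram (X n) (supp (β n)) *ᵥ w n)) / 2 : ℝ) : ℂ)))
        atTop (𝓝 0)) :
    AsymptoticallyNormal P Z (fun n => invGram (X n) (supp (β n))) v := by
  have hd : 0 < 1 - δ := by linarith
  refine asymptoticallyNormal_of_functionals (L := 1 / (1 - δ)) (L' := 1 + δ) hv hZ
    (Eventually.of_forall fun n => posSemidef_invGram _ _) ?_ ?_ (by positivity) (by positivity)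
    hchar
  · filter_upwards [hcond, eventually_gt_atTop 0] with n hn hpos
    exact abs_dotProduct_invGram_le hpos h1 fun u => (hn.gram_bounds u).1
  · filter_upwards [hcond, eventually_gt_atTop 0] with n hn hpos
    exact sum_sq_le_dotProduct_invGram hpos h0.le (fun u => (hn.gram_bounds u).2)
      (hn.isUnit_det hpos h1)

end sequences

end

end DoubleSparse

theorem theorem2p3 (δ : ℝ) (hδ₀ : 0 < δ) (hδ₁ : δ < 1) :
    ∃ C : ℝ, 0 < C ∧
      ∀ (κ σ c : ℝ), δ < κ → κ < 1 → 0 < σ →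
      ∀ (d m s s₀ t : ℕ → ℕ)
        (X : ∀ n, Matrix (Fin n) (DoubleSparse.Idx (d n) (m n)) ℝ)
        (β : ∀ n, DoubleSparse.Idx (d n) (m n) → ℝ)
        (Ω : ℕ → Type*) [∀ n, MeasurableSpace (Ω n)]
        (P : ∀ n, Measure (Ω n)) [∀ n, IsProbabilityMeasure (P n)]
        (ξ : ∀ n, Fin n → Ω n → ℝ),
        -- independent 1-sub-Gaussian noise (hence centred) with common variance `c`
        (∀ n, iIndepFun (ξ n) (P n)) →
        (∀ n k, HasSubgaussianMGF (ξ n k) 1 (P n)) →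
        (∀ n k, variance (ξ n k) (P n) = c) →
        -- the asymptotic regime
        Tendsto d atTop atTop →
        Tendsto m atTop atTop →
        (fun n => (s n : ℝ) * s₀ n * DoubleSparse.Delta (d n) (m n) (s n) (s₀ n))
          =O[atTop] (fun n : ℕ => (n : ℝ)) →
        (fun n => DoubleSparse.maxRowNorm (X n) (DoubleSparse.supp (β n)) ^ 3)
          =o[atTop] (fun n : ℕ => Real.sqrt n) →
        -- the conditions on design and signal
        (∀ᶠ n : ℕ in atTop, DoubleSparse.Conditions (X n) (β n) κ δ σ (s n) (s₀ n)) →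
        -- at least `C log n` second-stage iterations
        (∀ᶠ n : ℕ in atTop, C * Real.log n ≤ t n) →
        DoubleSparse.AsymptoticallyNormal P
          (fun n ω (q : DoubleSparse.supp (β n)) => Real.sqrt n *
            (DoubleSparse.twoStage (X n)
              (DoubleSparse.response (X n) (β n) σ (fun k => ξ n k ω))
              κ δ σ (s n) (s₀ n) (t n) q - β n q))
          (fun n => DoubleSparse.invGram (X n) (DoubleSparse.supp (β n))) (c * σ ^ 2) ∧
        DoubleSparse.AsymptoticallyNormal P
          (fun n ω (q : DoubleSparse.supp (β n)) => Real.sqrt n *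
            (DoubleSparse.oracleOLS (X n)
              (DoubleSparse.response (X n) (β n) σ (fun k => ξ n k ω))
              (DoubleSparse.supp (β n)) q - β n q))
          (fun n => DoubleSparse.invGram (X n) (DoubleSparse.supp (β n))) (c * σ ^ 2) := by
  have hρ := DoubleSparse.rate_pos hδ₀ hδ₁
  refine ⟨1 / Real.log (1 / DoubleSparse.rate δ), one_div_pos.2 (Real.log_pos ?_), ?_⟩
  · rw [lt_div_iff₀ hρ, one_mul]
    exact DoubleSparse.rate_lt_one hδ₀ hδ₁
  intro κ σ c hκ hκ1 hσ d m s s₀ t X β Ω _ P _ ξ hind hsub hc hd hm hO hB hcond ht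
  have hc0 : 0 ≤ c := hc 1 0 ▸ variance_nonneg _ _
  have hv : 0 ≤ c * σ ^ 2 := by positivity
  have hξ : ∀ n k, AEMeasurable (ξ n k) (P n) := fun n k => (hsub n k).aemeasurable
  have horacle := DoubleSparse.tendsto_integral_cexp_oracleErr (κ := κ) hδ₁ hσ hind hsub hc hc0 hB
    hcond
  refine ⟨DoubleSparse.asymptoticallyNormal_invGram hδ₀ hδ₁ hcond hv
    (fun n q => DoubleSparse.aemeasurable_twoStageErr (hξ n) (t n) q) fun w hw => ?_,
    DoubleSparse.asymptoticallyNormal_invGram hδ₀ hδ₁ hcond hv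
      (fun n q => DoubleSparse.aemeasurable_oracleErr (hξ n) q) horacle⟩
  have h := (DoubleSparse.tendsto_integral_cexp_twoStageErr_sub hδ₀ hκ hκ1 hσ hind hsub hd hm hO
    hcond ht w hw).add (horacle w hw)
  rw [add_zero] at h
  exact h.congr fun n => sub_add_sub_cancel _ _ _
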